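/- Let $\Sigma$ be the 4-punctured sphere, $\pi_1\Sigma=\langle c_1,c_2,c_3,c_4\mid c_1c_2c_3c_4=1\rangle$, and $b=(c_1c_2)^{-1}$. For $\alpha\in(0,2\pi)^4$ with $\sum_i\alpha_i>6\pi$, let $\mathrm{Rep}_\alpha$ be the space (with the quotient topology) of $\mathrm{PSL}_2\mathbb R$-conjugacy classes of homomorphisms $\rho:\pi_1\Sigma\to\mathrm{PSL}_2\mathbb R$ such that $\rho(c_i)$ is a rotation of the hyperbolic plane of angle $\alpha_i$ for every $i$, and let the DT component $\mathrm{Rep}^{DT}_\alpha$ be its compact connected component. The pure mapping class group $\mathrm{PMod}(\Sigma)$, that is, the group of automorphisms of $\pi_1\Sigma$ that preserve the conjugacy class of each $c_i$, modulo inner automorphisms, acts on $\mathrm{Rep}_\alpha$ by precomposition. For $[\rho]\in\mathrm{Rep}^{DT}_\alpha$ let $C_i$ and $B$ be the fixed points of $\rho(c_i)$ and $\rho(b)$ in the hyperbolic plane. The action coordinate $\beta\in(0,2\pi)$ is the rotation angle of $\rho(b)$. If $C_1\ne C_2$ and $C_3\neq C_4$, the angle coordinate $\gamma\in\mathbb R/2\pi\mathbb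 Z$ is the oriented angle at $B$ from the ray $BC_3$ to the ray $BC_2$. Otherwise $[\rho]$ is one of two points, the north pole (with $\beta=\alpha_3+\alpha_4-2\pi$) or the south pole (with $\beta=4\pi-\alpha_1-\alpha_2$), where $\gamma$ is not defined. For real numbers $p,q,r$, a rotation triangle group $D(p,q,r)\subset\mathrm{PSL}_2\mathbb R$ is a group generated by the rotations of angles $2\pi/p$, $2\pi/q$, $2\pi/r$ about the vertices of a hyperbolic triangle with respective interior angles $\pi/p$, $\pi/q$, $\pi/r$. **Lemma.** Let $5\pi/3<\theta<2\pi$ and let $\alpha$ be any ordering of the angles $4\pi/3,\ \theta,\ \theta,\ 2\theta-2\pi$. Then $\mathrm{Rep}^{DT}_\alpha$ contains exactly one $\mathrm{PMod}(\Sigma)$-orbit of length $3$ (the finite orbit of Type III). The image of every representation $\rho$ whose class lies in this orbit is a rotation triangle group $D(2,3,\overline\theta)$, where $\overline\theta=(1-\theta/2\pi)^{-1}$. The action-angle coordinates $(\beta,\gamma)$ of the three points of the orbit are the following. - $\alpha=(4\pi/3,2\theta-2\pi,\theta,\theta)$: $\beta=4\pi/3$ and $\gamma\in\{0,2\pi/3,4\pi/3\}$.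 - $\alpha=(2\theta-2\pi,4\pi/3,\theta,\theta)$: $\beta=4\pi/3$ and $\gamma\in\{\pi/3,\pi,5\pi/3\}$. - $\alpha=(\theta,\theta,4\pi/3,2\theta-2\pi)$: $\beta=2\pi/3$ and $\gamma\in\{\pi/3,\pi,5\pi/3\}$. - $\alpha=(\theta,\theta,2\theta-2\pi,4\pi/3)$: $\beta=2\pi/3$ and $\gamma\in\{0,2\pi/3,4\pi/3\}$. - $\alpha=(4\pi/3,\theta,2\theta-2\pi,\theta)$ or $(\theta,4\pi/3,\theta,2\theta-2\pi)$: two points with $\beta=\pi$ and $\gamma\in\{0,\pi\}$, and the north pole, with $\beta=3\theta-4\pi$. - $\alpha=(2\theta-2\pi,\theta,4\pi/3,\theta)$ or $(\theta,2\theta-2\pi,\theta,4\pi/3)$: two points with $\beta=\pi$ and $\gamma\in\{0,\pi\}$, and the south pole, with $\beta=6\pi-3\theta$. - $\alpha=(4\pi/3,\theta,\theta,2\theta-2\pi)$ or $(\theta,4\pi/3,2\theta-2\pi,\theta)$: two points with $\beta=\pi$ and $\gamma\in\{\pi/2,3\pi/2\}$, and the north pole, with $\beta=3\theta-4\pi$.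 - $\alpha=(\theta,2\theta-2\pi,4\pi/3,\theta)$ or $(2\theta-2\pi,\theta,\theta,4\pi/3)$: two points with $\beta=\pi$ and $\gamma\in\{\pi/2,3\pi/2\}$, and the south pole, with $\beta=6\pi-3\theta$. -/

import Mathlib

open Real UpperHalfPlane
open scoped MatrixGroups ComplexConjugate

noncomputable section

namespace PuncturedSphere

/-! ### The group `PSL(2, ℝ)` and the hyperbolic plane -/

/-- The matrix of the anti-clockwise rotation of the upper half-plane by the angle `φ` about `i`
(it fixes `i`, with derivative `exp (iφ)` there). -/
def rot (φ : ℝ) : SL(2, ℝ) :=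
  ⟨!![cos (φ / 2), sin (φ / 2); -sin (φ / 2), cos (φ / 2)], by
    rw [Matrix.det_fin_two_of]
    nlinarith [sin_sq_add_cos_sq (φ / 2)]⟩

/-- `g` acts on the hyperbolic plane as the anti-clockwise rotation about `z` by the angle `φ`. -/
def IsRotation (g : PSL(2, ℝ)) (z : ℍ) (φ : ℝ) : Prop :=
  ∃ h : SL(2, ℝ), h • I = z ∧ g = ((h * rot φ * h⁻¹ : SL(2, ℝ)) : PSL(2, ℝ))

/-- The Möbius transformation defined by `g` fixes the point `z`. -/
def Fixes (g : PSL(2, ℝ)) (z : ℍ) : Prop :=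
  ∃ A : SL(2, ℝ), (A : PSL(2, ℝ)) = g ∧ A • z = z

/-- The coordinate of `z` in the unit disc model of the hyperbolic plane centred at `B`. It is
conformal and orientation preserving, and geodesic rays from `B` become radii. -/
def discCoord (B z : ℍ) : ℂ :=
  ((z : ℂ) - (B : ℂ)) / ((z : ℂ) - conj (B : ℂ))

/-- For `P` and `Q` different from `B`, the oriented angle at `B`, measured anti-clockwise from
the geodesic ray `BP` to the geodesic ray `BQ`. -/
def orientedAngle (B P Q : ℍ) : Real.Angle :=
  ((discCoord B Q / discCoord B P).arg : Real.Angle)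

/-- The interior angle at `P` of the hyperbolic triangle with vertices `P`, `Q`, `R`. -/
def interiorAngle (P Q R : ℍ) : ℝ :=
  |(discCoord P R / discCoord P Q).arg|

/-- `Γ` is a rotation triangle group `D(p, q, r)`, for real numbers `p`, `q`, `r`: it is generated
by the rotations by `2π/p`, `2π/q`, `2π/r` about the vertices of some hyperbolic triangle whose
interior angles are `π/p`, `π/q`, `π/r`. -/
def IsRotationTriangleGroup (p q r : ℝ) (Γ : Subgroup PSL(2, ℝ)) : Prop :=
  ∃ P Q R : ℍ, P ≠ Q ∧ Q ≠ R ∧ R ≠ P ∧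
    interiorAngle P Q R = π / p ∧ interiorAngle Q R P = π / q ∧ interiorAngle R P Q = π / r ∧
    Γ = Subgroup.closure
      {g | IsRotation g P (2 * π / p) ∨ IsRotation g Q (2 * π / q) ∨ IsRotation g R (2 * π / r)}

/-! ### The fundamental group and the pure mapping class group -/

/-- The fundamental group `⟨c₁, c₂, c₃, c₄ | c₁ c₂ c₃ c₄ = 1⟩` of the 4-punctured sphere. -/
abbrev SphereGroup : Type :=
  PresentedGroup
    ({FreeGroup.of 0 * FreeGroup.of 1 * FreeGroup.of 2 * FreeGroup.of 3} :
      Set (FreeGroup (Fin 4)))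

/-- The peripheral generators; indices start at `0`, so `c 0`, ..., `c 3` are `c₁`, `c₂`, `c₃`, `c₄`. -/
def SphereGroup.c (i : Fin 4) : SphereGroup := PresentedGroup.of i

/-- The simple closed curve `b = (c₁ c₂)⁻¹`, which defines the standard pants decomposition. -/
def SphereGroup.b : SphereGroup := (SphereGroup.c 0 * SphereGroup.c 1)⁻¹

/-- The automorphisms of the fundamental group that preserve the conjugacy class of every
peripheral generator. By the Dehn–Nielsen–Baer theorem, the quotient of this group by the inner
automorphisms is the pure mapping class group of the 4-punctured sphere. Inner automorphisms act
trivially on conjugacy classes of representations, so the two groups have the same orbits there. -/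
def PureAut : Subgroup (MulAut SphereGroup) where
  carrier := {φ | ∀ i, IsConj (SphereGroup.c i) (φ (SphereGroup.c i))}
  one_mem' := fun i => IsConj.refl (SphereGroup.c i)
  mul_mem' := by
    intro φ ψ hφ hψ i
    exact (hφ i).trans (φ.toMonoidHom.map_isConj (hψ i))
  inv_mem' := by
    intro φ hφ i
    have h := (φ⁻¹ : MulAut SphereGroup).toMonoidHom.map_isConj (hφ i)
    have e : (φ⁻¹ : MulAut SphereGroup) (φ (SphereGroup.c i)) = SphereGroup.c i := MulAut.inv_apply_self _ φ (SphereGroup.c i)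
    change IsConj ((φ⁻¹ : MulAut SphereGroup) (SphereGroup.c i)) ((φ⁻¹ : MulAut SphereGroup) (φ (SphereGroup.c i))) at h
    rw [e] at h
    exact h.symm

/-! ### Relative character varieties -/

/-- The representations into `PSL(2, ℝ)` that map each `cᵢ` to a rotation by the angle `αᵢ`. -/
def RelHom (α : Fin 4 → ℝ) : Type :=
  {ρ : SphereGroup →* PSL(2, ℝ) // ∀ i, ∃ z, IsRotation (ρ (SphereGroup.c i)) z (α i)}

/-- The topology of pointwise convergence. -/
instance (α : Fin 4 → ℝ) : TopologicalSpace (RelHom α) :=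
  TopologicalSpace.induced (fun ρ g => ρ.1 g)
    (inferInstance : TopologicalSpace (SphereGroup → PSL(2, ℝ)))

/-- Conjugation of representations by elements of `PSL(2, ℝ)`. -/
instance conjSetoid (α : Fin 4 → ℝ) : Setoid (RelHom α) where
  r ρ ρ' := ∃ h : PSL(2, ℝ), ∀ g, ρ'.1 g = h * ρ.1 g * h⁻¹
  iseqv :=
    { refl := fun ρ => ⟨1, fun g => by simp⟩
      symm := by
        rintro ρ ρ' ⟨h, hh⟩
        exact ⟨h⁻¹, fun g => by rw [hh g]; group⟩
      trans := by
        rintro ρ ρ' ρ'' ⟨h, hh⟩ ⟨k, hk⟩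
        exact ⟨k * h, fun g => by rw [hk g, hh g]; group⟩ }

/-- The relative character variety, with the quotient topology. -/
def CharVar (α : Fin 4 → ℝ) : Type := Quotient (conjSetoid α)

instance (α : Fin 4 → ℝ) : TopologicalSpace (CharVar α) :=
  inferInstanceAs (TopologicalSpace (Quotient (conjSetoid α)))

/-- The conjugacy class of a representation. -/
def CharVar.mk {α : Fin 4 → ℝ} (ρ : RelHom α) : CharVar α := Quotient.mk (conjSetoid α) ρ

/-- The Deroin–Tholozan component: the compact connected component of the relative character
variety, for angles in `(0, 2π)` with `α₁ + α₂ + α₃ + α₄ > 6π`. -/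
def DTComponent (α : Fin 4 → ℝ) : Set (CharVar α) :=
  {x | IsCompact (connectedComponent x)}

/-! ### The action of the pure mapping class group -/

theorem exists_isRotation_conj {g : PSL(2, ℝ)} {φ : ℝ} (hg : ∃ z, IsRotation g z φ)
    (k : PSL(2, ℝ)) : ∃ z, IsRotation (k * g * k⁻¹) z φ := by
  obtain ⟨z, h, -, rfl⟩ := hg
  obtain ⟨K, rfl⟩ := QuotientGroup.mk_surjective k
  refine ⟨(K * h) • I, K * h, rfl, ?_⟩
  rw [← QuotientGroup.mk_inv, ← QuotientGroup.mk_mul, ← QuotientGroup.mk_mul]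
  congr 1
  group

/-- Precomposition of representations with inverses of pure automorphisms. -/
instance (α : Fin 4 → ℝ) : MulAction PureAut (RelHom α) where
  smul φ ρ := ⟨ρ.1.comp ((φ⁻¹ : PureAut) : MulAut SphereGroup).toMonoidHom, fun i => by
    obtain ⟨w, hw⟩ := isConj_iff.mp ((φ⁻¹).2 i)
    have e : (ρ.1.comp ((φ⁻¹ : PureAut) : MulAut SphereGroup).toMonoidHom) (SphereGroup.c i)
        = ρ.1 w * ρ.1 (SphereGroup.c i) * (ρ.1 w)⁻¹ := by
      change ρ.1 (((φ⁻¹ : PureAut) : MulAut SphereGroup) (SphereGroup.c i)) = _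
      rw [← hw, map_mul, map_mul, map_inv]
    rw [e]
    exact exists_isRotation_conj (ρ.2 i) _⟩
  one_smul ρ := Subtype.ext (MonoidHom.ext fun g => by
    change ρ.1 (((1 : PureAut)⁻¹ : MulAut SphereGroup) g) = ρ.1 g
    simp)
  mul_smul φ ψ ρ := Subtype.ext (MonoidHom.ext fun g => by
    change ρ.1 ((((φ * ψ)⁻¹ : PureAut) : MulAut SphereGroup) g)
      = ρ.1 (((ψ⁻¹ : PureAut) : MulAut SphereGroup) (((φ⁻¹ : PureAut) : MulAut SphereGroup) g))
    rw [mul_inv_rev]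
    rfl)

/-- The induced action on conjugacy classes of representations: `φ • [ρ] = [ρ ∘ φ⁻¹]`. -/
instance (α : Fin 4 → ℝ) : MulAction PureAut (CharVar α) where
  smul φ := Quotient.map (fun ρ => φ • ρ) (by
    rintro ρ ρ' ⟨h, hh⟩
    exact ⟨h, fun g => hh (((φ⁻¹ : PureAut) : MulAut SphereGroup) g)⟩)
  one_smul x := by
    induction x using Quotient.inductionOn with
    | h ρ => exact congrArg (Quotient.mk (conjSetoid α)) (one_smul PureAut ρ)
  mul_smul φ ψ x := by
    induction x using Quotient.inductionOn with
    | h ρ => exact congrArg (Quotient.mk (conjSetoid α)) (mul_smul φ ψ ρ)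

/-- `O` is a mapping class group orbit of length 3 contained in the DT component. -/
def IsOrbitOfLengthThree (α : Fin 4 → ℝ) (O : Set (CharVar α)) : Prop :=
  (∃ x, O = MulAction.orbit PureAut x) ∧ O ⊆ DTComponent α ∧ O.ncard = 3

/-! ### Action-angle coordinates -/

/-- A point of the DT component is one of the two poles, or it has an angle coordinate. -/
inductive AngleCoordinate where
  | northPole : AngleCoordinate
  | southPole : AngleCoordinate
  | angle (γ : Real.Angle) : AngleCoordinate

/-- The action coordinate `β` is the angle in `(0, 2π)` of the rotation `ρ(b)`. -/
def HasAction {α : Fin 4 → ℝ} (ρ : RelHom α) (β : ℝ) : Prop :=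
  0 < β ∧ β < 2 * π ∧ ∃ B, IsRotation (ρ.1 SphereGroup.b) B β

/-- Let `Cᵢ` and `B` be the fixed points of `ρ(cᵢ)` and `ρ(b)`. The triangle chain of `ρ` consists
of the triangles `(C₁, C₂, B)` and `(B, C₃, C₄)`. It is singular if one of these is reduced to a
point, that is, if `C₁ = C₂` or `C₃ = C₄`. -/
def IsSingular {α : Fin 4 → ℝ} (ρ : RelHom α) : Prop :=
  (∃ z, Fixes (ρ.1 (SphereGroup.c 0)) z ∧ Fixes (ρ.1 (SphereGroup.c 1)) z) ∨
  (∃ z, Fixes (ρ.1 (SphereGroup.c 2)) z ∧ Fixes (ρ.1 (SphereGroup.c 3)) z)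

/-- The angle between the two triangles of a regular triangle chain: the anti-clockwise angle
at `B` from the ray `BC₃` to the ray `BC₂`. -/
def HasAngle {α : Fin 4 → ℝ} (ρ : RelHom α) (γ : Real.Angle) : Prop :=
  ∃ B C₂ C₃ : ℍ, Fixes (ρ.1 SphereGroup.b) B ∧ Fixes (ρ.1 (SphereGroup.c 1)) C₂ ∧ Fixes (ρ.1 (SphereGroup.c 2)) C₃ ∧
    γ = orientedAngle B C₃ C₂

/-- The action-angle coordinates of a representation. The two poles are the points with singular
triangle chain, the north pole with `β = α₃ + α₄ - 2π`, the south pole with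
`β = 4π - α₁ - α₂`. -/
def RelHom.HasCoordinates {α : Fin 4 → ℝ} (ρ : RelHom α) (β : ℝ) : AngleCoordinate → Prop
  | .northPole => HasAction ρ β ∧ IsSingular ρ ∧ β = α 2 + α 3 - 2 * π
  | .southPole => HasAction ρ β ∧ IsSingular ρ ∧ β = 4 * π - α 0 - α 1
  | .angle γ => HasAction ρ β ∧ ¬ IsSingular ρ ∧ HasAngle ρ γ

/-- The set of action-angle coordinates of the points of `O` (the coordinates of a point do not
depend on the representation chosen in the conjugacy class). -/
def coordinates {α : Fin 4 → ℝ} (O : Set (CharVar α)) : Set (ℝ × AngleCoordinate) :=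
  {p | ∃ ρ : RelHom α, CharVar.mk ρ ∈ O ∧ ρ.HasCoordinates p.1 p.2}

/-- In the DT component with peripheral angles `α`, the action-angle coordinates of the points of
every orbit of length 3 are the elements of `T`. -/
def OrbitCoordinatesAre (α : Fin 4 → ℝ) (T : Set (ℝ × AngleCoordinate)) : Prop :=
  ∀ O : Set (CharVar α), IsOrbitOfLengthThree α O → coordinates O = T

end PuncturedSphere

end

open PuncturedSphere PuncturedSphere.AngleCoordinate

/-! A rotation of angle φ in (0, 2π) about z has exactly one lift to SL(2, ℝ) of trace 2cos(φ/2)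
with negative lower left entry, namely `rotAt φ z`. The four lifts attached to a representation
multiply to 1 or -1. This sign is locally constant, and the classes of sign -1 form a compact clopen
set (`isClopen_sgn`, `isCompact_sgn`), which therefore lies in the DT component. Orbits of length
three have sign -1 (`sgn_of_orbit`): for sign 1 the trace of c₁c₂ has absolute value at least 2, and
the Dehn twist along c₁c₂ cannot have period at most three.

For sign -1 the traces x, y, z of the lifts of c₁c₂, c₂c₃, c₁c₃ determine the class
(`eq_of_traceVec_eq`), since they give the mutual distances of three centres and, through the trace
of the triple product, their orientation. The traces satisfy Fricke's cubic equation. The twist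
along the curve with trace x keeps x and moves the other two traces by an affine map whose linear
part has determinant 1 and trace x² - 2. Away from its fixed points it has period 2 only if x = 0,
and period 3 only if x² = 1. Two of the twists never fix the same class, as this would be a singular
point of the cubic and would force three centres to coincide. These facts determine every orbit of
length three (`IsTwistDynamics.classification`): some twist permutes it cyclically, the
corresponding coefficient k_i of the cubic is 2x with x = ±1, and the traces are x together with
(k_j, 0), (0, k_l) or (0, 0).

With t = 2cos(θ/2), the coefficients are, up to sign, 2 once and t³ - 3t twice, and 0 < |t³ - 3t| <
2. Hence the cyclic twist and all traces are known. The action is read from x = 2cos(β/2), and the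
angle from `angleCos` and `angleSin`, which express the law of cosines and the oriented volume at B
in terms of traces.

For existence, the base representation factors through the free product of cyclic groups generated
by s of order 2 and r of order 3, with c₁, c₂, c₃, c₄ sent to r⁻¹, sr, rs, (sr)². Computing with
integral matrices shows that a pure automorphism acts on this homomorphism, up to conjugation, as
one of three powers of a Dehn twist (`ModularProduct.peripheral_pureAut`), so the orbit has at most
three points. The traces separate three points. Rotations of angles π and 2π/3 with product of angle
θ generate the triangle group. Braids carry one ordering of the angles to all others. -/

noncomputable section
namespace PuncturedSphere

/-! ### Rotations of the hyperbolic plane -/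

/-- The coordinate `u = re / im` of a point of the hyperboloid `w v - u² = 1`, where `v = 1 / im`
and `w = |z|² / im`. -/
def hu (z : ℍ) : ℝ := z.re / z.im

/-- The coordinate `1 / im` of a point of the hyperboloid. -/
def hv (z : ℍ) : ℝ := 1 / z.im

/-- The coordinate `|z|² / im` of a point of the hyperboloid. -/
def hw (z : ℍ) : ℝ := (z.re ^ 2 + z.im ^ 2) / z.im

theorem hw_mul_hv (z : ℍ) : hw z * hv z = 1 + hu z ^ 2 := by
  have := z.im_ne_zero
  simp only [hw, hv, hu]
  field_simp
  ring

theorem hv_pos (z : ℍ) : 0 < hv z := one_div_pos.2 z.im_pos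

theorem ext_hu_hv {z w : ℍ} (hu' : hu z = hu w) (hv' : hv z = hv w) : z = w := by
  have h1 := z.im_ne_zero
  have h2 := w.im_ne_zero
  have h3 : z.im = w.im := by
    simp only [hv] at hv'
    field_simp at hv'
    exact hv'.symm
  refine UpperHalfPlane.ext_re_im ?_ h3
  · simp only [hu, h3] at hu'
    field_simp at hu'
    exact hu'

@[simp] theorem hu_I : hu I = 0 := by simp [hu]
@[simp] theorem hv_I : hv I = 1 := by simp [hv]
@[simp] theorem hw_I : hw I = 1 := by simp [hw]

theorem det_eq {R : Type*} [CommRing R] (h : SL(2, R)) : h 0 0 * h 1 1 - h 0 1 * h 1 0 = 1 := by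
  have := h.det_coe
  rwa [Matrix.det_fin_two] at this

theorem smul_mul_denom (h : SL(2, ℝ)) (z : ℍ) :
    ((h • z : ℍ) : ℂ) * (h 1 0 * z + h 1 1) = h 0 0 * z + h 0 1 := by
  have h0 : ((h 1 0 : ℝ) : ℂ) * z + h 1 1 ≠ 0 := by
    have := UpperHalfPlane.denom_ne_zero (h : GL (Fin 2) ℝ) z
    simpa [UpperHalfPlane.denom] using this
  rw [UpperHalfPlane.coe_specialLinearGroup_apply]
  exact div_mul_cancel₀ _ h0

/-- Let M be the symmetric matrix with rows (w, u) and (u, v), of determinant 1 by `hw_mul_hv`. The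
Möbius action is M ↦ h M hᵀ. Being linear, it turns all later invariance statements into polynomial
identities. -/
theorem smul_coords (h : SL(2, ℝ)) (z : ℍ) :
    hu (h • z) = h 0 0 * h 1 0 * hw z + (h 0 0 * h 1 1 + h 0 1 * h 1 0) * hu z
      + h 0 1 * h 1 1 * hv z ∧
    hv (h • z) = h 1 0 ^ 2 * hw z + 2 * h 1 0 * h 1 1 * hu z + h 1 1 ^ 2 * hv z := by
  have hd := det_eq h
  have e := smul_mul_denom h z
  set Z := h • z with hZ
  have h1 := z.im_pos
  have h2 := Z.im_pos
  have e1 := congrArg Complex.re e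
  have e2 := congrArg Complex.im e
  simp at e1 e2
  generalize h 0 0 = a at *
  generalize h 0 1 = b at *
  generalize h 1 0 = c at *
  generalize h 1 1 = d at *
  simp only [hu, hv, hw]
  generalize z.re = x at *
  generalize z.im = y at *
  generalize Z.re = X at *
  generalize Z.im = Y at *
  clear hZ e
  have h2' := h2.ne'
  have h1' := h1.ne'
  -- The formula Im (h • z) = Im z / |cz + d|², with denominators cleared.
  have key : Y * ((c * x + d) ^ 2 + c ^ 2 * y ^ 2) = y := by
    linear_combination (c * x + d) * e2 - c * y * e1 + y * hd
  have key2 : X * y = Y * (a * c * (x ^ 2 + y ^ 2) + (a * d + b * c) * x + b * d) := by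
    have : (X * ((c * x + d) ^ 2 + c ^ 2 * y ^ 2)) =
      (a * c * (x ^ 2 + y ^ 2) + (a * d + b * c) * x + b * d) := by
      linear_combination (c * x + d) * e1 + c * y * e2
    rw [← this]
    linear_combination -X * key
  constructor
  · field_simp
    linear_combination key2
  · field_simp
    linear_combination -key

theorem hu_smul (h : SL(2, ℝ)) (z : ℍ) :
    hu (h • z) = h 0 0 * h 1 0 * hw z + (h 0 0 * h 1 1 + h 0 1 * h 1 0) * hu z
      + h 0 1 * h 1 1 * hv z := (smul_coords h z).1

theorem hv_smul (h : SL(2, ℝ)) (z : ℍ) :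
    hv (h • z) = h 1 0 ^ 2 * hw z + 2 * h 1 0 * h 1 1 * hu z + h 1 1 ^ 2 * hv z :=
  (smul_coords h z).2

theorem hw_smul (h : SL(2, ℝ)) (z : ℍ) :
    hw (h • z) = h 0 0 ^ 2 * hw z + 2 * h 0 0 * h 0 1 * hu z + h 0 1 ^ 2 * hv z := by
  have hd := det_eq h
  have e := hw_mul_hv (h • z)
  have e' := hw_mul_hv z
  apply mul_right_cancel₀ (hv_pos (h • z)).ne'
  rw [e, hu_smul, hv_smul]
  linear_combination (-(h 0 0 * h 1 1 - h 0 1 * h 1 0) - 1) * hd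
     - (h 0 0 * h 1 1 - h 0 1 * h 1 0) ^ 2 * e'

/-- The canonical lift to `SL(2, ℝ)` of the rotation by `φ` about `z`. -/
def rotAt (φ : ℝ) (z : ℍ) : SL(2, ℝ) :=
  ⟨!![cos (φ / 2) - sin (φ / 2) * hu z, sin (φ / 2) * hw z;
      -sin (φ / 2) * hv z, cos (φ / 2) + sin (φ / 2) * hu z], by
    rw [Matrix.det_fin_two_of]
    linear_combination sin_sq_add_cos_sq (φ / 2) + sin (φ / 2) ^ 2 * hw_mul_hv z⟩

@[simp] theorem rotAt_00 (φ : ℝ) (z : ℍ) :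
    rotAt φ z 0 0 = cos (φ / 2) - sin (φ / 2) * hu z := rfl
@[simp] theorem rotAt_01 (φ : ℝ) (z : ℍ) : rotAt φ z 0 1 = sin (φ / 2) * hw z := rfl
@[simp] theorem rotAt_10 (φ : ℝ) (z : ℍ) : rotAt φ z 1 0 = -sin (φ / 2) * hv z := rfl
@[simp] theorem rotAt_11 (φ : ℝ) (z : ℍ) :
    rotAt φ z 1 1 = cos (φ / 2) + sin (φ / 2) * hu z := rfl

/-! ### Entries of products and inverses of two by two matrices -/

section

variable {R : Type*} [CommRing R]

theorem sl_ext {A B : SL(2, R)} (h00 : A 0 0 = B 0 0) (h01 : A 0 1 = B 0 1)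
    (h10 : A 1 0 = B 1 0) (h11 : A 1 1 = B 1 1) : A = B := by
  ext i j
  fin_cases i <;> fin_cases j <;> assumption

@[simp] theorem mul_00 (A B : SL(2, R)) : (A * B) 0 0 = A 0 0 * B 0 0 + A 0 1 * B 1 0 := by
  simp [Matrix.mul_apply]
@[simp] theorem mul_01 (A B : SL(2, R)) : (A * B) 0 1 = A 0 0 * B 0 1 + A 0 1 * B 1 1 := by
  simp [Matrix.mul_apply]
@[simp] theorem mul_10 (A B : SL(2, R)) : (A * B) 1 0 = A 1 0 * B 0 0 + A 1 1 * B 1 0 := by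
  simp [Matrix.mul_apply]
@[simp] theorem mul_11 (A B : SL(2, R)) : (A * B) 1 1 = A 1 0 * B 0 1 + A 1 1 * B 1 1 := by
  simp [Matrix.mul_apply]
@[simp] theorem inv_00 (A : SL(2, R)) : A⁻¹ 0 0 = A 1 1 := by
  simp [Matrix.SpecialLinearGroup.coe_inv, Matrix.adjugate_fin_two]
@[simp] theorem inv_01 (A : SL(2, R)) : A⁻¹ 0 1 = -A 0 1 := by
  simp [Matrix.SpecialLinearGroup.coe_inv, Matrix.adjugate_fin_two]
@[simp] theorem inv_10 (A : SL(2, R)) : A⁻¹ 1 0 = -A 1 0 := by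
  simp [Matrix.SpecialLinearGroup.coe_inv, Matrix.adjugate_fin_two]
@[simp] theorem inv_11 (A : SL(2, R)) : A⁻¹ 1 1 = A 0 0 := by
  simp [Matrix.SpecialLinearGroup.coe_inv, Matrix.adjugate_fin_two]
@[simp] theorem neg_app (A : SL(2, R)) (i j : Fin 2) : (-A) i j = -A i j := by
  simp [Matrix.SpecialLinearGroup.coe_neg]

end

@[simp] theorem one_00 : (1 : SL(2, ℝ)) 0 0 = 1 := by simp
@[simp] theorem one_01 : (1 : SL(2, ℝ)) 0 1 = 0 := by simp
@[simp] theorem one_10 : (1 : SL(2, ℝ)) 1 0 = 0 := by simp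
@[simp] theorem one_11 : (1 : SL(2, ℝ)) 1 1 = 1 := by simp

/-- The lift is cos(φ/2) + sin(φ/2) Mε, with M the symmetric matrix of z and ε the matrix with rows
(0, 1) and (-1, 0). Since εh⁻¹ = hᵀε, conjugation by h replaces M by h M hᵀ, the matrix of h • z. -/
theorem conj_rotAt (h : SL(2, ℝ)) (φ : ℝ) (z : ℍ) :
    h * rotAt φ z * h⁻¹ = rotAt φ (h • z) := by
  have hd := det_eq h
  apply sl_ext <;> simp only [mul_00, mul_01, mul_10, mul_11, inv_00, inv_01, inv_10, inv_11,
    rotAt_00, rotAt_01, rotAt_10, rotAt_11, hu_smul, hv_smul, hw_smul]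
  · linear_combination cos (φ / 2) * hd
  · ring
  · ring
  · linear_combination cos (φ / 2) * hd

theorem rotAt_I (φ : ℝ) : rotAt φ I = rot φ := by
  apply sl_ext <;> simp [rot]

theorem isRotation_iff {g : PSL(2, ℝ)} {z : ℍ} {φ : ℝ} :
    IsRotation g z φ ↔ g = (rotAt φ z : PSL(2, ℝ)) := by
  constructor
  · rintro ⟨h, rfl, rfl⟩
    rw [← rotAt_I, conj_rotAt]
  · rintro rfl
    refine ⟨z.toSL2R, toSL2R_smul_I z, ?_⟩
    rw [← rotAt_I, conj_rotAt, toSL2R_smul_I]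

/-- The trace. -/
def tr (A : SL(2, ℝ)) : ℝ := A 0 0 + A 1 1

@[simp] theorem tr_rotAt (φ : ℝ) (z : ℍ) : tr (rotAt φ z) = 2 * cos (φ / 2) := by
  simp [tr]; ring

theorem tr_neg (A : SL(2, ℝ)) : tr (-A) = -tr A := by simp [tr]; ring
theorem tr_inv (A : SL(2, ℝ)) : tr A⁻¹ = tr A := by simp [tr]; ring
theorem tr_mul_comm (A B : SL(2, ℝ)) : tr (A * B) = tr (B * A) := by simp [tr]; ring
theorem tr_mul_inv (A B : SL(2, ℝ)) : tr (A * B⁻¹) = tr A * tr B - tr (A * B) := by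
  simp [tr]; ring
theorem tr_conj (A B : SL(2, ℝ)) : tr (A * B * A⁻¹) = tr B := by
  rw [tr_mul_comm, ← mul_assoc, inv_mul_cancel, one_mul]

/-- An elliptic matrix and its inverse have the same trace; the sign of the lower left entry
distinguishes them, that is, it fixes the sense of rotation. -/
theorem eq_rotAt {A : SL(2, ℝ)} {φ : ℝ} (h0 : 0 < φ) (h1 : φ < 2 * π) (hA : A 1 0 < 0)
    (ht : tr A = 2 * cos (φ / 2)) : ∃ z, A = rotAt φ z := by
  have hs : 0 < sin (φ / 2) := sin_pos_of_pos_of_lt_pi (by linarith) (by linarith)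
  have hd := det_eq A
  have hsc := sin_sq_add_cos_sq (φ / 2)
  -- The root in the upper half-plane of the fixed point equation A₁₀z² + (A₁₁ - A₀₀)z - A₀₁ = 0,
  -- whose discriminant is tr² - 4 = -4sin²(φ/2).
  refine ⟨⟨⟨(A 0 0 - A 1 1) / (2 * A 1 0), sin (φ / 2) / (-A 1 0)⟩,
    div_pos hs (by linarith)⟩, ?_⟩
  set z : ℍ := ⟨⟨(A 0 0 - A 1 1) / (2 * A 1 0), sin (φ / 2) / (-A 1 0)⟩,
    div_pos hs (by linarith)⟩ with hz
  have hre : z.re = (A 0 0 - A 1 1) / (2 * A 1 0) := rfl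
  have him : z.im = sin (φ / 2) / (-A 1 0) := rfl
  clear_value z
  unfold tr at ht
  have h10 := hA.ne
  have hu' : sin (φ / 2) * hu z = (A 1 1 - A 0 0) / 2 := by
    simp only [hu, hre, him]
    field_simp
    ring
  have hv' : sin (φ / 2) * hv z = -A 1 0 := by
    simp only [hv, him]
    field_simp
  apply sl_ext <;> simp only [rotAt_00, rotAt_01, rotAt_10, rotAt_11]
  · linarith
  · have := hw_mul_hv z
    apply mul_right_cancel₀ h10
    linear_combination -hd + hsc + sin (φ / 2) ^ 2 * this +
      (sin (φ / 2) * hu z + (A 1 1 - A 0 0) / 2) * hu' + sin (φ / 2) * hw z * (-hv')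
      + (A 0 0 + A 1 1 + 2 * cos (φ / 2)) / 4 * ht
  · linarith
  · linarith

theorem rotAt_10_neg {φ : ℝ} (h0 : 0 < φ) (h1 : φ < 2 * π) (z : ℍ) : rotAt φ z 1 0 < 0 := by
  have hs : 0 < sin (φ / 2) := sin_pos_of_pos_of_lt_pi (by linarith) (by linarith)
  have := mul_pos hs (hv_pos z)
  simp only [rotAt_10]
  linarith

theorem rotAt_injective {φ ψ : ℝ} (h0 : 0 < φ) (h1 : φ < 2 * π) (h0' : 0 < ψ) (h1' : ψ < 2 * π)
    {z w : ℍ} (h : rotAt φ z = rotAt ψ w) : φ = ψ ∧ z = w := by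
  have hs : 0 < sin (φ / 2) := sin_pos_of_pos_of_lt_pi (by linarith) (by linarith)
  have e := congrArg tr h
  simp only [tr_rotAt] at e
  have e' : φ / 2 = ψ / 2 := injOn_cos ⟨by linarith, by linarith⟩ ⟨by linarith, by linarith⟩
    (by linarith)
  obtain rfl : φ = ψ := by linarith
  refine ⟨rfl, ext_hu_hv ?_ ?_⟩
  · have := congrArg (fun A : SL(2, ℝ) => A 1 1) h
    simpa [hs.ne'] using this
  · have := congrArg (fun A : SL(2, ℝ) => A 1 0) h
    simpa [hs.ne'] using this

/-! ### Passage from `SL(2, ℝ)` to `PSL(2, ℝ)` -/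

theorem mk_eq_mk_iff {A B : SL(2, ℝ)} :
    (A : PSL(2, ℝ)) = (B : PSL(2, ℝ)) ↔ A = B ∨ A = -B := by
  rw [QuotientGroup.eq, Matrix.SpecialLinearGroup.mem_center_iff]
  constructor
  · rintro ⟨r, hr, e⟩
    have h0 : A⁻¹ * B = 1 ∨ A⁻¹ * B = -1 := by
      have : r = 1 ∨ r = -1 := by
        simp at hr
        exact hr
      rcases this with rfl | rfl
      · left; ext i j; rw [← e]; simp
      · right; ext i j; rw [← e]; fin_cases i <;> fin_cases j <;> simp
    rcases h0 with h0 | h0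
    · left; exact inv_mul_eq_one.1 h0
    · right
      rw [inv_mul_eq_iff_eq_mul] at h0
      rw [h0]; simp
  · rintro (rfl | rfl)
    · exact ⟨1, by simp, by simp⟩
    · refine ⟨-1, by simp, ?_⟩
      have : (-B)⁻¹ * B = -1 := by
        rw [inv_mul_eq_iff_eq_mul]; simp
      rw [this]
      ext i j; fin_cases i <;> fin_cases j <;> simp

theorem mk_neg (A : SL(2, ℝ)) : ((-A : SL(2, ℝ)) : PSL(2, ℝ)) = (A : PSL(2, ℝ)) :=
  mk_eq_mk_iff.2 (Or.inr rfl)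

/-- Both lifts have a negative lower left entry, so they cannot be opposite. This is what makes the
lift of a rotation canonical. -/
theorem mk_rotAt_injective {φ ψ : ℝ} (h0 : 0 < φ) (h1 : φ < 2 * π) (h0' : 0 < ψ)
    (h1' : ψ < 2 * π) {z w : ℍ} (h : (rotAt φ z : PSL(2, ℝ)) = (rotAt ψ w : PSL(2, ℝ))) :
    φ = ψ ∧ z = w := by
  rcases mk_eq_mk_iff.1 h with h | h
  · exact rotAt_injective h0 h1 h0' h1' h
  · have e := congrArg (fun A : SL(2, ℝ) => A 1 0) h
    have e1 := rotAt_10_neg h0 h1 z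
    have e2 := rotAt_10_neg h0' h1' w
    simp only [neg_app] at e
    linarith

theorem rotAt_smul_self (φ : ℝ) (z : ℍ) : rotAt φ z • z = z := by
  have e := hw_mul_hv z
  have e' := sin_sq_add_cos_sq (φ / 2)
  apply ext_hu_hv
  · rw [hu_smul]
    simp only [rotAt_00, rotAt_01, rotAt_10, rotAt_11]
    linear_combination hu z * e' + sin (φ / 2) ^ 2 * hu z * e
  · rw [hv_smul]
    simp only [rotAt_10, rotAt_11]
    linear_combination hv z * e' + sin (φ / 2) ^ 2 * hv z * e

/-- If the rotation about z fixes w, then by equivariance it commutes with the rotation about w.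
Commuting makes the hyperboloid vectors of z and w proportional, hence equal. -/
theorem eq_of_rotAt_smul {φ : ℝ} (h0 : 0 < φ) (h1 : φ < 2 * π) {z w : ℍ}
    (h : rotAt φ z • w = w) : w = z := by
  have e : rotAt φ z * rotAt φ w * (rotAt φ z)⁻¹ = rotAt φ w := by rw [conj_rotAt, h]
  have hs : 0 < sin (φ / 2) := sin_pos_of_pos_of_lt_pi (by linarith) (by linarith)
  rw [mul_inv_eq_iff_eq_mul] at e
  have e1 := congrArg (fun A : SL(2, ℝ) => A 1 0) e
  have e2 := congrArg (fun A : SL(2, ℝ) => A 0 0) e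
  simp only [mul_00, mul_10, rotAt_00, rotAt_01, rotAt_10, rotAt_11] at e1 e2
  have f1 : hv z * hu w = hu z * hv w := by
    have : 2 * sin (φ / 2) ^ 2 * (hv z * hu w - hu z * hv w) = 0 := by linear_combination e1
    have h3 : (2 * sin (φ / 2) ^ 2) ≠ 0 := by positivity
    have := (mul_eq_zero.1 this).resolve_left h3
    linarith
  have f2 : hw z * hv w = hw w * hv z := by
    have : sin (φ / 2) ^ 2 * (hw z * hv w - hw w * hv z) = 0 := by linear_combination -e2
    have h3 : (sin (φ / 2) ^ 2) ≠ 0 := by positivity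
    have := (mul_eq_zero.1 this).resolve_left h3
    linarith
  have g1 := hw_mul_hv z
  have g2 := hw_mul_hv w
  have p1 := hv_pos z
  have p2 := hv_pos w
  have f3 : hv w = hv z := by
    have : hv w ^ 2 = hv z ^ 2 := by
      linear_combination -hv w ^ 2 * g1 + hv z ^ 2 * g2 + hv z * hv w * f2 +
         (hv z * hu w + hu z * hv w) * f1
    exact (sq_eq_sq₀ p2.le p1.le).1 this
  apply ext_hu_hv _ f3
  rw [f3] at f1
  apply mul_left_cancel₀ p1.ne'
  linarith

theorem neg_smul_eq (A : SL(2, ℝ)) (z : ℍ) : -A • z = A • z := by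
  apply ext_hu_hv
  · simp only [hu_smul, neg_app]; ring
  · simp only [hv_smul, neg_app]; ring

theorem fixes_rotAt_iff {φ : ℝ} (h0 : 0 < φ) (h1 : φ < 2 * π) {z w : ℍ} :
    Fixes (rotAt φ z : PSL(2, ℝ)) w ↔ w = z := by
  constructor
  · rintro ⟨A, hA, hw⟩
    apply eq_of_rotAt_smul h0 h1
    rcases mk_eq_mk_iff.1 hA with rfl | rfl
    · exact hw
    · rwa [neg_smul_eq] at hw
  · rintro rfl
    exact ⟨_, rfl, rotAt_smul_self φ w⟩

end PuncturedSphere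

end

noncomputable section
namespace PuncturedSphere

/-! ### Trace identities -/

theorem tr_mul_mul_mul (A B C : SL(2, ℝ)) :
    tr (A * B * C * B) = tr (A * B) * tr (B * C) - tr A * tr C + tr (A * C) := by
  have h := tr_mul_inv (A * B) (C * B)⁻¹
  rw [inv_inv, ← mul_assoc, tr_inv] at h
  rw [h, mul_inv_rev, ← mul_assoc, mul_assoc A, mul_inv_cancel, mul_one, tr_mul_inv,
    tr_mul_comm C B]
  ring

/-- A consequence of tr(AB⁻¹) = tr A tr B - tr(AB). The right side is the second root, given by
Vieta, of Fricke's relation viewed as a quadratic equation in tr(AC). The other two partners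
exchange the roots in the other two variables. -/
theorem tr_partner_z (A B C : SL(2, ℝ)) :
    tr (A * B * C * B⁻¹) = tr A * tr C + tr B * tr (A * B * C)
      - tr (A * B) * tr (B * C) - tr (A * C) := by
  rw [tr_mul_inv, tr_mul_mul_mul]
  ring

theorem tr_partner_y (A B C : SL(2, ℝ)) :
    tr (A * B * A⁻¹ * C) = tr B * tr C + tr A * tr (A * B * C)
      - tr (A * B) * tr (A * C) - tr (B * C) := by
  have h1 : tr (A * B * A⁻¹ * C) = tr (C * A * B * A⁻¹) := by
    rw [tr_mul_comm]; simp only [mul_assoc]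
  have h2 : tr (C * A * B) = tr (A * B * C) := by
    rw [tr_mul_comm (A * B)]; simp only [mul_assoc]
  rw [h1, tr_partner_z, h2, tr_mul_comm C B, tr_mul_comm C A]
  ring

theorem tr_partner_x (A B C : SL(2, ℝ)) :
    tr (A * C⁻¹ * B * C) = tr A * tr B + tr C * tr (A * B * C)
      - tr (B * C) * tr (A * C) - tr (A * B) := by
  have h1 : tr (A * C⁻¹ * B * C) = tr (B * C * A * C⁻¹) := by
    rw [mul_assoc, tr_mul_comm, ← mul_assoc]
  have h2 : tr (B * C * A) = tr (A * B * C) := by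
    rw [tr_mul_comm]; simp only [mul_assoc]
  rw [h1, tr_partner_z, h2, tr_mul_comm B A, tr_mul_comm C A]
  ring

theorem tr_sq (A : SL(2, ℝ)) : tr (A * A) = tr A ^ 2 - 2 := by
  have h := tr_mul_inv A A
  rw [mul_inv_cancel] at h
  simp [tr] at h ⊢
  linear_combination h

theorem tr_commutator (A B : SL(2, ℝ)) :
    tr (A * B * A⁻¹ * B⁻¹) = tr (A * B) ^ 2 + tr A ^ 2 + tr B ^ 2
      - tr (A * B) * tr A * tr B - 2 := by
  have h := tr_partner_y A B B⁻¹
  rw [h, mul_assoc A B, mul_inv_cancel, mul_one, tr_mul_inv, tr_inv]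
  simp [tr]
  ring

/-- Fricke's relation. -/
theorem fricke (A B C : SL(2, ℝ)) :
    tr (A * B) ^ 2 + tr (B * C) ^ 2 + tr (A * C) ^ 2 + tr (A * B) * tr (B * C) * tr (A * C) =
      (tr A * tr B + tr C * tr (A * B * C)) * tr (A * B)
      + (tr B * tr C + tr A * tr (A * B * C)) * tr (B * C)
      + (tr A * tr C + tr B * tr (A * B * C)) * tr (A * C)
      + 4 - tr A ^ 2 - tr B ^ 2 - tr C ^ 2 - tr (A * B * C) ^ 2
      - tr A * tr B * tr C * tr (A * B * C) := by
  -- The trace of ABC·ACB is computed twice: here through ABC·(ACB)⁻¹, a conjugate of the commutator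
  -- of B and C, and in `e2` by cyclic rearrangement. After tr(ACB) is eliminated with `e3`, the
  -- equality of the two values is the claim.
  have e1 : tr (A * B * C * (A * C * B)) = tr (A * B * C) * tr (A * C * B)
      - tr (B * C * B⁻¹ * C⁻¹) := by
    have h := tr_mul_inv (A * B * C) (A * C * B)
    have h2 : tr (A * B * C * (A * C * B)⁻¹) = tr (B * C * B⁻¹ * C⁻¹) := by
      rw [← tr_conj A (B * C * B⁻¹ * C⁻¹)]
      congr 1
      group
    rw [h2] at h
    linarith
  have e2 : tr (A * B * C * (A * C * B)) =
      (tr (A * B) * tr (A * C) * tr (B * C) - tr (A * B) * tr (B * A⁻¹)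
        - tr (A * C) * tr (C * A⁻¹) + tr (A * A)) := by
    have bab : ∀ X Y : SL(2, ℝ), ∀ Z : SL(2, ℝ), tr (Z * (X * Y * X)) =
        tr (X * Y) * tr (Z * X) - tr (Z * Y⁻¹) := by
      intro X Y Z
      have := tr_mul_mul_mul Z X Y
      rw [tr_mul_inv]
      simp only [mul_assoc] at this ⊢
      linarith
    have s1 : tr (A * B * C * (A * C * B)) = tr (B * A * B * (C * A * C)) := by
      rw [tr_mul_comm (A * B * C)]
      have : A * C * B * (A * B * C) = A * C * (B * A * B * C) := by group
      rw [this, tr_mul_comm]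
      congr 1; group
    have i2 : A⁻¹ * A⁻¹ = (A * A)⁻¹ := by group
    rw [s1, bab C A, tr_mul_comm (B * A * B) C, bab B A, tr_mul_comm (B * A * B), bab B A,
      tr_mul_comm C A, tr_mul_comm B A, i2, tr_inv, tr_mul_comm A⁻¹ B, tr_mul_comm C B]
    ring
  have e3 : tr (A * C * B) = tr (A * B) * tr C + tr (B * C) * tr A + tr (A * C) * tr B
      - tr A * tr B * tr C - tr (A * B * C) := by
    have h := tr_mul_inv (A * B) C⁻¹
    have h1 := tr_mul_inv (A * C) B⁻¹
    have h2 : tr (A * C * B⁻¹) = tr A * tr (C * B⁻¹) - tr (A * (C * B⁻¹)⁻¹) := by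
      rw [mul_assoc]
      have := tr_mul_inv A (C * B⁻¹)
      linarith
    have h3 : tr (A * (C * B⁻¹)⁻¹) = tr (A * B * C⁻¹) := by
      congr 1; group
    rw [h3] at h2
    have h4 := tr_mul_inv C B
    rw [inv_inv, tr_inv] at h h1
    rw [tr_mul_comm C B] at h4
    rw [h1, h2, h4]
    linarith
  rw [e2, e3, tr_commutator, tr_mul_inv, tr_mul_inv, tr_sq, tr_mul_comm B A, tr_mul_comm C A] at e1
  linear_combination e1

/-- A product of two rotations by angles between `π` and `2π`, if elliptic, is a rotation in
the negative direction. -/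
theorem mul_10_pos {A B : SL(2, ℝ)} (hA : A 1 0 < 0) (hB : B 1 0 < 0) (tA : tr A < 0)
    (tB : tr B < 0) (h : tr (A * B) ^ 2 < 4) : 0 < (A * B) 1 0 := by
  have dA := det_eq A
  have dB := det_eq B
  have dD := det_eq (A * B)
  set D := A * B with hD
  -- The second summand is the lower left entry of BDB⁻¹ = BA, and AB + BA equals tr A · B + tr B ·
  -- A up to a scalar matrix. Hence the lower left entries of AB and BA have a positive sum.
  have key : D 1 0 + (D 1 0 * B 1 1 ^ 2 - (D 1 1 - D 0 0) * B 1 1 * B 1 0 - D 0 1 * B 1 0 ^ 2) =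
      tr A * B 1 0 + tr B * A 1 0 := by
    simp only [hD, mul_00, mul_01, mul_10, mul_11, tr]
    linear_combination (A 0 0 * B 1 0 + A 1 0 * B 1 1) * dB
  have k1 := mul_pos_of_neg_of_neg tA hB
  have k2 := mul_pos_of_neg_of_neg tB hA
  -- Completing the square in a quadratic form of discriminant tr(D)² - 4 < 0: the form is definite
  -- with the sign of D₁₀, so the two entries also have a positive product.
  have sq : 4 * (D 1 0 * (D 1 0 * B 1 1 ^ 2 - (D 1 1 - D 0 0) * B 1 1 * B 1 0 - D 0 1 * B 1 0 ^ 2))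
      = (2 * D 1 0 * B 1 1 - (D 1 1 - D 0 0) * B 1 0) ^ 2 + (4 - tr D ^ 2) * B 1 0 ^ 2 := by
    simp only [tr]
    linear_combination (4 * B 1 0 ^ 2) * dD
  have pos : 0 < (4 - tr D ^ 2) * B 1 0 ^ 2 :=
    mul_pos (by linarith) (by have := hB.ne; positivity)
  by_contra hneg
  push Not at hneg
  nlinarith [sq_nonneg (2 * D 1 0 * B 1 1 - (D 1 1 - D 0 0) * B 1 0)]

/-! ### Distances and orientation in the hyperboloid model -/

/-- The hyperbolic cosine of the distance. -/
def ip (z w : ℍ) : ℝ := (hw z * hv w + hw w * hv z) / 2 - hu z * hu w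

/-- The oriented volume of the three corresponding vectors of the hyperboloid. -/
def vol (z₁ z₂ z₃ : ℍ) : ℝ :=
  hu z₃ * (hw z₁ * hv z₂ - hv z₁ * hw z₂) + hv z₃ * (hu z₁ * hw z₂ - hw z₁ * hu z₂)
    + hw z₃ * (hv z₁ * hu z₂ - hu z₁ * hv z₂)

theorem ip_comm (z w : ℍ) : ip z w = ip w z := by simp only [ip]; ring

/-- A sum of squares that gives both the inequality cosh ≥ 1 and its equality case. -/
theorem ip_sub_one (z w : ℍ) : 2 * (hv z * hv w) * (ip z w - 1) =
    (hv z - hv w) ^ 2 + (hu z * hv w - hu w * hv z) ^ 2 := by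
  have e1 := hw_mul_hv z
  have e2 := hw_mul_hv w
  simp only [ip]
  linear_combination hv w ^ 2 * e1 + hv z ^ 2 * e2

theorem one_le_ip (z w : ℍ) : 1 ≤ ip z w := by
  have := ip_sub_one z w
  have h := mul_pos (hv_pos z) (hv_pos w)
  by_contra hc
  push Not at hc
  nlinarith [sq_nonneg (hv z - hv w), sq_nonneg (hu z * hv w - hu w * hv z)]

theorem ip_eq_one_iff {z w : ℍ} : ip z w = 1 ↔ z = w := by
  constructor
  · intro h
    have := ip_sub_one z w
    rw [h, sub_self, mul_zero] at this
    have e1 : hv z = hv w := by nlinarith [sq_nonneg (hv z - hv w), sq_nonneg (hu z * hv w - hu w * hv z)]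
    refine ext_hu_hv ?_ e1
    have e2 : hu z * hv w - hu w * hv z = 0 := by
      nlinarith [sq_nonneg (hv z - hv w), sq_nonneg (hu z * hv w - hu w * hv z)]
    rw [e1] at e2
    apply mul_right_cancel₀ (hv_pos w).ne'
    linarith
  · rintro rfl
    simp only [ip]
    linear_combination hw_mul_hv z

theorem ip_smul (h : SL(2, ℝ)) (z w : ℍ) : ip (h • z) (h • w) = ip z w := by
  have hd := det_eq h
  have : ip (h • z) (h • w) = (h 0 0 * h 1 1 - h 0 1 * h 1 0) ^ 2 * ip z w := by
    simp only [ip, hu_smul, hv_smul, hw_smul]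
    ring
  rw [this, hd]; ring

theorem vol_smul (h : SL(2, ℝ)) (z₁ z₂ z₃ : ℍ) :
    vol (h • z₁) (h • z₂) (h • z₃) = vol z₁ z₂ z₃ := by
  have hd := det_eq h
  have : vol (h • z₁) (h • z₂) (h • z₃) =
      (h 0 0 * h 1 1 - h 0 1 * h 1 0) ^ 3 * vol z₁ z₂ z₃ := by
    simp only [vol, hu_smul, hv_smul, hw_smul]
    ring
  rw [this, hd]; ring

theorem tr_rotAt_mul (α β : ℝ) (z w : ℍ) : tr (rotAt α z * rotAt β w) =
    2 * cos (α / 2) * cos (β / 2) - 2 * sin (α / 2) * sin (β / 2) * ip z w := by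
  simp [tr, ip]; ring

theorem tr_rotAt_mul_mul (α β γ : ℝ) (z₁ z₂ z₃ : ℍ) :
    tr (rotAt α z₁ * rotAt β z₂ * rotAt γ z₃) =
    2 * cos (α / 2) * cos (β / 2) * cos (γ / 2)
      - 2 * (cos (α / 2) * sin (β / 2) * sin (γ / 2) * ip z₂ z₃
        + cos (β / 2) * sin (α / 2) * sin (γ / 2) * ip z₁ z₃
        + cos (γ / 2) * sin (α / 2) * sin (β / 2) * ip z₁ z₂)
      + sin (α / 2) * sin (β / 2) * sin (γ / 2) * vol z₁ z₂ z₃ := by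
  simp [tr, ip, vol]; ring

/-- The trace of the commutator, minus two. -/
theorem discr_rotAt (α β : ℝ) (z w : ℍ) :
    tr (rotAt α z * rotAt β w) ^ 2
      - tr (rotAt α z * rotAt β w) * tr (rotAt α z) * tr (rotAt β w)
      + tr (rotAt α z) ^ 2 + tr (rotAt β w) ^ 2 - 4
      = 4 * (sin (α / 2) * sin (β / 2)) ^ 2 * (ip z w ^ 2 - 1) := by
  rw [tr_rotAt_mul, tr_rotAt, tr_rotAt]
  have h1 := sin_sq (α / 2)
  have h2 := sin_sq (β / 2)
  linear_combination (4 * sin (β / 2) ^ 2) * h1 + (4 * (1 - cos (α / 2) ^ 2)) * h2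

/-- By `discr_rotAt` the expression is a positive multiple of sinh² of the distance between the
centres. It makes coincidence of centres visible on traces. -/
theorem discr_eq_zero_iff {α β : ℝ} (ha : 0 < α) (ha' : α < 2 * π) (hb : 0 < β)
    (hb' : β < 2 * π) (z w : ℍ) : tr (rotAt α z * rotAt β w) ^ 2
      - tr (rotAt α z * rotAt β w) * tr (rotAt α z) * tr (rotAt β w)
      + tr (rotAt α z) ^ 2 + tr (rotAt β w) ^ 2 - 4 = 0 ↔ z = w := by
  have hs : 0 < sin (α / 2) := sin_pos_of_pos_of_lt_pi (by linarith) (by linarith)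
  have hs' : 0 < sin (β / 2) := sin_pos_of_pos_of_lt_pi (by linarith) (by linarith)
  have h1 := one_le_ip z w
  rw [discr_rotAt, ← ip_eq_one_iff]
  constructor
  · intro h
    have := (mul_eq_zero.1 h).resolve_left (by positivity)
    nlinarith
  · intro h
    rw [h]; ring

/-- Since cosh > -1, the trace is smaller than 2cos((α - β)/2). For sign -1, complementary pairs
have opposite traces, so this upper bound becomes a lower bound and hence a bound on distances. -/
theorem tr_rotAt_mul_lt {α β : ℝ} (ha : 0 < α) (ha' : α < 2 * π) (hb : 0 < β)
    (hb' : β < 2 * π) (z w : ℍ) : tr (rotAt α z * rotAt β w) < 2 := by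
  have hs : 0 < sin (α / 2) := sin_pos_of_pos_of_lt_pi (by linarith) (by linarith)
  have hs' : 0 < sin (β / 2) := sin_pos_of_pos_of_lt_pi (by linarith) (by linarith)
  have h1 := one_le_ip z w
  rw [tr_rotAt_mul]
  nlinarith [mul_pos hs hs', cos_le_one (α / 2 - β / 2), cos_sub (α / 2) (β / 2)]

/-! ### The Markov dynamics -/

/-- If two vertices of the conic slice vanish to first order, so does the discriminant. -/
theorem slice_identity {t₀ t₁ t₂ q x y z : ℝ}
    (h : x ^ 2 + y ^ 2 + z ^ 2 + x * y * z = (t₀ * t₁ + t₂ * q) * x + (t₁ * t₂ + t₀ * q) * y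
      + (t₀ * t₂ + t₁ * q) * z + 4 - t₀ ^ 2 - t₁ ^ 2 - t₂ ^ 2 - q ^ 2 - t₀ * t₁ * t₂ * q) :
    (-2 * (t₁ * t₂ + t₀ * q) + x * (t₀ * t₂ + t₁ * q) + (4 - x ^ 2) * y) ^ 2
      + (4 - x ^ 2) * (t₀ * t₂ + t₁ * q - x * y - 2 * z) ^ 2
      = 4 * ((x ^ 2 - x * t₀ * t₁ + t₀ ^ 2 + t₁ ^ 2 - 4)
        * (x ^ 2 - x * t₂ * q + t₂ ^ 2 + q ^ 2 - 4)) := by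
  linear_combination 4 * (4 - x ^ 2) * h

/-- The action of a Dehn twist on the two traces that it does not preserve. -/
def twistPair (x m n : ℝ) (p : ℝ × ℝ) : ℝ × ℝ :=
  (m - x * (n - x * p.1 - p.2) - p.1, n - x * p.1 - p.2)

theorem twistPair_eq_self {x m n : ℝ} {p : ℝ × ℝ} (h : twistPair x m n p = p) :
    2 * p.1 + x * p.2 = m ∧ 2 * p.2 + x * p.1 = n := by
  have h1 := congrArg Prod.fst h
  have h2 := congrArg Prod.snd h
  simp only [twistPair] at h1 h2
  constructor
  · linear_combination -h1 - x * h2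
  · linear_combination -h2

/-- The linear part of the twist has determinant 1 and trace x² - 2, so for x = 2cos τ it has the
eigenvalues of a rotation by 2τ. Order two needs x² - 2 = -2, and order three, in `twistPair_cube`,
needs x² - 2 = -1. -/
theorem twistPair_sq {x m n : ℝ} {p : ℝ × ℝ}
    (h : twistPair x m n (twistPair x m n p) = p) : twistPair x m n p = p ∨ x = 0 := by
  by_cases hx : x = 0
  · exact Or.inr hx
  left
  obtain ⟨u, v⟩ := p
  simp only [twistPair, Prod.mk.injEq] at h ⊢
  obtain ⟨h1, h2⟩ := h
  have e2 : x * (2 * u + x * v - m + x * (n - x * u - 2 * v)) = 0 := by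
    linear_combination h2
  have e2' := (mul_eq_zero.1 e2).resolve_left hx
  have e3 : n - x * u - 2 * v = 0 := by
    have : x * (n - x * u - 2 * v) = 0 := by linear_combination h1 + x ^ 2 * e2'
    exact (mul_eq_zero.1 this).resolve_left hx
  constructor
  · linear_combination -e2'
  · linear_combination e3

theorem twistPair_cube {x m n : ℝ} {p : ℝ × ℝ}
    (h : twistPair x m n (twistPair x m n (twistPair x m n p)) = p) :
    twistPair x m n p = p ∨ x ^ 2 = 1 := by
  by_cases hx : x ^ 2 = 1
  · exact Or.inr hx
  left
  obtain ⟨u, v⟩ := p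
  simp only [twistPair, Prod.mk.injEq] at h ⊢
  obtain ⟨h1, h2⟩ := h
  have hx' : x ^ 2 - 1 ≠ 0 := sub_ne_zero.2 hx
  set e := m - x * (n - x * u - v) - u - u with he
  set f := n - x * u - v - v with hf
  have k1 : (x ^ 2 - 1) * ((x ^ 2 - 1) * e + x * f) = 0 := by
    rw [he, hf]; linear_combination h1
  have k2 : (x ^ 2 - 1) * (-x * e - f) = 0 := by
    rw [he, hf]; linear_combination h2
  have k1' := (mul_eq_zero.1 k1).resolve_left hx'
  have k2' := (mul_eq_zero.1 k2).resolve_left hx'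
  constructor
  · linear_combination -k1' - x * k2'
  · linear_combination (-1 + x ^ 2) * k2' + x * k1'

theorem twistPair_zero (m n : ℝ) (p : ℝ × ℝ) :
    twistPair 0 m n p = (m - p.1, n - p.2) := by
  simp [twistPair]

end PuncturedSphere

end

noncomputable section
namespace PuncturedSphere

/-! ### Congruence of triples of points -/

/-- The number a · conj b records the scalar product and the oriented area, so the hypotheses say
that the two pairs of plane vectors are directly congruent. -/
theorem exists_unit_mul {a b a' b' : ℂ} (ha : Complex.normSq a = Complex.normSq a')
    (hb : Complex.normSq b = Complex.normSq b') (hab : a * conj b = a' * conj b') :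
    ∃ φ : ℝ, a' = Complex.exp (φ * Complex.I) * a ∧ b' = Complex.exp (φ * Complex.I) * b := by
  have unit : ∀ x x' : ℂ, x ≠ 0 → Complex.normSq x = Complex.normSq x' →
      ∃ φ : ℝ, x' = Complex.exp (φ * Complex.I) * x := by
    intro x x' hx h
    refine ⟨(x' / x).arg, ?_⟩
    have h1 : ‖x' / x‖ = 1 := by
      rw [norm_div, Complex.norm_def, Complex.norm_def, ← h]
      apply div_self
      exact (Real.sqrt_pos.2 (Complex.normSq_pos.2 hx)).ne'
    have h2 := Complex.norm_mul_exp_arg_mul_I (x' / x)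
    rw [h1, Complex.ofReal_one, one_mul] at h2
    rw [h2]
    field_simp
  -- A vanishing vector does not determine the rotation; the angle must then be taken from the other
  -- one.
  by_cases ha0 : a = 0
  · subst ha0
    have ha' : a' = 0 := by
      simpa using ha.symm
    subst ha'
    by_cases hb0 : b = 0
    · subst hb0
      have hb' : b' = 0 := by simpa using hb.symm
      exact ⟨0, by simp, by simp [hb']⟩
    · obtain ⟨φ, h⟩ := unit b b' hb0 hb
      exact ⟨φ, by simp, h⟩
  · obtain ⟨φ, h⟩ := unit a a' ha0 ha
    refine ⟨φ, h, ?_⟩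
    rw [h, mul_comm _ a, mul_assoc] at hab
    have h2 := mul_left_cancel₀ ha0 hab
    have h3 := congrArg conj h2
    simp only [map_mul, Complex.conj_conj, ← Complex.exp_conj, Complex.conj_I,
      Complex.conj_ofReal] at h3
    rw [h3, ← mul_assoc, ← Complex.exp_add]
    simp

/-- The stabiliser of I preserves the height (w + v)/2, which is `ip I z`, and rotates the plane
with coordinates (w - v)/2 and u. The claim thus reduces to congruence of two plane vectors. -/
theorem exists_smul_eq_of_I {z₁ z₂ w₁ w₂ : ℍ} (h₁ : ip I z₁ = ip I w₁) (h₂ : ip I z₂ = ip I w₂)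
    (h₁₂ : ip z₁ z₂ = ip w₁ w₂) (hv' : vol I z₁ z₂ = vol I w₁ w₂) :
    ∃ h : SL(2, ℝ), h • I = I ∧ h • z₁ = w₁ ∧ h • z₂ = w₂ := by
  have r1 := hw_mul_hv z₁
  have r2 := hw_mul_hv z₂
  have r3 := hw_mul_hv w₁
  have r4 := hw_mul_hv w₂
  simp only [ip, vol, hu_I, hv_I, hw_I] at h₁ h₂ h₁₂ hv'
  obtain ⟨φ, e1, e2⟩ := exists_unit_mul (a := ⟨(hw z₁ - hv z₁) / 2, hu z₁⟩)
    (b := ⟨(hw z₂ - hv z₂) / 2, hu z₂⟩) (a' := ⟨(hw w₁ - hv w₁) / 2, hu w₁⟩)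
    (b' := ⟨(hw w₂ - hv w₂) / 2, hu w₂⟩)
    (by
      simp only [Complex.normSq_mk]
      linear_combination (hw z₁ + hv z₁ + hw w₁ + hv w₁) / 2 * h₁ - r1 + r3)
    (by
      simp only [Complex.normSq_mk]
      linear_combination (hw z₂ + hv z₂ + hw w₂ + hv w₂) / 2 * h₂ - r2 + r4)
    (by
      apply Complex.ext
      · simp
        linear_combination -h₁₂ + (hw z₂ + hv z₂) / 2 * h₁ + (hw w₁ + hv w₁) / 2 * h₂
      · simp
        linear_combination hv' / 2)
  -- Near I these plane coordinates are (dy, dx), which reverses the orientation; hence the angle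
  -- -φ.
  have key : ∀ z w : ℍ, ip I z = ip I w → (⟨(hw w - hv w) / 2, hu w⟩ : ℂ) =
      Complex.exp (φ * Complex.I) * ⟨(hw z - hv z) / 2, hu z⟩ → rotAt (-φ) I • z = w := by
    intro z w h e
    have e1 := congrArg Complex.re e
    have e2 := congrArg Complex.im e
    simp [Complex.exp_ofReal_mul_I_re, Complex.exp_ofReal_mul_I_im] at e1 e2
    simp only [ip, hu_I, hv_I, hw_I] at h
    have c1 : cos φ = cos (φ / 2) ^ 2 - sin (φ / 2) ^ 2 := by
      rw [← cos_two_mul']; congr 1; ring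
    have c2 : sin φ = 2 * sin (φ / 2) * cos (φ / 2) := by
      rw [← sin_two_mul]; congr 1; ring
    have c3 := sin_sq_add_cos_sq (φ / 2)
    rw [c1, c2] at e1 e2
    apply ext_hu_hv
    · rw [hu_smul, e2]
      simp [neg_div]
      ring
    · rw [hv_smul]
      simp [neg_div]
      linear_combination (sin (φ / 2) ^ 2 + cos (φ / 2) ^ 2) * h +
        (1 / 2) * (hw w + hv w) * c3 + e1
  exact ⟨rotAt (-φ) I, rotAt_smul_self (-φ) I, key _ _ (by simpa [ip] using h₁) e1,
    key _ _ (by simpa [ip] using h₂) e2⟩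

theorem exists_smul_eq {z₀ z₁ z₂ w₀ w₁ w₂ : ℍ} (h₀₁ : ip z₀ z₁ = ip w₀ w₁)
    (h₀₂ : ip z₀ z₂ = ip w₀ w₂) (h₁₂ : ip z₁ z₂ = ip w₁ w₂)
    (hv' : vol z₀ z₁ z₂ = vol w₀ w₁ w₂) :
    ∃ h : SL(2, ℝ), h • z₀ = w₀ ∧ h • z₁ = w₁ ∧ h • z₂ = w₂ := by
  obtain ⟨g, hg⟩ := MulAction.exists_smul_eq SL(2, ℝ) z₀ I
  obtain ⟨k, hk⟩ := MulAction.exists_smul_eq SL(2, ℝ) w₀ I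
  obtain ⟨h, e0, e1, e2⟩ := exists_smul_eq_of_I (z₁ := g • z₁) (z₂ := g • z₂) (w₁ := k • w₁)
    (w₂ := k • w₂) (by rw [← hg, ip_smul, hg, ← hk, ip_smul, h₀₁])
    (by rw [← hg, ip_smul, hg, ← hk, ip_smul, h₀₂]) (by rw [ip_smul, ip_smul, h₁₂])
    (by rw [← hg, vol_smul, hg, ← hk, vol_smul, hv'])
  refine ⟨k⁻¹ * h * g, ?_, ?_, ?_⟩
  · rw [mul_smul, mul_smul, hg, e0, inv_smul_eq_iff, hk]
  · rw [mul_smul, mul_smul, e1, inv_smul_smul]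
  · rw [mul_smul, mul_smul, e2, inv_smul_smul]

/-! ### Homomorphisms from the fundamental group -/

theorem c_prod : SphereGroup.c 0 * SphereGroup.c 1 * SphereGroup.c 2 * SphereGroup.c 3 = 1 :=
  PresentedGroup.one_of_mem (Set.mem_singleton _)

/-- The homomorphism with prescribed values on the peripheral generators. -/
def sphereHom {G : Type*} [Group G] (f : Fin 4 → G) (hf : f 0 * f 1 * f 2 * f 3 = 1) :
    SphereGroup →* G :=
  PresentedGroup.toGroup (f := f) (by
    intro r hr
    rw [Set.mem_singleton_iff.1 hr]
    simpa using hf)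

@[simp] theorem sphereHom_c {G : Type*} [Group G] (f : Fin 4 → G)
    (hf : f 0 * f 1 * f 2 * f 3 = 1) (i : Fin 4) : sphereHom f hf (SphereGroup.c i) = f i :=
  PresentedGroup.toGroup.of _

theorem sphereHom_ext {G : Type*} [Group G] {f g : SphereGroup →* G}
    (h : ∀ i, f (SphereGroup.c i) = g (SphereGroup.c i)) : f = g :=
  PresentedGroup.ext h

/-- The automorphism given by its values and those of its inverse on the generators. -/
def sphereAut (f g : SphereGroup →* SphereGroup)
    (h : ∀ i, g (f (SphereGroup.c i)) = SphereGroup.c i)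
    (h' : ∀ i, f (g (SphereGroup.c i)) = SphereGroup.c i) : MulAut SphereGroup :=
  MonoidHom.toMulEquiv f g (sphereHom_ext h) (sphereHom_ext h')

@[simp] theorem sphereAut_apply (f g : SphereGroup →* SphereGroup) (h h') (x : SphereGroup) :
    sphereAut f g h h' x = f x := rfl

open SphereGroup

theorem c_three : c 3 = (c 0 * c 1 * c 2)⁻¹ := (inv_eq_of_mul_eq_one_right c_prod).symm

/-! ### Centres of representations -/

variable {α : Fin 4 → ℝ}

/-- The point `C i` is the fixed point of `ρ (c i)`. -/
def IsCenters (ρ : RelHom α) (C : Fin 4 → ℍ) : Prop :=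
  ∀ i, ρ.1 (c i) = (rotAt (α i) (C i) : PSL(2, ℝ))

theorem exists_isCenters (ρ : RelHom α) : ∃ C, IsCenters ρ C := by
  choose C hC using ρ.2
  exact ⟨C, fun i => isRotation_iff.1 (hC i)⟩

theorem IsCenters.unique (hα : ∀ i, 0 < α i ∧ α i < 2 * π) {ρ : RelHom α} {C C' : Fin 4 → ℍ}
    (h : IsCenters ρ C) (h' : IsCenters ρ C') : C = C' := by
  funext i
  have := (h i).symm.trans (h' i)
  exact (mk_rotAt_injective (hα i).1 (hα i).2 (hα i).1 (hα i).2 this).2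

/-- The product of the canonical lifts. -/
def liftProd (α : Fin 4 → ℝ) (C : Fin 4 → ℍ) : SL(2, ℝ) :=
  rotAt (α 0) (C 0) * rotAt (α 1) (C 1) * rotAt (α 2) (C 2) * rotAt (α 3) (C 3)

theorem IsCenters.liftProd_eq {ρ : RelHom α} {C : Fin 4 → ℍ} (h : IsCenters ρ C) :
    liftProd α C = 1 ∨ liftProd α C = -1 := by
  apply mk_eq_mk_iff.1
  have := congrArg ρ.1 c_prod
  simp only [map_mul, map_one] at this
  rw [h 0, h 1, h 2, h 3] at this
  exact this

/-- The trace of the product of the lifts at the first two punctures. -/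
def trX (α : Fin 4 → ℝ) (C : Fin 4 → ℍ) : ℝ := tr (rotAt (α 0) (C 0) * rotAt (α 1) (C 1))

/-- The trace of the product of the lifts at the second and the third puncture. -/
def trY (α : Fin 4 → ℝ) (C : Fin 4 → ℍ) : ℝ :=
  tr (rotAt (α 1) (C 1) * rotAt (α 2) (C 2))

/-- The trace of the product of the lifts at the first and the third puncture. -/
def trZ (α : Fin 4 → ℝ) (C : Fin 4 → ℍ) : ℝ :=
  tr (rotAt (α 0) (C 0) * rotAt (α 2) (C 2))

theorem triple_eq {C : Fin 4 → ℍ} (h : liftProd α C = -1) :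
    rotAt (α 0) (C 0) * rotAt (α 1) (C 1) * rotAt (α 2) (C 2) = -(rotAt (α 3) (C 3))⁻¹ := by
  rw [eq_mul_inv_of_mul_eq h]; simp

theorem tr_triple {C : Fin 4 → ℍ} (h : liftProd α C = -1) :
    tr (rotAt (α 0) (C 0) * rotAt (α 1) (C 1) * rotAt (α 2) (C 2)) = -(2 * cos (α 3 / 2)) := by
  rw [triple_eq h, tr_neg, tr_inv, tr_rotAt]

theorem tr_triple_pos {C : Fin 4 → ℍ} (h : liftProd α C = 1) :
    tr (rotAt (α 0) (C 0) * rotAt (α 1) (C 1) * rotAt (α 2) (C 2)) = 2 * cos (α 3 / 2) := by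
  rw [liftProd, mul_eq_one_iff_eq_inv] at h
  rw [h, tr_inv, tr_rotAt]

theorem mk_eq_mk_of_conj {ρ ρ' : RelHom α} (h : PSL(2, ℝ))
    (H : ∀ i, ρ'.1 (c i) = h * ρ.1 (c i) * h⁻¹) : CharVar.mk ρ = CharVar.mk ρ' := by
  apply Quotient.sound
  refine ⟨h, fun g => ?_⟩
  have : ρ'.1 = (MulAut.conj h).toMonoidHom.comp ρ.1 := sphereHom_ext (by simpa using H)
  rw [this]
  simp

theorem conj_of_mk_eq_mk {ρ ρ' : RelHom α} (H : CharVar.mk ρ = CharVar.mk ρ') :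
    ∃ h : PSL(2, ℝ), ∀ g, ρ'.1 g = h * ρ.1 g * h⁻¹ := Quotient.exact H

/-- The traces determine the conjugacy class. -/
theorem mk_eq_mk_of_traces (hα : ∀ i, 0 < α i ∧ α i < 2 * π) {ρ ρ' : RelHom α}
    {C C' : Fin 4 → ℍ} (hC : IsCenters ρ C) (hC' : IsCenters ρ' C') (hs : liftProd α C = -1)
    (hs' : liftProd α C' = -1) (hx : trX α C = trX α C') (hy : trY α C = trY α C')
    (hz : trZ α C = trZ α C') : CharVar.mk ρ = CharVar.mk ρ' := by
  have sp : ∀ i, 0 < sin (α i / 2) := fun i =>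
    sin_pos_of_pos_of_lt_pi (by linarith [(hα i).1]) (by linarith [(hα i).2])
  have hip : ∀ i j, tr (rotAt (α i) (C i) * rotAt (α j) (C j)) =
      tr (rotAt (α i) (C' i) * rotAt (α j) (C' j)) → ip (C i) (C j) = ip (C' i) (C' j) := by
    intro i j h
    rw [tr_rotAt_mul, tr_rotAt_mul] at h
    have : 2 * sin (α i / 2) * sin (α j / 2) ≠ 0 := by
      have := sp i
      have := sp j
      positivity
    apply mul_left_cancel₀ this
    linarith
  have i01 := hip _ _ hx
  have i12 := hip _ _ hy
  have i02 := hip _ _ hz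
  -- Distances leave a reflection undetermined. The sign -1 prescribes the trace of the triple
  -- product, in which the oriented volume is the only remaining unknown.
  have hvol : vol (C 0) (C 1) (C 2) = vol (C' 0) (C' 1) (C' 2) := by
    have e := (tr_triple hs).trans (tr_triple hs').symm
    rw [tr_rotAt_mul_mul, tr_rotAt_mul_mul, i01, i12, i02] at e
    have : sin (α 0 / 2) * sin (α 1 / 2) * sin (α 2 / 2) ≠ 0 := by
      have := sp 0
      have := sp 1
      have := sp 2
      positivity
    apply mul_left_cancel₀ this
    linarith
  obtain ⟨h, h0, h1, h2⟩ := exists_smul_eq i01 i02 i12 hvol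
  -- The fourth lift is determined by the other three through the product relation.
  have h3 : h • C 3 = C' 3 := by
    have e := triple_eq hs'
    rw [← h0, ← h1, ← h2, ← conj_rotAt, ← conj_rotAt, ← conj_rotAt] at e
    have e2 : h * (rotAt (α 0) (C 0) * rotAt (α 1) (C 1) * rotAt (α 2) (C 2)) * h⁻¹ =
        -(rotAt (α 3) (C' 3))⁻¹ := by
      rw [← e]; group
    rw [triple_eq hs] at e2
    have e3 : (rotAt (α 3) (h • C 3))⁻¹ = (rotAt (α 3) (C' 3))⁻¹ := by
      rw [← conj_rotAt]
      have := neg_injective (show -(h * (rotAt (α 3) (C 3))⁻¹ * h⁻¹) = _ by simpa using e2)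
      rw [← this]; group
    exact (rotAt_injective (hα 3).1 (hα 3).2 (hα 3).1 (hα 3).2 (inv_injective e3)).2
  apply mk_eq_mk_of_conj (h : PSL(2, ℝ))
  intro i
  have hi : h • C i = C' i := by fin_cases i <;> assumption
  rw [hC i, hC' i, ← hi, ← conj_rotAt]
  rfl

/-- Centres, sign and traces are well defined on conjugacy classes. -/
theorem IsCenters.conj {ρ ρ' : RelHom α} {C : Fin 4 → ℍ} (hC : IsCenters ρ C)
    (H : CharVar.mk ρ = CharVar.mk ρ') : ∃ C', IsCenters ρ' C' ∧ liftProd α C' = liftProd α C ∧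
      trX α C' = trX α C ∧ trY α C' = trY α C ∧ trZ α C' = trZ α C := by
  obtain ⟨h, hh⟩ := conj_of_mk_eq_mk H
  obtain ⟨k, rfl⟩ := QuotientGroup.mk_surjective h
  refine ⟨fun i => k • C i, fun i => ?_, ?_, ?_, ?_, ?_⟩
  · rw [hh, hC i, ← conj_rotAt]; rfl
  · simp only [liftProd, ← conj_rotAt]
    have : k * rotAt (α 0) (C 0) * k⁻¹ * (k * rotAt (α 1) (C 1) * k⁻¹) *
      (k * rotAt (α 2) (C 2) * k⁻¹) * (k * rotAt (α 3) (C 3) * k⁻¹) =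
      k * liftProd α C * k⁻¹ := by rw [liftProd]; group
    rw [← liftProd, this]
    rcases hC.liftProd_eq with e | e <;> rw [e] <;> simp
  · simp only [trX, tr_rotAt_mul, ip_smul]
  · simp only [trY, tr_rotAt_mul, ip_smul]
  · simp only [trZ, tr_rotAt_mul, ip_smul]

end PuncturedSphere

end

noncomputable section
namespace PuncturedSphere
open SphereGroup
variable {α : Fin 4 → ℝ}

/-! ### Dehn twists -/

/-- The Dehn twist along the curve `c₁c₂`. -/
def twistX : MulAut SphereGroup :=
  sphereAut
    (sphereHom ![c 0, c 1, (c 0 * c 1) * c 2 * (c 0 * c 1)⁻¹, (c 0 * c 1) * c 3 * (c 0 * c 1)⁻¹]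
      (by simp [c_three]; group))
    (sphereHom ![c 0, c 1, (c 0 * c 1)⁻¹ * c 2 * (c 0 * c 1), (c 0 * c 1)⁻¹ * c 3 * (c 0 * c 1)]
      (by simp [c_three]; group))
    (by intro i; fin_cases i <;> simp <;> group)
    (by intro i; fin_cases i <;> simp <;> group)

/-- The Dehn twist along the curve `c₂c₃`. -/
def twistY : MulAut SphereGroup :=
  sphereAut
    (sphereHom ![c 0, (c 1 * c 2) * c 1 * (c 1 * c 2)⁻¹, (c 1 * c 2) * c 2 * (c 1 * c 2)⁻¹, c 3]
      (by simp [c_three]; group))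
    (sphereHom ![c 0, (c 1 * c 2)⁻¹ * c 1 * (c 1 * c 2), (c 1 * c 2)⁻¹ * c 2 * (c 1 * c 2), c 3]
      (by simp [c_three]; group))
    (by intro i; fin_cases i <;> simp <;> group)
    (by intro i; fin_cases i <;> simp <;> group)

/-- The Dehn twist along the curve `c₁c₃`. -/
def twistZ : MulAut SphereGroup :=
  sphereAut
    (sphereHom ![c 0, (c 2 * c 0) * c 1 * (c 2 * c 0)⁻¹, c 2, (c 0 * c 2) * c 3 * (c 0 * c 2)⁻¹]
      (by simp [c_three]; group))
    (sphereHom ![c 0, (c 2 * c 0)⁻¹ * c 1 * (c 2 * c 0), c 2, (c 0 * c 2)⁻¹ * c 3 * (c 0 * c 2)]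
      (by simp [c_three]; group))
    (by intro i; fin_cases i <;> simp <;> group)
    (by intro i; fin_cases i <;> simp <;> group)

theorem isConj_mul_inv {G : Type*} [Group G] (a b : G) : IsConj a (b * a * b⁻¹) :=
  isConj_iff.2 ⟨b, rfl⟩

theorem twistX_mem : twistX ∈ PureAut := by
  intro i
  fin_cases i <;> simp only [twistX, sphereAut_apply, sphereHom_c]
  exacts [IsConj.refl _, IsConj.refl _, isConj_mul_inv _ _, isConj_mul_inv _ _]

theorem twistY_mem : twistY ∈ PureAut := by
  intro i
  fin_cases i <;> simp only [twistY, sphereAut_apply, sphereHom_c]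
  exacts [IsConj.refl _, isConj_mul_inv _ _, isConj_mul_inv _ _, IsConj.refl _]

theorem twistZ_mem : twistZ ∈ PureAut := by
  intro i
  fin_cases i <;> simp only [twistZ, sphereAut_apply, sphereHom_c]
  exacts [IsConj.refl _, isConj_mul_inv _ _, IsConj.refl _, isConj_mul_inv _ _]

/-- Precomposition of a representation with a pure automorphism. -/
def precomp (ρ : RelHom α) (φ : MulAut SphereGroup) (hφ : φ ∈ PureAut) : RelHom α :=
  (⟨φ, hφ⟩ : PureAut)⁻¹ • ρ

theorem precomp_apply (ρ : RelHom α) {φ : MulAut SphereGroup} (hφ : φ ∈ PureAut)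
    (g : SphereGroup) : (precomp ρ φ hφ).1 g = ρ.1 (φ g) := by
  change ρ.1 (((⟨φ, hφ⟩ : PureAut)⁻¹⁻¹ : PureAut).1 g) = _
  rw [inv_inv]

theorem mk_precomp (ρ : RelHom α) {φ : MulAut SphereGroup} (hφ : φ ∈ PureAut) :
    CharVar.mk (precomp ρ φ hφ) = (⟨φ, hφ⟩ : PureAut)⁻¹ • CharVar.mk ρ := rfl

theorem smul_mk_eq (φ : PureAut) (ρ : RelHom α) :
    φ • CharVar.mk ρ = CharVar.mk (precomp ρ (φ⁻¹).1 (φ⁻¹).2) := by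
  rw [mk_precomp]
  change φ • _ = (φ⁻¹)⁻¹ • _
  rw [inv_inv]

theorem isCenters_of_conj {ρ ρ' : RelHom α} {C : Fin 4 → ℍ} (hC : IsCenters ρ C)
    (K : Fin 4 → SL(2, ℝ))
    (h : ∀ i, ρ'.1 (c i) = (K i : PSL(2, ℝ)) * ρ.1 (c i) * (K i : PSL(2, ℝ))⁻¹) :
    IsCenters ρ' (fun i => K i • C i) := by
  intro i
  rw [h, hC i, ← conj_rotAt]
  rfl

/-- The twist conjugates the last two generators by c₁c₂. On traces it is a composition of two Vieta
involutions of the cubic, first in z and then in y, with x fixed. Conjugation does not affect the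
scalar `liftProd`. -/
theorem twistX_traces {ρ : RelHom α} {C : Fin 4 → ℍ} (hC : IsCenters ρ C) :
    ∃ C', IsCenters (precomp ρ twistX twistX_mem) C' ∧ liftProd α C' = liftProd α C ∧
      trX α C' = trX α C ∧
      (trY α C', trZ α C') = twistPair (trX α C)
        (2 * cos (α 1 / 2) * (2 * cos (α 2 / 2)) + 2 * cos (α 0 / 2) *
          tr (rotAt (α 0) (C 0) * rotAt (α 1) (C 1) * rotAt (α 2) (C 2)))
        (2 * cos (α 0 / 2) * (2 * cos (α 2 / 2)) + 2 * cos (α 1 / 2) *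
          tr (rotAt (α 0) (C 0) * rotAt (α 1) (C 1) * rotAt (α 2) (C 2)))
        (trY α C, trZ α C) := by
  set A := rotAt (α 0) (C 0) with hA
  set B := rotAt (α 1) (C 1) with hB
  set D := rotAt (α 2) (C 2) with hD
  set E := rotAt (α 3) (C 3) with hE
  have tA : tr A = 2 * cos (α 0 / 2) := tr_rotAt _ _
  have tB : tr B = 2 * cos (α 1 / 2) := tr_rotAt _ _
  have tD : tr D = 2 * cos (α 2 / 2) := tr_rotAt _ _
  refine ⟨_, isCenters_of_conj hC ![1, 1, A * B, A * B] ?_, ?_, ?_, ?_⟩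
  · intro i
    have h0 := hC 0
    have h1 := hC 1
    rw [precomp_apply]
    fin_cases i <;>
      simp [twistX, QuotientGroup.mk_mul, h0, h1, hA, hB]
  · have : liftProd α C = A * B * D * E := rfl
    rcases hC.liftProd_eq with e | e <;>
    · rw [e]
      rw [this] at e
      simp only [liftProd, ← conj_rotAt]
      simp only [Matrix.cons_val, inv_one, one_mul, mul_one]
      rw [← hA, ← hB, ← hD, ← hE]
      have : A * B * (A * B * D * (A * B)⁻¹) * (A * B * E * (A * B)⁻¹) =
        (A * B) * (A * B * D * E) * (A * B)⁻¹ := by group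
      rw [this, e]
      simp
  · simp [trX]
  · simp only [trX, trY, trZ, ← conj_rotAt]
    simp only [Matrix.cons_val, inv_one, one_mul, mul_one]
    rw [← hA, ← hB, ← hD]
    have hz : tr (A * (A * B * D * (A * B)⁻¹)) = tr A * tr D + tr B * tr (A * B * D)
      - tr (A * B) * tr (B * D) - tr (A * D) := by
      rw [← tr_partner_z, ← tr_conj A (A * B * D * B⁻¹)]
      congr 1; group
    -- The second involution, read backwards: the old y is the partner of the new y when z has its
    -- new value.
    have hy : tr (B * D) = tr B * tr D + tr A * tr (A * B * D)
        - tr (A * B) * tr (A * (A * B * D * (A * B)⁻¹)) - tr (B * (A * B * D * (A * B)⁻¹)) := by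
      have := tr_partner_y A B (A * B * D * (A * B)⁻¹)
      have e1 : tr (A * B * A⁻¹ * (A * B * D * (A * B)⁻¹)) = tr (B * D) := by
        rw [← tr_conj (A * B) (B * D)]
        congr 1; group
      have e2 : tr (A * B * (A * B * D * (A * B)⁻¹)) = tr (A * B * D) := by
        rw [← tr_conj (A * B) (A * B * D)]
        congr 1; group
      rw [e1, e2, tr_conj] at this
      exact this
    rw [twistPair, Prod.mk.injEq, ← tA, ← tB, ← tD]
    constructor
    · rw [hz] at hy
      linear_combination hy
    · rw [hz]

theorem twistY_traces {ρ : RelHom α} {C : Fin 4 → ℍ} (hC : IsCenters ρ C) :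
    ∃ C', IsCenters (precomp ρ twistY twistY_mem) C' ∧ liftProd α C' = liftProd α C ∧
      trY α C' = trY α C ∧
      (trX α C', trZ α C') = twistPair (trY α C)
        (2 * cos (α 0 / 2) * (2 * cos (α 1 / 2)) + 2 * cos (α 2 / 2) *
          tr (rotAt (α 0) (C 0) * rotAt (α 1) (C 1) * rotAt (α 2) (C 2)))
        (2 * cos (α 0 / 2) * (2 * cos (α 2 / 2)) + 2 * cos (α 1 / 2) *
          tr (rotAt (α 0) (C 0) * rotAt (α 1) (C 1) * rotAt (α 2) (C 2)))
        (trX α C, trZ α C) := by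
  set A := rotAt (α 0) (C 0) with hA
  set B := rotAt (α 1) (C 1) with hB
  set D := rotAt (α 2) (C 2) with hD
  set E := rotAt (α 3) (C 3) with hE
  have tA : tr A = 2 * cos (α 0 / 2) := tr_rotAt _ _
  have tB : tr B = 2 * cos (α 1 / 2) := tr_rotAt _ _
  have tD : tr D = 2 * cos (α 2 / 2) := tr_rotAt _ _
  refine ⟨_, isCenters_of_conj hC ![1, B * D, B * D, 1] ?_, ?_, ?_, ?_⟩
  · intro i
    have h0 := hC 1
    have h1 := hC 2
    rw [precomp_apply]
    fin_cases i <;>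
      simp [twistY, QuotientGroup.mk_mul, h0, h1, hD, hB]
  · simp only [liftProd, ← conj_rotAt]
    simp only [Matrix.cons_val, inv_one, one_mul, mul_one]
    rw [← hA, ← hB, ← hD, ← hE]
    group
  · simp only [trY, ← conj_rotAt]
    simp only [Matrix.cons_val]
    rw [← hB, ← hD]
    congr 1; group
  · simp only [trX, trY, trZ, ← conj_rotAt]
    simp only [Matrix.cons_val, inv_one, one_mul, mul_one]
    rw [← hA, ← hB, ← hD]
    have hz : tr (A * (B * D * D * (B * D)⁻¹)) = tr A * tr D + tr B * tr (A * B * D)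
      - tr (A * B) * tr (B * D) - tr (A * D) := by
      rw [← tr_partner_z]
      congr 1; group
    have hx : tr (A * B) = tr A * tr B + tr D * tr (A * B * D)
        - tr (B * D) * tr (A * (B * D * D * (B * D)⁻¹)) - tr (A * (B * D * B * (B * D)⁻¹)) := by
      have := tr_partner_x A (B * D * B * (B * D)⁻¹) (B * D * D * (B * D)⁻¹)
      have e1 : A * (B * D * D * (B * D)⁻¹)⁻¹ * (B * D * B * (B * D)⁻¹) *
          (B * D * D * (B * D)⁻¹) = A * B := by group
      have e2 : A * (B * D * B * (B * D)⁻¹) * (B * D * D * (B * D)⁻¹) = A * B * D := by group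
      have e3 : B * D * B * (B * D)⁻¹ * (B * D * D * (B * D)⁻¹) = B * D := by group
      rw [e1, e2, e3, tr_conj, tr_conj] at this
      exact this
    rw [twistPair, Prod.mk.injEq, ← tA, ← tB, ← tD]
    constructor
    · rw [hz] at hx
      linear_combination hx
    · rw [hz]; ring

/-- The generators c₁ and c₃ are not consecutive, so the second and the fourth generator are
conjugated by the two different products DA and AD. The trace computation is again a pair of Vieta
involutions. -/
theorem twistZ_traces {ρ : RelHom α} {C : Fin 4 → ℍ} (hC : IsCenters ρ C) :
    ∃ C', IsCenters (precomp ρ twistZ twistZ_mem) C' ∧ liftProd α C' = liftProd α C ∧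
      trZ α C' = trZ α C ∧
      (trX α C', trY α C') = twistPair (trZ α C)
        (2 * cos (α 0 / 2) * (2 * cos (α 1 / 2)) + 2 * cos (α 2 / 2) *
          tr (rotAt (α 0) (C 0) * rotAt (α 1) (C 1) * rotAt (α 2) (C 2)))
        (2 * cos (α 1 / 2) * (2 * cos (α 2 / 2)) + 2 * cos (α 0 / 2) *
          tr (rotAt (α 0) (C 0) * rotAt (α 1) (C 1) * rotAt (α 2) (C 2)))
        (trX α C, trY α C) := by
  set A := rotAt (α 0) (C 0) with hA
  set B := rotAt (α 1) (C 1) with hB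
  set D := rotAt (α 2) (C 2) with hD
  set E := rotAt (α 3) (C 3) with hE
  have tA : tr A = 2 * cos (α 0 / 2) := tr_rotAt _ _
  have tB : tr B = 2 * cos (α 1 / 2) := tr_rotAt _ _
  have tD : tr D = 2 * cos (α 2 / 2) := tr_rotAt _ _
  refine ⟨_, isCenters_of_conj hC ![1, D * A, 1, A * D] ?_, ?_, ?_, ?_⟩
  · intro i
    have h0 := hC 0
    have h1 := hC 2
    rw [precomp_apply]
    fin_cases i <;>
      simp [twistZ, QuotientGroup.mk_mul, h0, h1, hA, hD]
  · have : liftProd α C = A * B * D * E := rfl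
    rcases hC.liftProd_eq with e | e <;>
    · rw [e]
      rw [this] at e
      simp only [liftProd, ← conj_rotAt]
      simp only [Matrix.cons_val, inv_one, one_mul, mul_one]
      rw [← hA, ← hB, ← hD, ← hE]
      have : A * (D * A * B * (D * A)⁻¹) * D * (A * D * E * (A * D)⁻¹) =
        (A * D) * (A * B * D * E) * (A * D)⁻¹ := by group
      rw [this, e]
      simp
  · simp [trZ]
  · simp only [trX, trY, trZ, ← conj_rotAt]
    simp only [Matrix.cons_val, inv_one, one_mul, mul_one]
    rw [← hA, ← hB, ← hD]
    have hy : tr (D * A * B * (D * A)⁻¹ * D) = tr B * tr D + tr A * tr (A * B * D)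
      - tr (A * B) * tr (A * D) - tr (B * D) := by
      rw [← tr_partner_y, ← tr_conj D (A * B * A⁻¹ * D)]
      congr 1; group
    have hx : tr (A * B) = tr A * tr B + tr D * tr (A * B * D)
        - tr (D * A * B * (D * A)⁻¹ * D) * tr (A * D) - tr (A * (D * A * B * (D * A)⁻¹)) := by
      have := tr_partner_x A (D * A * B * (D * A)⁻¹) D
      have e1 : tr (A * D⁻¹ * (D * A * B * (D * A)⁻¹) * D) = tr (A * B) := by
        rw [← tr_conj A (A * B)]
        congr 1; group
      have e2 : tr (A * (D * A * B * (D * A)⁻¹) * D) = tr (A * B * D) := by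
        rw [← tr_conj (A * D) (A * B * D)]
        congr 1; group
      rw [e1, e2, tr_conj] at this
      exact this
    rw [twistPair, Prod.mk.injEq, ← tA, ← tB, ← tD]
    constructor
    · rw [hy] at hx
      linear_combination hx
    · rw [hy]; ring

end PuncturedSphere

end

noncomputable section
namespace PuncturedSphere

/-! ### Three-point orbits of the trace dynamics -/

/-- Three maps which act on a set of three points of `ℝ³` as Dehn twists act on traces. -/
structure IsTwistDynamics (E : Set (Fin 3 → ℝ)) (k : Fin 3 → ℝ)
    (T : Fin 3 → (Fin 3 → ℝ) → (Fin 3 → ℝ)) : Prop where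
  ncard : E.ncard = 3
  maps : ∀ i, ∀ p ∈ E, T i p ∈ E
  inj : ∀ i, Function.Injective (T i)
  coord : ∀ i p, T i p i = p i
  sq : ∀ i p, T i (T i p) = p → T i p = p ∨ p i = 0
  cube : ∀ i p, T i (T i (T i p)) = p → T i p = p ∨ p i ^ 2 = 1
  zero : ∀ i j p, p i = 0 → j ≠ i → T i p j = k j - p j
  fixed : ∀ i j l p, T i p = p → j ≠ i → l ≠ i → l ≠ j → 2 * p j + p i * p l = k j
  const : ∀ i j p, p i ≠ 0 → j ≠ i → T i p j = p j → T i (T i p) j = T i p j →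
    T i (T i p) = T i p
  -- A common fixed point of two twists would be a critical point of the cubic, which
  -- `IsCenters.not_singular_point` excludes.
  nofix : ∀ i j, ∀ p ∈ E, i ≠ j → T i p = p → T j p ≠ p

theorem eq_triple_of_ncard {β : Type*} {E : Set β} (hE : E.ncard = 3) {p q r : β} (hp : p ∈ E)
    (hq : q ∈ E) (hr : r ∈ E) (hpq : p ≠ q) (hpr : p ≠ r) (hqr : q ≠ r) : E = {p, q, r} := by
  have hfin : E.Finite := Set.finite_of_ncard_ne_zero (by omega)
  symm
  apply Set.eq_of_subset_of_ncard_le _ _ hfin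
  · rintro s (rfl | rfl | rfl) <;> assumption
  · rw [hE, Set.ncard_eq_three.2 ⟨p, q, r, hpq, hpr, hqr, rfl⟩]

theorem exists_period_le_three {β : Type*} {E : Set β} (hE : E.ncard = 3) {f : β → β}
    (hf : ∀ p ∈ E, f p ∈ E) (hinj : Function.Injective f) {p : β} (hp : p ∈ E) :
    f p = p ∨ f (f p) = p ∨ f (f (f p)) = p := by
  by_contra hc
  push Not at hc
  obtain ⟨h1, h2, h3⟩ := hc
  have e1 : f p ≠ f (f p) := fun h => h1 (hinj h).symm
  have e2 : f p ≠ f (f (f p)) := fun h => h2 (hinj h).symm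
  have e3 : f (f p) ≠ f (f (f p)) := fun h => e1 (hinj h)
  have h4 := hf _ (hf _ (hf _ hp))
  rw [eq_triple_of_ncard hE hp (hf _ hp) (hf _ (hf _ hp)) h1.symm h2.symm e1] at h4
  rcases h4 with h | h | h
  exacts [h3 h, e2 h.symm, e3 h.symm]

namespace IsTwistDynamics

variable {E : Set (Fin 3 → ℝ)} {k : Fin 3 → ℝ} {T : Fin 3 → (Fin 3 → ℝ) → (Fin 3 → ℝ)}

/-- An injective self-map of three points has period at most three at each of them. Period two
forces a zero coordinate, and period three forces coordinate ±1 and exhausts the set. -/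
theorem trichotomy (h : IsTwistDynamics E k T) (i : Fin 3) {p : Fin 3 → ℝ} (hp : p ∈ E) :
    T i p = p ∨ p i = 0 ∨
      (p i ^ 2 = 1 ∧ T i p ≠ p ∧ E = {p, T i p, T i (T i p)}) := by
  by_cases h1 : T i p = p
  · exact Or.inl h1
  by_cases h0 : p i = 0
  · exact Or.inr (Or.inl h0)
  have h2 : T i (T i p) ≠ p := fun e => (h.sq i p e).elim h1 h0
  have h3 := ((exists_period_le_three h.ncard (h.maps i) (h.inj i) hp).resolve_left
    h1).resolve_left h2
  refine Or.inr (Or.inr ⟨(h.cube i p h3).resolve_left h1, h1, ?_⟩)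
  exact eq_triple_of_ncard h.ncard hp (h.maps i _ hp) (h.maps i _ (h.maps i _ hp)) (Ne.symm h1)
    (Ne.symm h2) (fun e => h1 (h.inj i e).symm)

/-- Some twist permutes the three points cyclically. -/
theorem exists_cycle (h : IsTwistDynamics E k T) : ∃ i, ∃ p ∈ E,
    p i ^ 2 = 1 ∧ T i p ≠ p ∧ E = {p, T i p, T i (T i p)} := by
  by_contra hc
  push Not at hc
  have hd : ∀ i, ∀ p ∈ E, T i p = p ∨ p i = 0 := by
    intro i p hp
    rcases h.trichotomy i hp with h1 | h1 | ⟨h1, h2, h3⟩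
    · exact Or.inl h1
    · exact Or.inr h1
    · exact absurd h3 (hc i p hp h1 h2)
  -- Without fixed points all coordinates of all three points would vanish.
  obtain ⟨i, p, hp, hfix⟩ : ∃ i, ∃ p ∈ E, T i p = p := by
    by_contra hc'
    push Not at hc'
    have hsub : E ⊆ {0} := by
      intro p hp
      funext i
      exact (hd i p hp).resolve_left (hc' i p hp)
    have := Set.ncard_le_ncard hsub (Set.finite_singleton _)
    rw [h.ncard, Set.ncard_singleton] at this
    omega
  obtain ⟨j, l, hji, hli, hlj, hall⟩ : ∃ j l : Fin 3, j ≠ i ∧ l ≠ i ∧ l ≠ j ∧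
      ∀ m, m = i ∨ m = j ∨ m = l := by
    clear * -; revert i; decide
  have nj : T j p ≠ p := h.nofix i j p hp hji.symm hfix
  have nl : T l p ≠ p := h.nofix i l p hp hli.symm hfix
  have pj := (hd j p hp).resolve_left nj
  have pl := (hd l p hp).resolve_left nl
  have kj := h.fixed i j l p hfix hji hli hlj
  have kl := h.fixed i l j p hfix hli hji hlj.symm
  rw [pj, pl] at kj kl
  have kj' : k j = 0 := by linarith
  have kl' : k l = 0 := by linarith
  -- At p the j-th and l-th coordinates and coefficients vanish, so both twists only replace the
  -- i-th coordinate by `k i - p i`.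
  have eq : T j p = T l p := by
    funext m
    rcases hall m with rfl | rfl | rfl
    · rw [h.zero j m p pj hji.symm, h.zero l m p pl hli.symm]
    · rw [h.coord, h.zero l m p pl hlj.symm, kj', pj, sub_zero]
    · rw [h.coord, h.zero j m p pj hlj, kl', pl, sub_zero]
  have hq := h.maps j p hp
  have back : ∀ m n, n ≠ i → m ≠ i → m ≠ n → T m p = T n p → p m = 0 → k m = 0 → p n = 0 →
      k n = 0 → T m (T m p) = p := by
    intro m n hn hm hmn he pm km pn kn
    have q0 : T m p m = 0 := by rw [h.coord, pm]
    have hall' : ∀ s, s = i ∨ s = m ∨ s = n := by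
      clear * - hn hm hmn; revert i m n; decide
    funext s
    rcases hall' s with rfl | rfl | rfl
    · rw [h.zero m s _ q0 hm.symm, h.zero m s p pm hm.symm]; ring
    · rw [h.coord, h.coord]
    · rw [h.zero m s _ q0 hmn.symm, h.zero m s p pm hmn.symm, kn, pn]; ring
  have bj := back j l hli hji hlj.symm eq pj kj' pl kl'
  have bl := back l j hji hli hlj eq.symm pl kl' pj kj'
  obtain ⟨r, hr, hrp, hrq⟩ : ∃ r ∈ E, r ≠ p ∧ r ≠ T j p := by
    by_contra hc'
    push Not at hc'
    have hsub : E ⊆ {p, T j p} := by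
      intro r hr
      by_cases e : r = p
      · exact Or.inl e
      · exact Or.inr (hc' r hr e)
    have := Set.ncard_le_ncard hsub (Set.toFinite _)
    have h2 := Set.ncard_insert_le p {T j p}
    rw [Set.ncard_singleton] at h2
    rw [h.ncard] at this
    omega
  -- Both twists exchange p and `T j p`, so they both fix the third point r. This contradicts
  -- `nofix`.
  have hE := eq_triple_of_ncard h.ncard hp hq hr nj.symm hrp.symm hrq.symm
  have fixr : ∀ m, T m p = T j p → T m (T m p) = p → T m r = r := by
    intro m hm hm'
    have : T m r ∈ E := h.maps m r hr
    rw [hE] at this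
    rcases this with e | e | e
    · exact absurd (h.inj m (e.trans hm'.symm)) (by rw [hm]; exact hrq)
    · rw [← hm] at e
      exact absurd (h.inj m e) hrp
    · exact e
  exact h.nofix j l r hr hlj.symm (fixr j rfl bj) (fixr l eq.symm bl)

/-- Along the cyclic twist i, the i-th coordinate is constant. No other twist can be cyclic, because
a second constant coordinate would stop the first twist. For the others a point is either fixed or
has coordinate zero, and the fixed point equations leave just three candidates. -/
theorem classification (h : IsTwistDynamics E k T) : ∃ i, ∃ x : ℝ, x ^ 2 = 1 ∧ k i = 2 * x ∧
    ∀ j l, j ≠ i → l ≠ i → l ≠ j → k l = x * k j ∧ k j ≠ 0 ∧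
      ∀ p, p ∈ E ↔ p i = x ∧ (p j = k j ∧ p l = 0 ∨ p j = 0 ∧ p l = k l ∨ p j = 0 ∧ p l = 0) := by
  obtain ⟨i, p, hp, hx, hTp, hE⟩ := h.exists_cycle
  refine ⟨i, p i, hx, ?_⟩
  set x := p i with hxdef
  have hx0 : x ≠ 0 := by rintro e; rw [e] at hx; norm_num at hx
  have hEx : ∀ q ∈ E, q i = x := by
    intro q hq
    rw [hE] at hq
    rcases hq with rfl | rfl | rfl
    · rfl
    · rw [h.coord]
    · rw [h.coord, h.coord]
  have hd : ∀ j, j ≠ i → ∀ q ∈ E, T j q = q ∨ q j = 0 := by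
    intro j hj q hq
    rcases h.trichotomy j hq with h1 | h1 | ⟨h1, h2, h3⟩
    · exact Or.inl h1
    · exact Or.inr h1
    · exfalso
      have hc : ∀ r ∈ E, r j = q j := by
        intro r hr
        rw [h3] at hr
        rcases hr with rfl | rfl | rfl
        · rfl
        · rw [h.coord]
        · rw [h.coord, h.coord]
      have m1 := h.maps i p hp
      have m2 := h.maps i _ m1
      have := h.const i j p hx0 hj (by rw [hc _ m1, hc _ hp]) (by rw [hc _ m2, hc _ m1])
      exact hTp (h.inj i this)
  have small : ∀ a b : Fin 3 → ℝ, ¬ E ⊆ {a, b} := by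
    intro a b hsub
    have := Set.ncard_le_ncard hsub (Set.toFinite _)
    have h2 := Set.ncard_insert_le a {b}
    rw [Set.ncard_singleton] at h2
    rw [h.ncard] at this
    omega
  have main : ∀ j l, j ≠ i → l ≠ i → l ≠ j → k i = 2 * x ∧ k l = x * k j ∧ k j ≠ 0 ∧
      ∀ p, p ∈ E ↔ p i = x ∧ (p j = k j ∧ p l = 0 ∨ p j = 0 ∧ p l = k l ∨ p j = 0 ∧ p l = 0) := by
    intro j l hj hl hlj
    have hall : ∀ m, m = i ∨ m = j ∨ m = l := by
      clear * - hj hl hlj; revert i j l; decide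
    have ext3 : ∀ p q : Fin 3 → ℝ, p i = q i → p j = q j → p l = q l → p = q := by
      intro p q h1 h2 h3
      funext m
      rcases hall m with rfl | rfl | rfl <;> assumption
    -- a point with `q j ≠ 0` is fixed by the `j`-th twist
    have fixd : ∀ j l, j ≠ i → l ≠ i → l ≠ j → ∀ q ∈ E, q j ≠ 0 →
        q l = 0 ∧ k i = 2 * x ∧ q j = x * k l ∧ T j q = q := by
      intro j l hj hl hlj q hq hqj
      have hf := (hd j hj q hq).resolve_right hqj
      have hl0 := (hd l hl q hq).resolve_left (h.nofix j l q hq hlj.symm hf)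
      have e1 := h.fixed j i l q hf hj.symm hlj hl
      have e2 := h.fixed j l i q hf hlj hj.symm hl.symm
      rw [hl0, hEx q hq] at e1 e2
      refine ⟨hl0, by linarith, ?_, hf⟩
      linear_combination (-q j) * hx + x * e2
    have point : ∀ u v : ℝ, ∃ q : Fin 3 → ℝ, q i = x ∧ q j = u ∧ q l = v := fun u v =>
      ⟨fun m => if m = i then x else if m = j then u else v, by simp, by simp [hj],
        by simp [hl, hlj]⟩
    -- The candidates are indexed by which of the coordinates j and l is nonzero; both cannot be.
    -- Since there are three points, none of the candidates is missing and no two of them coincide.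
    obtain ⟨Pj, hPj⟩ := point (x * k l) 0
    obtain ⟨Pl, hPl⟩ := point 0 (x * k j)
    obtain ⟨P0, hP0⟩ := point 0 0
    have cases3 : ∀ q ∈ E, q = Pj ∨ q = Pl ∨ q = P0 := by
      intro q hq
      by_cases e1 : q j = 0
      · by_cases e2 : q l = 0
        · right; right
          exact ext3 _ _ (by rw [hEx q hq, hP0.1]) (by rw [e1, hP0.2.1]) (by rw [e2, hP0.2.2])
        · obtain ⟨-, -, f, -⟩ := fixd l j hl hj hlj.symm q hq e2
          right; left
          exact ext3 _ _ (by rw [hEx q hq, hPl.1]) (by rw [e1, hPl.2.1]) (by rw [f, hPl.2.2])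
      · obtain ⟨f0, -, f, -⟩ := fixd j l hj hl hlj q hq e1
        left
        exact ext3 _ _ (by rw [hEx q hq, hPj.1]) (by rw [f, hPj.2.1]) (by rw [f0, hPj.2.2])
    have mPj : Pj ∈ E := by
      by_contra hn
      exact small Pl P0 fun q hq => by
        rcases cases3 q hq with rfl | rfl | rfl
        · exact absurd hq hn
        · exact Or.inl rfl
        · exact Or.inr rfl
    have mPl : Pl ∈ E := by
      by_contra hn
      exact small Pj P0 fun q hq => by
        rcases cases3 q hq with rfl | rfl | rfl
        · exact Or.inl rfl
        · exact absurd hq hn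
        · exact Or.inr rfl
    have mP0 : P0 ∈ E := by
      by_contra hn
      exact small Pj Pl fun q hq => by
        rcases cases3 q hq with rfl | rfl | rfl
        · exact Or.inl rfl
        · exact Or.inr rfl
        · exact absurd hq hn
    have nPj : Pj j ≠ 0 := by
      intro e
      have : Pj = P0 := ext3 _ _ (by rw [hPj.1, hP0.1]) (by rw [e, hP0.2.1])
        (by rw [hPj.2.2, hP0.2.2])
      exact small Pl P0 fun q hq => by
        rcases cases3 q hq with rfl | rfl | rfl
        · exact Or.inr this
        · exact Or.inl rfl
        · exact Or.inr rfl
    have nPl : Pl l ≠ 0 := by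
      intro e
      have : Pl = P0 := ext3 _ _ (by rw [hPl.1, hP0.1]) (by rw [hPl.2.1, hP0.2.1])
        (by rw [e, hP0.2.2])
      exact small Pj P0 fun q hq => by
        rcases cases3 q hq with rfl | rfl | rfl
        · exact Or.inl rfl
        · exact Or.inr this
        · exact Or.inr rfl
    obtain ⟨-, ki, -, -⟩ := fixd j l hj hl hlj Pj mPj nPj
    obtain ⟨-, -, -, fl⟩ := fixd l j hl hj hlj.symm Pl mPl nPl
    -- The twist j moves Pl and keeps its j-th coordinate 0, so it sends Pl to P0. Comparing l-th
    -- coordinates relates `k l` and `k j`.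
    have nfj : T j Pl ≠ Pl := h.nofix l j Pl mPl hlj fl
    have z1 := h.zero j l Pl hPl.2.1 hlj
    have kl : k l = x * k j := by
      rcases cases3 _ (h.maps j Pl mPl) with e | e | e
      · exfalso
        apply nPj
        rw [← e, h.coord, hPl.2.1]
      · exact absurd e nfj
      · rw [e, hP0.2.2, hPl.2.2] at z1
        linarith
    have kj : k j = x * k l := by
      rw [kl]; linear_combination (-k j) * hx
    refine ⟨ki, kl, ?_, fun q => ⟨fun hq => ⟨hEx q hq, ?_⟩, ?_⟩⟩
    · rw [kj, ← hPj.2.1]; exact nPj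
    · rcases cases3 q hq with rfl | rfl | rfl
      · exact Or.inl ⟨by rw [hPj.2.1, kj], hPj.2.2⟩
      · exact Or.inr (Or.inl ⟨hPl.2.1, by rw [hPl.2.2, kl]⟩)
      · exact Or.inr (Or.inr hP0.2)
    · rintro ⟨h1, ⟨h2, h3⟩ | ⟨h2, h3⟩ | ⟨h2, h3⟩⟩
      · have : q = Pj := ext3 _ _ (by rw [h1, hPj.1]) (by rw [h2, hPj.2.1, ← kj])
          (by rw [h3, hPj.2.2])
        rwa [this]
      · have : q = Pl := ext3 _ _ (by rw [h1, hPl.1]) (by rw [h2, hPl.2.1])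
          (by rw [h3, hPl.2.2, ← kl])
        rwa [this]
      · have : q = P0 := ext3 _ _ (by rw [h1, hP0.1]) (by rw [h2, hP0.2.1])
          (by rw [h3, hP0.2.2])
        rwa [this]
  constructor
  · obtain ⟨j, l, hji, hli, hlj⟩ : ∃ j l : Fin 3, j ≠ i ∧ l ≠ i ∧ l ≠ j := by
      clear * -; revert i; decide
    exact (main j l hji hli hlj).1
  · intro j l hj hl hlj
    exact (main j l hj hl hlj).2

end IsTwistDynamics
end PuncturedSphere

end

noncomputable section
namespace PuncturedSphere
open SphereGroup
variable {α : Fin 4 → ℝ}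

/-! ### Trace coordinates on the character variety -/

/-- All angles lie between `π` and `2π`, and their sum exceeds `6π`. -/
structure IsLarge (α : Fin 4 → ℝ) : Prop where
  lt : ∀ i, π < α i
  lt' : ∀ i, α i < 2 * π
  sum : 6 * π < α 0 + α 1 + α 2 + α 3

theorem IsLarge.pos (h : IsLarge α) (i : Fin 4) : 0 < α i := pi_pos.trans (h.lt i)

theorem IsLarge.bounds (h : IsLarge α) (i : Fin 4) : 0 < α i ∧ α i < 2 * π :=
  ⟨h.pos i, h.lt' i⟩

/-- The fixed points of the peripheral generators, for some representation in the class. -/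
def centers (X : CharVar α) : Fin 4 → ℍ :=
  (exists_isCenters (Quotient.out (s := conjSetoid α) X)).choose

/-- The sign of the product of the canonical lifts. -/
def sgn (X : CharVar α) : ℝ := liftProd α (centers X) 0 0

/-- The three trace coordinates. -/
def traceVec (X : CharVar α) : Fin 3 → ℝ :=
  ![trX α (centers X), trY α (centers X), trZ α (centers X)]

/-- Removes the choice of representative from `sgn` and `traceVec`: centres are unique, and
conjugation moves all of them by one isometry. -/
theorem sgn_traceVec_mk (hα : ∀ i, 0 < α i ∧ α i < 2 * π) {ρ : RelHom α} {C : Fin 4 → ℍ}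
    (hC : IsCenters ρ C) : sgn (CharVar.mk ρ) = liftProd α C 0 0 ∧
      traceVec (CharVar.mk ρ) = ![trX α C, trY α C, trZ α C] := by
  have h := (exists_isCenters (Quotient.out (s := conjSetoid α) (CharVar.mk ρ))).choose_spec
  obtain ⟨C', h', e0, e1, e2, e3⟩ := h.conj (ρ' := ρ) (Quotient.out_eq _)
  obtain rfl := h'.unique hα hC
  simp only [sgn, traceVec, centers]
  rw [e0, e1, e2, e3]
  exact ⟨rfl, rfl⟩

theorem IsCenters.sgn_eq_or {ρ : RelHom α} {C : Fin 4 → ℍ} (hC : IsCenters ρ C) :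
    liftProd α C = 1 ∧ liftProd α C 0 0 = 1 ∨ liftProd α C = -1 ∧ liftProd α C 0 0 = -1 := by
  rcases hC.liftProd_eq with e | e
  · left; rw [e]; simp
  · right; rw [e]; simp

theorem exists_rep (X : CharVar α) : ∃ ρ : RelHom α, CharVar.mk ρ = X := Quotient.exists_rep X

theorem exists_rep_centers (X : CharVar α) :
    ∃ (ρ : RelHom α) (C : Fin 4 → ℍ), CharVar.mk ρ = X ∧ IsCenters ρ C := by
  obtain ⟨ρ, h⟩ := exists_rep X
  obtain ⟨C, hC⟩ := exists_isCenters ρ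
  exact ⟨ρ, C, h, hC⟩

theorem sgn_eq_or (hα : ∀ i, 0 < α i ∧ α i < 2 * π) (X : CharVar α) : sgn X = 1 ∨ sgn X = -1 := by
  obtain ⟨ρ, C, rfl, hC⟩ := exists_rep_centers X
  rw [(sgn_traceVec_mk hα hC).1]
  rcases hC.sgn_eq_or with h | h
  exacts [Or.inl h.2, Or.inr h.2]

/-- Classes of negative sign are determined by their traces. -/
theorem eq_of_traceVec_eq (hα : ∀ i, 0 < α i ∧ α i < 2 * π) {X Y : CharVar α} (hX : sgn X = -1)
    (hY : sgn Y = -1) (h : traceVec X = traceVec Y) : X = Y := by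
  obtain ⟨ρ, C, rfl, hC⟩ := exists_rep_centers X
  obtain ⟨ρ', C', rfl, hC'⟩ := exists_rep_centers Y
  rw [(sgn_traceVec_mk hα hC).1] at hX
  rw [(sgn_traceVec_mk hα hC').1] at hY
  rw [(sgn_traceVec_mk hα hC).2, (sgn_traceVec_mk hα hC').2] at h
  have e0 := congrFun h 0
  have e1 := congrFun h 1
  have e2 := congrFun h 2
  refine mk_eq_mk_of_traces hα hC hC' ?_ ?_ e0 e1 e2
  · rcases hC.sgn_eq_or with h | h
    · rw [h.2] at hX; norm_num at hX
    · exact h.1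
  · rcases hC'.sgn_eq_or with h | h
    · rw [h.2] at hY; norm_num at hY
    · exact h.1

/-- The coefficients of the cubic surface of traces. -/
def coef (α : Fin 4 → ℝ) (ε : ℝ) : Fin 3 → ℝ :=
  ![2 * cos (α 0 / 2) * (2 * cos (α 1 / 2)) + 2 * cos (α 2 / 2) * (ε * (2 * cos (α 3 / 2))),
    2 * cos (α 1 / 2) * (2 * cos (α 2 / 2)) + 2 * cos (α 0 / 2) * (ε * (2 * cos (α 3 / 2))),
    2 * cos (α 0 / 2) * (2 * cos (α 2 / 2)) + 2 * cos (α 1 / 2) * (ε * (2 * cos (α 3 / 2)))]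

/-- The actions of three Dehn twists on traces. -/
def twistMap (k : Fin 3 → ℝ) (i : Fin 3) (p : Fin 3 → ℝ) : Fin 3 → ℝ :=
  match i with
  | 0 => ![p 0, (twistPair (p 0) (k 1) (k 2) (p 1, p 2)).1,
      (twistPair (p 0) (k 1) (k 2) (p 1, p 2)).2]
  | 1 => ![(twistPair (p 1) (k 0) (k 2) (p 0, p 2)).1, p 1,
      (twistPair (p 1) (k 0) (k 2) (p 0, p 2)).2]
  | 2 => ![(twistPair (p 2) (k 0) (k 1) (p 0, p 1)).1,
      (twistPair (p 2) (k 0) (k 1) (p 0, p 1)).2, p 2]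

/-- The three Dehn twists. -/
def twists (i : Fin 3) : PureAut :=
  match i with
  | 0 => ⟨twistX, twistX_mem⟩⁻¹
  | 1 => ⟨twistY, twistY_mem⟩⁻¹
  | 2 => ⟨twistZ, twistZ_mem⟩⁻¹

theorem IsCenters.tr_triple {ρ : RelHom α} {C : Fin 4 → ℍ} (hC : IsCenters ρ C) :
    tr (rotAt (α 0) (C 0) * rotAt (α 1) (C 1) * rotAt (α 2) (C 2)) =
      liftProd α C 0 0 * (2 * cos (α 3 / 2)) := by
  rcases hC.sgn_eq_or with h | h
  · rw [h.2, tr_triple_pos h.1]; ring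
  · rw [h.2, PuncturedSphere.tr_triple h.1]; ring

/-- The action precomposes with the inverse automorphism. The inverses in `twists` cancel this, so
the formulas are those of precomposition with the twists themselves. -/
theorem twists_smul (hα : ∀ i, 0 < α i ∧ α i < 2 * π) (i : Fin 3) (X : CharVar α) :
    sgn (twists i • X) = sgn X ∧
      traceVec (twists i • X) = twistMap (coef α (sgn X)) i (traceVec X) := by
  obtain ⟨ρ, C, rfl, hC⟩ := exists_rep_centers X
  rw [(sgn_traceVec_mk hα hC).1, (sgn_traceVec_mk hα hC).2]
  fin_cases i
  · obtain ⟨C', hC', e0, e1, e2⟩ := twistX_traces hC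
    have h := sgn_traceVec_mk hα hC'
    rw [mk_precomp] at h
    refine ⟨h.1.trans (by rw [e0]), h.2.trans ?_⟩
    rw [hC.tr_triple] at e2
    simp only [twistMap, coef, Matrix.cons_val]
    rw [← e2, e1]
  · obtain ⟨C', hC', e0, e1, e2⟩ := twistY_traces hC
    have h := sgn_traceVec_mk hα hC'
    rw [mk_precomp] at h
    refine ⟨h.1.trans (by rw [e0]), h.2.trans ?_⟩
    rw [hC.tr_triple] at e2
    simp only [twistMap, coef, Matrix.cons_val]
    rw [← e2, e1]
  · obtain ⟨C', hC', e0, e1, e2⟩ := twistZ_traces hC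
    have h := sgn_traceVec_mk hα hC'
    rw [mk_precomp] at h
    refine ⟨h.1.trans (by rw [e0]), h.2.trans ?_⟩
    rw [hC.tr_triple] at e2
    simp only [twistMap, coef, Matrix.cons_val]
    rw [← e2, e1]

theorem cons3_inj {a b c a' b' c' : ℝ} :
    (![a, b, c] : Fin 3 → ℝ) = ![a', b', c'] ↔ a = a' ∧ b = b' ∧ c = c' := by
  constructor
  · intro h
    exact ⟨congrFun h 0, congrFun h 1, congrFun h 2⟩
  · rintro ⟨rfl, rfl, rfl⟩; rfl

theorem eq_cons3_iff {a b c : ℝ} {p : Fin 3 → ℝ} :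
    ![a, b, c] = p ↔ a = p 0 ∧ b = p 1 ∧ c = p 2 := by
  constructor
  · rintro rfl
    exact ⟨rfl, rfl, rfl⟩
  · rintro ⟨rfl, rfl, rfl⟩
    funext i; fin_cases i <;> rfl

/-- The index pair complementary to `i`, and the recurrence satisfied by `twistMap`. -/
theorem exists_twistMap_eq (k : Fin 3 → ℝ) (i : Fin 3) : ∃ j l : Fin 3, j ≠ i ∧ l ≠ i ∧ l ≠ j ∧
    (∀ m, m = i ∨ m = j ∨ m = l) ∧ ∀ p, twistMap k i p i = p i ∧
      (twistMap k i p j, twistMap k i p l) = twistPair (p i) (k j) (k l) (p j, p l) := by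
  fin_cases i
  · exact ⟨1, 2, by decide, by decide, by decide, by decide, fun p => ⟨rfl, rfl⟩⟩
  · exact ⟨0, 2, by decide, by decide, by decide, by decide, fun p => ⟨rfl, rfl⟩⟩
  · exact ⟨0, 1, by decide, by decide, by decide, by decide, fun p => ⟨rfl, rfl⟩⟩

theorem twistPair_injective (x m n : ℝ) : Function.Injective (twistPair x m n) := by
  rintro ⟨u, v⟩ ⟨u', v'⟩ h
  simp only [twistPair, Prod.mk.injEq] at h ⊢
  obtain ⟨h1, h2⟩ := h
  have hu' : u = u' := by linear_combination -h1 - x * h2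
  exact ⟨hu', by rw [hu'] at h2; linarith⟩

section twistMap

variable {k : Fin 3 → ℝ}

theorem twistMap_injective (i : Fin 3) : Function.Injective (twistMap k i) := by
  obtain ⟨j, l, -, -, -, hall, h⟩ := exists_twistMap_eq k i
  intro p q e
  have hi : p i = q i := by rw [← (h p).1, e, (h q).1]
  have h2 := (h p).2
  rw [e, (h q).2, hi] at h2
  have h3 := twistPair_injective _ _ _ h2
  rw [Prod.mk.injEq] at h3
  funext m
  rcases hall m with rfl | rfl | rfl
  exacts [hi, h3.1.symm, h3.2.symm]

theorem twistMap_coord (i : Fin 3) (p : Fin 3 → ℝ) : twistMap k i p i = p i := by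
  obtain ⟨j, l, -, -, -, -, h⟩ := exists_twistMap_eq k i
  exact (h p).1

theorem twistMap_sq (i : Fin 3) (p : Fin 3 → ℝ) (e : twistMap k i (twistMap k i p) = p) :
    twistMap k i p = p ∨ p i = 0 := by
  obtain ⟨j, l, -, -, -, hall, h⟩ := exists_twistMap_eq k i
  have h1 := (h p).2
  have h2 := (h (twistMap k i p)).2
  rw [e, (h p).1, h1] at h2
  refine (twistPair_sq h2.symm).imp_left fun h3 => ?_
  rw [← h1, Prod.mk.injEq] at h3
  funext m
  rcases hall m with rfl | rfl | rfl
  exacts [(h p).1, h3.1, h3.2]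

theorem twistMap_cube (i : Fin 3) (p : Fin 3 → ℝ)
    (e : twistMap k i (twistMap k i (twistMap k i p)) = p) :
    twistMap k i p = p ∨ p i ^ 2 = 1 := by
  obtain ⟨j, l, -, -, -, hall, h⟩ := exists_twistMap_eq k i
  have h1 := (h p).2
  have h2 := (h (twistMap k i p)).2
  have h3 := (h (twistMap k i (twistMap k i p))).2
  rw [(h p).1, h1] at h2
  rw [e, (h _).1, (h p).1, h2] at h3
  refine (twistPair_cube h3.symm).imp_left fun h4 => ?_
  rw [← h1, Prod.mk.injEq] at h4
  funext m
  rcases hall m with rfl | rfl | rfl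
  exacts [(h p).1, h4.1, h4.2]

theorem twistMap_zero (i m : Fin 3) (p : Fin 3 → ℝ) (hp : p i = 0) (hm : m ≠ i) :
    twistMap k i p m = k m - p m := by
  obtain ⟨j, l, -, -, -, hall, h⟩ := exists_twistMap_eq k i
  have h1 := (h p).2
  rw [hp, twistPair_zero, Prod.mk.injEq] at h1
  rcases hall m with rfl | rfl | rfl
  exacts [absurd rfl hm, h1.1, h1.2]

theorem twistMap_fixed (i j l : Fin 3) (p : Fin 3 → ℝ) (hp : twistMap k i p = p) (hj : j ≠ i)
    (hl : l ≠ i) (hlj : l ≠ j) : 2 * p j + p i * p l = k j := by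
  obtain ⟨j', l', hj', hl', hlj', hall, h⟩ := exists_twistMap_eq k i
  have h1 := (h p).2
  rw [hp] at h1
  have h2 := twistPair_eq_self h1.symm
  rcases hall j with rfl | rfl | rfl
  · exact absurd rfl hj
  · obtain rfl : l = l' := by
      rcases hall l with e | e | e
      exacts [absurd e hl, absurd e hlj, e]
    exact h2.1
  · obtain rfl : l = j' := by
      rcases hall l with e | e | e
      exacts [absurd e hl, e, absurd e hlj]
    exact h2.2

/-- When `p i` is nonzero, the recurrence for one moving coordinate determines the other, so if one
is stationary for two steps the other becomes stationary too. -/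
theorem twistMap_const (i m : Fin 3) (p : Fin 3 → ℝ) (hp : p i ≠ 0) (hm : m ≠ i)
    (e1 : twistMap k i p m = p m)
    (e2 : twistMap k i (twistMap k i p) m = twistMap k i p m) :
    twistMap k i (twistMap k i p) = twistMap k i p := by
  obtain ⟨j, l, hj, hl, hlj, hall, h⟩ := exists_twistMap_eq k i
  have h1 := (h p).2
  have h2 := (h (twistMap k i p)).2
  rw [(h p).1] at h2
  simp only [twistPair, Prod.mk.injEq] at h1 h2
  obtain ⟨a1, a2⟩ := h1
  obtain ⟨b1, b2⟩ := h2
  rw [← a2] at a1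
  rw [← b2] at b1
  rcases hall m with rfl | rfl | rfl
  · exact absurd rfl hm
  · have : twistMap k i (twistMap k i p) l = twistMap k i p l := by
      apply mul_left_cancel₀ hp
      linarith
    funext s
    rcases hall s with rfl | rfl | rfl
    exacts [twistMap_coord _ _, e2, this]
  · have e3 : twistMap k i p j = p j := by
      apply mul_left_cancel₀ hp
      linarith
    apply congrArg
    funext s
    rcases hall s with rfl | rfl | rfl
    exacts [twistMap_coord _ _, e3, e1]

end twistMap

/-! ### Poles -/

theorem rotAt_mul_same (φ ψ : ℝ) (z : ℍ) : rotAt φ z * rotAt ψ z = rotAt (φ + ψ) z := by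
  have h := hw_mul_hv z
  have e : (φ + ψ) / 2 = φ / 2 + ψ / 2 := by ring
  apply sl_ext <;> simp only [mul_00, mul_01, mul_10, mul_11, rotAt_00, rotAt_01, rotAt_10,
    rotAt_11, e, cos_add, sin_add]
  · linear_combination (-sin (φ / 2) * sin (ψ / 2)) * h
  · ring
  · ring
  · linear_combination (-sin (φ / 2) * sin (ψ / 2)) * h

theorem IsCenters.smul_eq {ρ : RelHom α} {C : Fin 4 → ℍ} (hC : IsCenters ρ C) (z : ℍ) :
    rotAt (α 0) (C 0) • rotAt (α 1) (C 1) • rotAt (α 2) (C 2) • rotAt (α 3) (C 3) • z = z := by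
  rw [← mul_smul, ← mul_smul, ← mul_smul]
  change liftProd α C • z = z
  rcases hC.liftProd_eq with e | e <;> rw [e]
  · simp
  · rw [neg_smul_eq, one_smul]

/-- The four fixed points are not all equal. -/
theorem not_all_fixed (hα : IsLarge α) {ρ : RelHom α} {C : Fin 4 → ℍ} (hC : IsCenters ρ C)
    {z : ℍ} (h : ∀ i, C i = z) : False := by
  have e : liftProd α C = rotAt (α 0 + α 1 + α 2 + α 3) z := by
    rw [liftProd, h, h, h, h, rotAt_mul_same, rotAt_mul_same, rotAt_mul_same]
  have h10 : sin ((α 0 + α 1 + α 2 + α 3) / 2) * hv z = 0 := by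
    have : liftProd α C 1 0 = 0 := by
      rcases hC.liftProd_eq with e | e <;> rw [e] <;> simp
    rw [e, rotAt_10] at this
    linarith
  have hs := (mul_eq_zero.1 h10).resolve_right (hv_pos z).ne'
  -- Half of the angle sum lies strictly between 3π and 4π, where the sine does not vanish, so the
  -- product of four rotations about one point is not ±1.
  have : sin ((α 0 + α 1 + α 2 + α 3) / 2) = -sin ((α 0 + α 1 + α 2 + α 3) / 2 - 3 * π) := by
    rw [show (α 0 + α 1 + α 2 + α 3) / 2 - 3 * π = (α 0 + α 1 + α 2 + α 3) / 2 - π - 2 * π by ring,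
      sin_sub_two_pi, sin_sub_pi, neg_neg]
  have hp : 0 < sin ((α 0 + α 1 + α 2 + α 3) / 2 - 3 * π) := by
    apply sin_pos_of_pos_of_lt_pi
    · linarith [hα.sum]
    · linarith [hα.lt' 0, hα.lt' 1, hα.lt' 2, hα.lt' 3]
  linarith

/-- By the product relation, a common fixed point of three of the rotations is fixed by the fourth,
which reduces to `not_all_fixed`. -/
theorem not_three_fixed (hα : IsLarge α) {ρ : RelHom α} {C : Fin 4 → ℍ} (hC : IsCenters ρ C)
    {z : ℍ} (i : Fin 4) (h : ∀ j, j ≠ i → C j = z) : False := by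
  apply not_all_fixed hα hC (z := z)
  have key : C i = z := by
    have e := hC.smul_eq z
    have f : ∀ j, j ≠ i → rotAt (α j) (C j) • z = z := fun j hj => by
      rw [h j hj]; exact rotAt_smul_self _ _
    have f' : ∀ j, j ≠ i → (rotAt (α j) (C j))⁻¹ • z = z := fun j hj => by
      rw [inv_smul_eq_iff, f j hj]
    have : rotAt (α i) (C i) • z = z := by
      fin_cases i
      · rwa [f 3 (by decide), f 2 (by decide), f 1 (by decide)] at e
      · rw [f 3 (by decide), f 2 (by decide), ← eq_inv_smul_iff, f' 0 (by decide)] at e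
        exact e
      · rw [f 3 (by decide), ← eq_inv_smul_iff, ← eq_inv_smul_iff, f' 0 (by decide),
          f' 1 (by decide)] at e
        exact e
      · rw [← eq_inv_smul_iff, ← eq_inv_smul_iff, ← eq_inv_smul_iff, f' 0 (by decide),
          f' 1 (by decide), f' 2 (by decide)] at e
        exact e
    exact (eq_of_rotAt_smul (hα.pos i) (hα.lt' i) this).symm
  intro j
  by_cases hj : j = i
  · rw [hj, key]
  · exact h j hj

/-- At a critical point of the slice with x fixed both terms on the left of `slice_identity` vanish,
hence so does the product of the two commutator discriminants. -/
theorem eq_or_eq_of_slice {t₀ t₁ t₂ q x y z : ℝ} (h1 : 2 * y + x * z = t₁ * t₂ + t₀ * q)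
    (h2 : 2 * z + x * y = t₀ * t₂ + t₁ * q)
    (h : x ^ 2 + y ^ 2 + z ^ 2 + x * y * z = (t₀ * t₁ + t₂ * q) * x + (t₁ * t₂ + t₀ * q) * y
      + (t₀ * t₂ + t₁ * q) * z + 4 - t₀ ^ 2 - t₁ ^ 2 - t₂ ^ 2 - q ^ 2 - t₀ * t₁ * t₂ * q) :
    x ^ 2 - x * t₀ * t₁ + t₀ ^ 2 + t₁ ^ 2 - 4 = 0 ∨
      x ^ 2 - x * t₂ * q + t₂ ^ 2 + q ^ 2 - 4 = 0 := by
  rw [← mul_eq_zero]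
  have := slice_identity h
  rw [← h1, ← h2] at this
  linear_combination -this / 4

theorem IsCenters.fricke {ρ : RelHom α} {C : Fin 4 → ℍ} (hC : IsCenters ρ C) :
    trX α C ^ 2 + trY α C ^ 2 + trZ α C ^ 2 + trX α C * trY α C * trZ α C =
      coef α (liftProd α C 0 0) 0 * trX α C + coef α (liftProd α C 0 0) 1 * trY α C +
      coef α (liftProd α C 0 0) 2 * trZ α C + 4 - (2 * cos (α 0 / 2)) ^ 2
      - (2 * cos (α 1 / 2)) ^ 2 - (2 * cos (α 2 / 2)) ^ 2
      - (liftProd α C 0 0 * (2 * cos (α 3 / 2))) ^ 2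
      - 2 * cos (α 0 / 2) * (2 * cos (α 1 / 2)) * (2 * cos (α 2 / 2))
        * (liftProd α C 0 0 * (2 * cos (α 3 / 2))) := by
  have := PuncturedSphere.fricke (rotAt (α 0) (C 0)) (rotAt (α 1) (C 1)) (rotAt (α 2) (C 2))
  rw [hC.tr_triple, tr_rotAt, tr_rotAt, tr_rotAt] at this
  exact this

theorem IsCenters.tr_two_three {ρ : RelHom α} {C : Fin 4 → ℍ} (hC : IsCenters ρ C) :
    tr (rotAt (α 2) (C 2) * rotAt (α 3) (C 3)) = liftProd α C 0 0 * trX α C := by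
  have e : rotAt (α 2) (C 2) * rotAt (α 3) (C 3) =
      (rotAt (α 0) (C 0) * rotAt (α 1) (C 1))⁻¹ * liftProd α C := by
    rw [liftProd]; group
  rcases hC.sgn_eq_or with h | h
  · rw [e, h.2, h.1, mul_one, tr_inv, one_mul]; rfl
  · rw [e, h.2, h.1, mul_neg_one, tr_neg, tr_inv, neg_one_mul]; rfl

theorem IsCenters.tr_zero_three {ρ : RelHom α} {C : Fin 4 → ℍ} (hC : IsCenters ρ C) :
    tr (rotAt (α 0) (C 0) * rotAt (α 3) (C 3)) = liftProd α C 0 0 * trY α C := by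
  have e : rotAt (α 3) (C 3) * rotAt (α 0) (C 0) =
      (rotAt (α 1) (C 1) * rotAt (α 2) (C 2))⁻¹ *
        ((rotAt (α 0) (C 0))⁻¹ * liftProd α C * rotAt (α 0) (C 0)) := by
    rw [liftProd]; group
  rw [tr_mul_comm]
  rcases hC.sgn_eq_or with h | h
  · rw [e, h.2, h.1, mul_one, inv_mul_cancel, mul_one, tr_inv, one_mul]; rfl
  · rw [e, h.2, h.1, mul_neg_one, neg_mul, inv_mul_cancel, mul_neg_one, tr_neg, tr_inv,
      neg_one_mul]; rfl

theorem IsCenters.discr_two_three {ρ : RelHom α} {C : Fin 4 → ℍ}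
    (hα : ∀ i, 0 < α i ∧ α i < 2 * π) (hC : IsCenters ρ C) :
    trX α C ^ 2 - trX α C * (2 * cos (α 2 / 2)) * (liftProd α C 0 0 * (2 * cos (α 3 / 2)))
      + (2 * cos (α 2 / 2)) ^ 2 + (liftProd α C 0 0 * (2 * cos (α 3 / 2))) ^ 2 - 4 = 0 ↔
    C 2 = C 3 := by
  rw [← discr_eq_zero_iff (hα 2).1 (hα 2).2 (hα 3).1 (hα 3).2, hC.tr_two_three, tr_rotAt, tr_rotAt]
  rcases hC.sgn_eq_or with h | h <;> rw [h.2] <;> ring_nf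

theorem IsCenters.discr_zero_one {C : Fin 4 → ℍ}
    (hα : ∀ i, 0 < α i ∧ α i < 2 * π) :
    trX α C ^ 2 - trX α C * (2 * cos (α 0 / 2)) * (2 * cos (α 1 / 2))
      + (2 * cos (α 0 / 2)) ^ 2 + (2 * cos (α 1 / 2)) ^ 2 - 4 = 0 ↔ C 0 = C 1 := by
  rw [← discr_eq_zero_iff (hα 0).1 (hα 0).2 (hα 1).1 (hα 1).2, tr_rotAt, tr_rotAt]
  rfl

/-- The hypotheses are the fixed point equations of the twist along c₁c₂. Each discriminant detects
the collapse of one triangle of the chain, so the fixed classes are poles. -/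
theorem IsCenters.fixed_x {ρ : RelHom α} {C : Fin 4 → ℍ} (hα : ∀ i, 0 < α i ∧ α i < 2 * π)
    (hC : IsCenters ρ C)
    (h1 : 2 * trY α C + trX α C * trZ α C = coef α (liftProd α C 0 0) 1)
    (h2 : 2 * trZ α C + trX α C * trY α C = coef α (liftProd α C 0 0) 2) :
    C 0 = C 1 ∨ C 2 = C 3 := by
  have h := eq_or_eq_of_slice h1 h2 hC.fricke
  rwa [IsCenters.discr_zero_one hα, hC.discr_two_three hα] at h

theorem IsCenters.fixed_y {ρ : RelHom α} {C : Fin 4 → ℍ} (hα : ∀ i, 0 < α i ∧ α i < 2 * π)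
    (hC : IsCenters ρ C)
    (h1 : 2 * trX α C + trY α C * trZ α C = coef α (liftProd α C 0 0) 0)
    (h2 : 2 * trZ α C + trX α C * trY α C = coef α (liftProd α C 0 0) 2) :
    C 1 = C 2 ∨ C 0 = C 3 := by
  have h := eq_or_eq_of_slice (t₀ := 2 * cos (α 1 / 2)) (t₁ := 2 * cos (α 2 / 2))
    (t₂ := 2 * cos (α 0 / 2)) (q := liftProd α C 0 0 * (2 * cos (α 3 / 2))) (x := trY α C)
    (y := trZ α C) (z := trX α C)
    (by rw [mul_comm (trY α C), h2]; simp only [coef, Matrix.cons_val]; ring)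
    (by rw [h1]; simp only [coef, Matrix.cons_val]; ring)
    (by
      have := hC.fricke
      simp only [coef, Matrix.cons_val] at this
      linear_combination this)
  refine h.imp (fun h => ?_) (fun h => ?_)
  · rw [← discr_eq_zero_iff (hα 1).1 (hα 1).2 (hα 2).1 (hα 2).2, tr_rotAt, tr_rotAt]
    exact h
  · rw [← discr_eq_zero_iff (hα 0).1 (hα 0).2 (hα 3).1 (hα 3).2, hC.tr_zero_three, tr_rotAt,
      tr_rotAt]
    rcases hC.sgn_eq_or with e | e <;> rw [e.2] at h ⊢ <;> linear_combination h

/-- The surface of traces is smooth at the traces of a representation. -/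
theorem IsCenters.not_singular_point (hα : IsLarge α) {ρ : RelHom α} {C : Fin 4 → ℍ}
    (hC : IsCenters ρ C)
    (h0 : 2 * trX α C + trY α C * trZ α C = coef α (liftProd α C 0 0) 0)
    (h1 : 2 * trY α C + trX α C * trZ α C = coef α (liftProd α C 0 0) 1)
    (h2 : 2 * trZ α C + trX α C * trY α C = coef α (liftProd α C 0 0) 2) : False := by
  -- In each case the two equalities concern two pairs of punctures with one in common, so three
  -- centres agree.
  rcases hC.fixed_x hα.bounds h1 h2 with e | e <;> rcases hC.fixed_y hα.bounds h0 h2 with f | f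
  · exact not_three_fixed hα hC (z := C 1) 3 (by
      intro j hj; fin_cases j <;> first | exact absurd rfl hj | simp [e, f])
  · exact not_three_fixed hα hC (z := C 0) 2 (by
      intro j hj; fin_cases j <;> first | exact absurd rfl hj | simp [← e, ← f])
  · exact not_three_fixed hα hC (z := C 2) 0 (by
      intro j hj; fin_cases j <;> first | exact absurd rfl hj | simp [e, f])
  · exact not_three_fixed hα hC (z := C 3) 1 (by
      intro j hj; fin_cases j <;> first | exact absurd rfl hj | simp [e, f])

/-! ### The sign of orbits of length three -/

theorem cos_half_neg (hα : IsLarge α) (i : Fin 4) : cos (α i / 2) < 0 :=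
  cos_neg_of_pi_div_two_lt_of_lt (by linarith [hα.lt i]) (by linarith [hα.lt' i, pi_pos])

/-- In the case of positive sign, `ρ (c₁ c₂)` is not elliptic. -/
theorem four_le_of_pos (hα : IsLarge α) {ρ : RelHom α} {C : Fin 4 → ℍ} (hC : IsCenters ρ C)
    (hs : liftProd α C 0 0 = 1) : 4 ≤ trX α C ^ 2 := by
  by_contra hlt
  push Not at hlt
  have h0 : ∀ i, rotAt (α i) (C i) 1 0 < 0 := fun i => rotAt_10_neg (hα.pos i) (hα.lt' i) _
  have ht : ∀ i, tr (rotAt (α i) (C i)) < 0 := fun i => by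
    rw [tr_rotAt]; linarith [cos_half_neg hα i]
  -- If elliptic, the products of the first two and of the last two lifts both have positive lower
  -- left entry. For sign 1 they are inverse to each other, so these entries are opposite.
  have h1 := mul_10_pos (h0 0) (h0 1) (ht 0) (ht 1) hlt
  have h2 := mul_10_pos (h0 2) (h0 3) (ht 2) (ht 3) (by rw [hC.tr_two_three, hs, one_mul]; exact hlt)
  rcases hC.sgn_eq_or with h | h
  · have e : rotAt (α 2) (C 2) * rotAt (α 3) (C 3) =
      (rotAt (α 0) (C 0) * rotAt (α 1) (C 1))⁻¹ * liftProd α C := by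
      rw [liftProd]; group
    rw [e, h.1, mul_one, inv_10] at h2
    linarith
  · rw [h.2] at hs; norm_num at hs

theorem tr_sq_lt_four {φ ψ : ℝ} (h1 : π < φ) (h2 : φ < 2 * π) (h3 : π < ψ) (h4 : ψ < 2 * π)
    (z : ℍ) : tr (rotAt φ z * rotAt ψ z) ^ 2 < 4 := by
  rw [rotAt_mul_same, tr_rotAt]
  have hs : 0 < sin ((φ + ψ) / 2 - π) := sin_pos_of_pos_of_lt_pi (by linarith) (by linarith)
  rw [sin_sub_pi] at hs
  nlinarith [sin_sq_add_cos_sq ((φ + ψ) / 2)]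

/-- For sign 1 the first trace satisfies x² ≥ 4, which excludes x = 0 and x² = 1, so the twist along
c₁c₂ fixes the class. Then two centres coincide, and the product of the rotations about this point
has x² < 4. -/
theorem sgn_of_orbit (hα : IsLarge α) {O : Set (CharVar α)} (hO : IsOrbitOfLengthThree α O)
    {X : CharVar α} (hX : X ∈ O) : sgn X = -1 := by
  refine (sgn_eq_or hα.bounds X).resolve_left fun hs => ?_
  obtain ⟨⟨x, rfl⟩, -, hcard⟩ := hO
  have maps : ∀ Y ∈ MulAction.orbit PureAut x, twists 0 • Y ∈ MulAction.orbit PureAut x :=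
    fun Y hY => MulAction.mem_orbit_of_mem_orbit _ hY
  have T := fun Y => twists_smul hα.bounds 0 (α := α) Y
  set p := traceVec X with hp
  have e1 := T X
  have e2 := T (twists 0 • X)
  have e3 := T (twists 0 • twists 0 • X)
  rw [hs] at e1
  rw [e1.1, e1.2] at e2
  rw [e2.1, e2.2] at e3
  obtain ⟨ρ, C, rfl, hC⟩ := exists_rep_centers X
  have hd := sgn_traceVec_mk hα.bounds hC
  have hsC : liftProd α C 0 0 = 1 := hd.1 ▸ hs
  have h4 := four_le_of_pos hα hC hsC
  have p0 : p 0 = trX α C := congrFun hd.2 0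
  have p1 : p 1 = trY α C := congrFun hd.2 1
  have p2 : p 2 = trZ α C := congrFun hd.2 2
  have hfix : twistMap (coef α 1) 0 p = p := by
    rcases exists_period_le_three hcard maps (MulAction.injective _) hX with h | h | h
    · rw [h] at e1
      exact e1.2.symm
    · rw [h] at e2
      refine (twistMap_sq 0 p e2.2.symm).resolve_right fun h0 => ?_
      rw [← p0, h0] at h4
      norm_num at h4
    · rw [h] at e3
      refine (twistMap_cube 0 p e3.2.symm).resolve_right fun h0 => ?_
      rw [← p0, h0] at h4
      norm_num at h4
  have f1 := twistMap_fixed 0 1 2 p hfix (by decide) (by decide) (by decide)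
  have f2 := twistMap_fixed 0 2 1 p hfix (by decide) (by decide) (by decide)
  rw [p0, p1, p2, ← hsC] at f1 f2
  rcases hC.fixed_x hα.bounds f1 f2 with e | e
  · have := tr_sq_lt_four (hα.lt 0) (hα.lt' 0) (hα.lt 1) (hα.lt' 1) (C 1)
    rw [trX, e] at h4
    linarith
  · have := tr_sq_lt_four (hα.lt 2) (hα.lt' 2) (hα.lt 3) (hα.lt' 3) (C 3)
    have h5 := hC.tr_two_three
    rw [hsC, one_mul, e] at h5
    rw [h5] at this
    linarith

/-- The trace map is injective on the orbit because all signs are -1. The fixed point equations of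
two twists together comprise all three partial derivatives of the cubic, whence `nofix`. -/
theorem isTwistDynamics (hα : IsLarge α) {O : Set (CharVar α)} (hO : IsOrbitOfLengthThree α O) :
    IsTwistDynamics (traceVec '' O) (coef α (-1)) (twistMap (coef α (-1))) := by
  have hs := fun X hX => sgn_of_orbit hα hO (X := X) hX
  have nosing : ∀ p ∈ traceVec '' O, ¬ (2 * p 0 + p 1 * p 2 = coef α (-1) 0 ∧
      2 * p 1 + p 0 * p 2 = coef α (-1) 1 ∧ 2 * p 2 + p 0 * p 1 = coef α (-1) 2) := by
    rintro _ ⟨X, hX, rfl⟩ ⟨h0, h1, h2⟩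
    have hsX := hs X hX
    obtain ⟨ρ, C, rfl, hC⟩ := exists_rep_centers X
    have hd := sgn_traceVec_mk hα.bounds hC
    rw [hd.1] at hsX
    rw [hd.2, ← hsX] at h0 h1 h2
    exact hC.not_singular_point hα h0 h1 h2
  refine ⟨?_, ?_, twistMap_injective, twistMap_coord, twistMap_sq, twistMap_cube,
    fun i j p => twistMap_zero i j p, twistMap_fixed, twistMap_const, ?_⟩
  · rw [Set.InjOn.ncard_image, hO.2.2]
    intro X hX Y hY e
    exact eq_of_traceVec_eq hα.bounds (hs X hX) (hs Y hY) e
  · rintro i _ ⟨X, hX, rfl⟩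
    refine ⟨twists i • X, ?_, ?_⟩
    · obtain ⟨⟨x, rfl⟩, -⟩ := hO
      exact MulAction.mem_orbit_of_mem_orbit _ hX
    · rw [(twists_smul hα.bounds i X).2, hs X hX]
  · intro i j p hp hij hi hj
    apply nosing p hp
    have fi := fun j l => twistMap_fixed i j l p hi
    have fj := fun i l => twistMap_fixed j i l p hj
    have all : ∀ m l n : Fin 3, m ≠ l → m ≠ n → l ≠ n → 2 * p m + p l * p n = coef α (-1) m := by
      intro m l n h1 h2 h3
      by_cases e : m = i
      · subst e
        rcases (show l = j ∨ n = j by clear * - h1 h2 h3 hij; revert m l n j; decide) with rfl | rfl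
        · exact fj m n hij h3.symm h2.symm
        · have := fj m l hij h3 h1.symm
          linarith
      · rcases (show l = i ∨ n = i by clear * - h1 h2 h3 e; revert m l n i; decide) with rfl | rfl
        · exact fi m n e h3.symm h2.symm
        · have := fi m l e h3 h1.symm
          linarith
    exact ⟨all 0 1 2 (by decide) (by decide) (by decide),
      all 1 0 2 (by decide) (by decide) (by decide),
      all 2 0 1 (by decide) (by decide) (by decide)⟩

end PuncturedSphere

end

noncomputable section
namespace PuncturedSphere
open SphereGroup
variable {α : Fin 4 → ℝ}

/-! ### Compactness of the set of classes of negative sign -/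

theorem continuous_entry (i j : Fin 2) : Continuous fun A : SL(2, ℝ) => A i j :=
  (continuous_apply_apply i j).comp continuous_subtype_val

theorem continuous_sl {X : Type*} [TopologicalSpace X] {f : X → SL(2, ℝ)}
    (h : ∀ i j, Continuous fun x => f x i j) : Continuous f :=
  Continuous.subtype_mk (f := fun x => (f x).1) (continuous_matrix h) _

theorem continuous_rotAt (φ : ℝ) : Continuous (rotAt φ) := by
  have h1 : Continuous fun z : ℍ => z.re := UpperHalfPlane.continuous_re
  have h2 : Continuous fun z : ℍ => z.im := UpperHalfPlane.continuous_im
  have hu' : Continuous hu := h1.div h2 im_ne_zero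
  have hv' : Continuous hv := continuous_const.div h2 im_ne_zero
  have hw' : Continuous hw := ((h1.pow 2).add (h2.pow 2)).div h2 im_ne_zero
  apply continuous_sl
  intro i j
  fin_cases i <;> fin_cases j <;> simp <;> fun_prop

theorem continuous_mk_comp {X : Type*} [TopologicalSpace X] {f : X → SL(2, ℝ)}
    (h : Continuous f) : Continuous fun x => (f x : PSL(2, ℝ)) :=
  continuous_quot_mk.comp h

/-- The quadruples of points with product of rotations equal to `-1`. -/
def NegConfig (α : Fin 4 → ℝ) : Type := {C : Fin 4 → ℍ // liftProd α C = -1}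

instance : TopologicalSpace (NegConfig α) := inferInstanceAs (TopologicalSpace {C : Fin 4 → ℍ // liftProd α C = -1})

/-- The representation with given fixed points. -/
def NegConfig.rep (C : NegConfig α) : RelHom α :=
  ⟨sphereHom (fun i => (rotAt (α i) (C.1 i) : PSL(2, ℝ))) (by
    change ((liftProd α C.1 : SL(2, ℝ)) : PSL(2, ℝ)) = 1
    rw [C.2, mk_neg]
    rfl), fun i => ⟨C.1 i, by
      rw [isRotation_iff, sphereHom_c]⟩⟩

theorem NegConfig.isCenters (C : NegConfig α) : IsCenters C.rep C.1 := by
  intro i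
  simp [NegConfig.rep]

theorem NegConfig.continuous_rep : Continuous (NegConfig.rep (α := α)) := by
  rw [continuous_induced_rng]
  apply continuous_pi
  intro g
  induction g using PresentedGroup.induction_on with
  | _ w =>
  change Continuous fun C : NegConfig α => C.rep.1 (PresentedGroup.mk _ w)
  induction w using FreeGroup.induction_on with
  | C1 => simpa using continuous_const
  | of i =>
    have : ∀ C : NegConfig α, C.rep.1 (PresentedGroup.mk _ (FreeGroup.of i)) =
        (rotAt (α i) (C.1 i) : PSL(2, ℝ)) := fun C => C.isCenters i
    simp only [this]
    exact continuous_mk_comp ((continuous_rotAt _).comp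
      ((continuous_apply i).comp continuous_subtype_val))
  | inv_of i h =>
    simp only [map_inv]
    exact h.inv
  | mul x y hx hy =>
    simp only [map_mul]
    exact hx.mul hy

theorem continuous_charVar_mk : Continuous (CharVar.mk (α := α)) := continuous_quotient_mk'

/-- A continuous function on the set of quadruples of matrices whose sign is invariant under
changes of signs. -/
def signFun (A : Fin 4 → SL(2, ℝ)) : ℝ :=
  A 0 1 0 * A 1 1 0 * A 2 1 0 * A 3 1 0 * (A 0 * A 1 * A 2 * A 3) 0 0

theorem continuous_signFun : Continuous signFun := by
  have h : ∀ k i j, Continuous fun A : Fin 4 → SL(2, ℝ) => A k i j := fun k i j =>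
    (continuous_entry i j).comp (continuous_apply k)
  unfold signFun
  simp only [mul_00, mul_01]
  fun_prop (disch := assumption)

/-- Each matrix occurs twice, through its lower left entry and in the product, so changing its sign
has no effect. -/
theorem signFun_eq {A B : Fin 4 → SL(2, ℝ)}
    (h : ∀ i, (A i : PSL(2, ℝ)) = (B i : PSL(2, ℝ))) : signFun A = signFun B := by
  have h' := fun i => mk_eq_mk_iff.1 (h i)
  unfold signFun
  simp only [mul_00, mul_01]
  rcases h' 0 with e0 | e0 <;> rcases h' 1 with e1 | e1 <;> rcases h' 2 with e2 | e2 <;>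
    rcases h' 3 with e3 | e3 <;> rw [e0, e1, e2, e3] <;> simp only [neg_app] <;> ring

theorem IsCenters.signFun_pos (hα : ∀ i, 0 < α i ∧ α i < 2 * π) {ρ : RelHom α} {C : Fin 4 → ℍ}
    (hC : IsCenters ρ C) {A : Fin 4 → SL(2, ℝ)} (hA : ∀ i, (A i : PSL(2, ℝ)) = ρ.1 (c i)) :
    0 < signFun A * liftProd α C 0 0 := by
  rw [signFun_eq (B := fun i => rotAt (α i) (C i)) (fun i => (hA i).trans (hC i))]
  have h : ∀ i, rotAt (α i) (C i) 1 0 < 0 := fun i => rotAt_10_neg (hα i).1 (hα i).2 _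
  have h4 : 0 < rotAt (α 0) (C 0) 1 0 * rotAt (α 1) (C 1) 1 0 * rotAt (α 2) (C 2) 1 0 *
      rotAt (α 3) (C 3) 1 0 :=
    mul_pos_of_neg_of_neg (mul_neg_of_pos_of_neg (mul_pos_of_neg_of_neg (h 0) (h 1)) (h 2)) (h 3)
  unfold signFun
  change 0 < _ * liftProd α C 0 0 * liftProd α C 0 0
  rcases hC.sgn_eq_or with e | e <;> rw [e.2] <;> linarith

/-- The sign of `signFun` is a continuous way to read the sign from arbitrary lifts. Openness
descends along the open projection to `PSL(2, ℝ)`, pulls back to representations, and passes to the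
quotient. -/
theorem isOpen_sgn (hα : ∀ i, 0 < α i ∧ α i < 2 * π) (ε : ℝ) (hε : ε = 1 ∨ ε = -1) :
    IsOpen {X : CharVar α | sgn X = ε} := by
  have hmk : IsOpenMap (QuotientGroup.mk : SL(2, ℝ) → PSL(2, ℝ)) := QuotientGroup.isOpenMap_coe
  have hpi : IsOpenMap (Pi.map fun (_ : Fin 4) (A : SL(2, ℝ)) => (A : PSL(2, ℝ))) :=
    IsOpenMap.piMap (fun _ => hmk) (Filter.Eventually.of_forall fun _ =>
      QuotientGroup.mk_surjective)
  have hU : IsOpen {A : Fin 4 → SL(2, ℝ) | 0 < signFun A * ε} :=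
    isOpen_lt continuous_const (continuous_signFun.mul continuous_const)
  have hV := hpi _ hU
  have hev : Continuous fun ρ : RelHom α => fun i : Fin 4 => ρ.1 (c i) := by
    apply continuous_pi
    intro i
    exact (continuous_apply (c i)).comp continuous_induced_dom
  have hW := hV.preimage hev
  have hq : Topology.IsQuotientMap (CharVar.mk (α := α)) := isQuotientMap_quotient_mk'
  rw [← hq.isOpen_preimage]
  convert hW using 1
  ext ρ
  obtain ⟨C, hC⟩ := exists_isCenters ρ
  have h := (sgn_traceVec_mk hα hC).1
  change sgn (CharVar.mk ρ) = ε ↔ ∃ A, 0 < signFun A * ε ∧ _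
  rw [h]
  constructor
  · intro e
    have hA : ∀ i, ((rotAt (α i) (C i) : SL(2, ℝ)) : PSL(2, ℝ)) = ρ.1 (c i) := fun i => (hC i).symm
    refine ⟨fun i => rotAt (α i) (C i), ?_, funext hA⟩
    rw [← e]
    exact hC.signFun_pos hα hA
  · rintro ⟨A, hA, e⟩
    have h1 := hC.signFun_pos hα (fun i => congrFun e i)
    rcases hC.sgn_eq_or with f | f <;> rw [f.2] at h1 ⊢ <;> rcases hε with rfl | rfl <;>
      first | rfl | (exfalso; linarith)

theorem isClopen_sgn (hα : ∀ i, 0 < α i ∧ α i < 2 * π) :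
    IsClopen {X : CharVar α | sgn X = -1} := by
  refine ⟨⟨?_⟩, isOpen_sgn hα _ (Or.inr rfl)⟩
  convert isOpen_sgn hα 1 (Or.inl rfl) using 1
  ext X
  simp only [Set.mem_compl_iff, Set.mem_ofPred_eq]
  rcases sgn_eq_or hα X with h | h <;> rw [h] <;> norm_num

theorem ip_I_eq_cosh_dist (z w : ℍ) : ip z w = cosh (dist z w) := by
  rw [UpperHalfPlane.cosh_dist']
  have h1 := z.im_ne_zero
  have h2 := w.im_ne_zero
  simp only [ip, hu, hv, hw]
  field_simp
  ring

theorem ip_le {φ ψ : ℝ} (h1 : 0 < φ) (h2 : φ < 2 * π) (h3 : 0 < ψ) (h4 : ψ < 2 * π) {z w : ℍ}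
    (h : -2 ≤ tr (rotAt φ z * rotAt ψ w)) : ip z w ≤ 2 / (sin (φ / 2) * sin (ψ / 2)) := by
  have hs : 0 < sin (φ / 2) := sin_pos_of_pos_of_lt_pi (by linarith) (by linarith)
  have hs' : 0 < sin (ψ / 2) := sin_pos_of_pos_of_lt_pi (by linarith) (by linarith)
  rw [tr_rotAt_mul] at h
  rw [le_div_iff₀ (mul_pos hs hs')]
  have : cos (φ / 2) * cos (ψ / 2) ≤ 1 := by
    nlinarith [sq_nonneg (cos (φ / 2) - cos (ψ / 2)), cos_sq_le_one (φ / 2), cos_sq_le_one (ψ / 2)]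
  linarith

/-- For sign -1, the trace at the pair (0, i) is minus that of a product of rotations at the other
two punctures. The latter is below 2, so the former exceeds -2 and bounds the distance. The summand
1 covers i = 0, where the cosh equals 1. -/
theorem NegConfig.bounded (hα : ∀ i, 0 < α i ∧ α i < 2 * π) (C : NegConfig α) (i : Fin 4) :
    ip (C.1 0) (C.1 i) ≤ 1 + 2 / (sin (α 0 / 2) * sin (α i / 2)) := by
  have hC := C.isCenters
  have hs : ∀ i, 0 < sin (α i / 2) := fun i =>
    sin_pos_of_pos_of_lt_pi (by linarith [(hα i).1]) (by linarith [(hα i).2])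
  have hp : 0 < 2 / (sin (α 0 / 2) * sin (α i / 2)) := by
    have := hs 0
    have := hs i
    positivity
  have ε : liftProd α C.1 0 0 = -1 := by rw [C.2]; simp
  have low : ∀ i : Fin 4, i ≠ 0 → -2 ≤ tr (rotAt (α 0) (C.1 0) * rotAt (α i) (C.1 i)) := by
    intro i hi
    have lt := fun i j z w => tr_rotAt_mul_lt (hα i).1 (hα i).2 (hα j).1 (hα j).2 z w
    fin_cases i
    · exact absurd rfl hi
    · have h := hC.tr_two_three
      have := lt 2 3 (C.1 2) (C.1 3)
      rw [h, ε] at this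
      change -2 ≤ trX α C.1
      linarith
    -- The pair is not consecutive, so one of the two complementary rotations must first be
    -- conjugated past the third lift; it remains a rotation of the same angle.
    · have e : rotAt (α 0) (C.1 0) * rotAt (α 2) (C.1 2) =
        -((rotAt (α 2) (C.1 2))⁻¹ * rotAt (α 1) (C.1 1) * (rotAt (α 2) (C.1 2))⁻¹⁻¹
          * rotAt (α 3) (C.1 3))⁻¹ := by
        have h : rotAt (α 0) (C.1 0) * rotAt (α 1) (C.1 1) * rotAt (α 2) (C.1 2) *
          rotAt (α 3) (C.1 3) = -1 := C.2
        have h' := eq_mul_inv_of_mul_eq h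
        have h'' := eq_mul_inv_of_mul_eq h'
        have h3 := eq_mul_inv_of_mul_eq h''
        rw [h3]
        simp [mul_assoc]
      have := lt 1 3 ((rotAt (α 2) (C.1 2))⁻¹ • C.1 1) (C.1 3)
      rw [← conj_rotAt] at this
      change -2 ≤ tr (rotAt (α 0) (C.1 0) * rotAt (α 2) (C.1 2))
      rw [e, tr_neg, tr_inv]
      linarith
    · have h := hC.tr_zero_three
      have := lt 1 2 (C.1 1) (C.1 2)
      change -2 ≤ tr (rotAt (α 0) (C.1 0) * rotAt (α 3) (C.1 3))
      rw [h, ε]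
      change trY α C.1 < 2 at this
      linarith
  by_cases hi : i = 0
  · subst hi
    rw [ip_eq_one_iff.2 rfl]
    linarith
  · linarith [ip_le (hα 0).1 (hα 0).2 (hα i).1 (hα i).2 (low i hi)]

/-- Every class has a representative whose first centre is I. By `NegConfig.bounded` the normalised
quadruples of centres form a closed bounded set, and the classes are its continuous image. -/
theorem isCompact_sgn (hα : ∀ i, 0 < α i ∧ α i < 2 * π) :
    IsCompact {X : CharVar α | sgn X = -1} := by
  have hK : IsCompact {C : NegConfig α | C.1 0 = I} := by
    have hemb : Topology.IsClosedEmbedding (fun C : NegConfig α => C.1) := by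
      apply IsClosed.isClosedEmbedding_subtypeVal
      have hr : ∀ i, Continuous fun C : Fin 4 → ℍ => rotAt (α i) (C i) := fun i =>
        (continuous_rotAt _).comp (continuous_apply i)
      exact isClosed_eq (((hr 0).mul (hr 1)).mul (hr 2) |>.mul (hr 3)) continuous_const
    have hB : IsCompact (Set.univ.pi fun i : Fin 4 => {z : ℍ |
        ip I z ≤ 1 + 2 / (sin (α 0 / 2) * sin (α i / 2))}) := by
      apply isCompact_univ_pi
      intro i
      set R := 1 + 2 / (sin (α 0 / 2) * sin (α i / 2))
      apply (isCompact_closedBall I (2 * R)).of_isClosed_subset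
      · simp only [ip_I_eq_cosh_dist]
        exact isClosed_le (continuous_cosh.comp (continuous_const.dist continuous_id))
          continuous_const
      · intro z hz
        rw [Set.mem_ofPred_eq, ip_I_eq_cosh_dist, dist_comm] at hz
        rw [Metric.mem_closedBall]
        -- The crude inequality x ≤ eˣ ≤ 2cosh x suffices to place the set in a ball.
        have h1 : dist z I ≤ 2 * cosh (dist z I) := by
          rw [cosh_eq]
          have := add_one_le_exp (dist z I)
          have := exp_pos (-dist z I)
          linarith
        linarith
    have hc := hemb.isCompact_preimage (hB.inter_right
      (isClosed_eq (continuous_apply 0) continuous_const : IsClosed {C : Fin 4 → ℍ | C 0 = I}))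
    convert hc using 1
    ext C
    simp only [Set.mem_ofPred_eq, Set.mem_preimage, Set.mem_inter_iff, Set.mem_univ_pi]
    refine ⟨fun h => ⟨fun i => ?_, h⟩, fun h => h.2⟩
    rw [← h]
    exact C.bounded hα i
  have himg := hK.image (continuous_charVar_mk.comp NegConfig.continuous_rep)
  convert himg using 1
  ext X
  constructor
  · intro hX
    obtain ⟨ρ, C, rfl, hC⟩ := exists_rep_centers X
    rw [Set.mem_ofPred_eq, (sgn_traceVec_mk hα hC).1] at hX
    have hneg : liftProd α C = -1 := by
      rcases hC.sgn_eq_or with h | h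
      · rw [h.2] at hX; norm_num at hX
      · exact h.1
    obtain ⟨g, hg⟩ := MulAction.exists_smul_eq SL(2, ℝ) (C 0) I
    have hneg' : liftProd α (fun i => g • C i) = -1 := by
      have : liftProd α (fun i => g • C i) = g * liftProd α C * g⁻¹ := by
        simp only [liftProd, ← conj_rotAt]; group
      rw [this, hneg]; simp
    refine ⟨⟨_, hneg'⟩, hg, ?_⟩
    symm
    apply mk_eq_mk_of_conj (g : PSL(2, ℝ))
    intro i
    rw [(NegConfig.isCenters ⟨_, hneg'⟩) i, hC i]
    change ((rotAt (α i) (g • C i) : SL(2, ℝ)) : PSL(2, ℝ)) = _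
    rw [← conj_rotAt]
    rfl
  · rintro ⟨C, -, rfl⟩
    change sgn (CharVar.mk C.rep) = -1
    rw [(sgn_traceVec_mk hα C.isCenters).1, C.2]
    simp

theorem mem_DTComponent_of_sgn (hα : ∀ i, 0 < α i ∧ α i < 2 * π) {X : CharVar α}
    (hX : sgn X = -1) : X ∈ DTComponent α :=
  (isCompact_sgn hα).of_isClosed_subset isClosed_connectedComponent
    ((isClopen_sgn hα).connectedComponent_subset hX)

end PuncturedSphere

end

noncomputable section
namespace PuncturedSphere
open SphereGroup
variable {α : Fin 4 → ℝ}

/-! ### Action-angle coordinates in terms of traces -/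

theorem map_b (ρ : SphereGroup →* PSL(2, ℝ)) : ρ b = (ρ (c 0) * ρ (c 1))⁻¹ := by
  simp [SphereGroup.b]

theorem IsCenters.map_b {ρ : RelHom α} {C : Fin 4 → ℍ} (hC : IsCenters ρ C) :
    ρ.1 b = (((rotAt (α 0) (C 0) * rotAt (α 1) (C 1))⁻¹ : SL(2, ℝ)) : PSL(2, ℝ)) := by
  rw [PuncturedSphere.map_b, hC 0, hC 1]
  rfl

theorem IsCenters.mul_10_pos (hα : IsLarge α) {C : Fin 4 → ℍ} (h : trX α C ^ 2 < 4) :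
    0 < (rotAt (α 0) (C 0) * rotAt (α 1) (C 1)) 1 0 := by
  have h0 : ∀ i, rotAt (α i) (C i) 1 0 < 0 := fun i => rotAt_10_neg (hα.pos i) (hα.lt' i) _
  have ht : ∀ i, tr (rotAt (α i) (C i)) < 0 := fun i => by
    rw [tr_rotAt]; linarith [cos_half_neg hα i]
  exact PuncturedSphere.mul_10_pos (h0 0) (h0 1) (ht 0) (ht 1) h

theorem two_cos_half_sq_lt {β : ℝ} (h0 : 0 < β) (h1 : β < 2 * π) : (2 * cos (β / 2)) ^ 2 < 4 := by
  have hs : 0 < sin (β / 2) := sin_pos_of_pos_of_lt_pi (by linarith) (by linarith)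
  nlinarith [sin_sq_add_cos_sq (β / 2)]

/-- An elliptic product of two of the lifts has positive lower left entry. It is therefore its
inverse, lifting ρ(b), that is a canonical lift. -/
theorem IsCenters.exists_b (hα : IsLarge α) {C : Fin 4 → ℍ} {β : ℝ} (h0 : 0 < β)
    (h1 : β < 2 * π) (h : trX α C = 2 * cos (β / 2)) :
    ∃ B, (rotAt (α 0) (C 0) * rotAt (α 1) (C 1))⁻¹ = rotAt β B := by
  apply eq_rotAt h0 h1
  · rw [inv_10, neg_lt_zero]
    exact IsCenters.mul_10_pos hα (by rw [h]; exact two_cos_half_sq_lt h0 h1)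
  · rw [tr_inv]; exact h

theorem IsCenters.hasAction_iff (hα : IsLarge α) {ρ : RelHom α} {C : Fin 4 → ℍ}
    (hC : IsCenters ρ C) {β : ℝ} :
    HasAction ρ β ↔ 0 < β ∧ β < 2 * π ∧ trX α C = 2 * cos (β / 2) := by
  constructor
  · rintro ⟨h0, h1, B, hB⟩
    refine ⟨h0, h1, ?_⟩
    rw [isRotation_iff, hC.map_b, mk_eq_mk_iff] at hB
    rcases hB with e | e
    · have := congrArg tr e
      rwa [tr_inv, tr_rotAt] at this
    · exfalso
      have h2 := congrArg tr e
      have h3 := congrArg (fun A : SL(2, ℝ) => A 1 0) e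
      simp only [inv_10, neg_app] at h3
      rw [tr_inv, tr_neg, tr_rotAt] at h2
      have h4 : trX α C ^ 2 < 4 := by
        change tr _ ^ 2 < 4
        rw [h2, neg_sq]
        exact two_cos_half_sq_lt h0 h1
      linarith [IsCenters.mul_10_pos hα h4, rotAt_10_neg h0 h1 B]
  · rintro ⟨h0, h1, h⟩
    obtain ⟨B, hB⟩ := IsCenters.exists_b hα h0 h1 h
    exact ⟨h0, h1, B, by rw [isRotation_iff, hC.map_b, hB]⟩

theorem IsCenters.isSingular_iff (hα : ∀ i, 0 < α i ∧ α i < 2 * π) {ρ : RelHom α}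
    {C : Fin 4 → ℍ} (hC : IsCenters ρ C) : IsSingular ρ ↔ C 0 = C 1 ∨ C 2 = C 3 := by
  have h : ∀ i z, Fixes (ρ.1 (c i)) z ↔ z = C i := fun i z => by
    rw [hC i, fixes_rotAt_iff (hα i).1 (hα i).2]
  simp only [IsSingular, h]
  constructor
  · rintro (⟨z, h1, h2⟩ | ⟨z, h1, h2⟩)
    · exact Or.inl (h1.symm.trans h2)
    · exact Or.inr (h1.symm.trans h2)
  · rintro (h | h)
    · exact Or.inl ⟨_, rfl, h⟩
    · exact Or.inr ⟨_, rfl, h⟩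

/-- The law of cosines at B gives the real part, and the oriented volume gives the imaginary part.
Only the argument of the quotient is used, so the positive factor r may stay unspecified. -/
theorem discCoord_div {B P Q : ℍ} :
    ∃ r : ℝ, 0 < r ∧ (P ≠ B → discCoord B Q / discCoord B P =
      (r : ℂ) * ((ip B P * ip B Q - ip P Q : ℝ) + (vol B P Q / 2 : ℝ) * Complex.I)) := by
  have hne : ∀ z : ℍ, (z : ℂ) - conj (B : ℂ) ≠ 0 := by
    intro z h
    have h2 := congrArg Complex.im h
    simp at h2
    linarith [z.im_pos, B.im_pos]
  set N := Complex.normSq (((Q : ℂ) - conj (B : ℂ)) * ((P : ℂ) - B)) with hN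
  by_cases hPB : P = B
  · exact ⟨1, one_pos, fun h => absurd hPB h⟩
  have hP : (P : ℂ) - B ≠ 0 := by
    rw [sub_ne_zero]
    exact fun h => hPB (UpperHalfPlane.ext h)
  have hNpos : 0 < N := Complex.normSq_pos.2 (mul_ne_zero (hne Q) hP)
  refine ⟨4 * B.im ^ 2 * P.im * Q.im / N, ?_, fun _ => ?_⟩
  · have := B.im_pos
    have := P.im_pos
    have := Q.im_pos
    positivity
  · have h1 : discCoord B Q / discCoord B P =
        (((Q : ℂ) - B) * ((P : ℂ) - conj (B : ℂ))) *
          conj (((Q : ℂ) - conj (B : ℂ)) * ((P : ℂ) - B)) / (N : ℂ) := by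
      rw [hN, Complex.normSq_eq_conj_mul_self]
      have h3 : conj (((Q : ℂ) - conj (B : ℂ)) * ((P : ℂ) - B)) ≠ 0 := by
        rw [Ne, map_eq_zero]
        exact mul_ne_zero (hne Q) hP
      unfold discCoord
      rw [div_div_div_eq, mul_comm (conj _), mul_div_mul_right _ _ h3]
    rw [h1]
    have h2 : (((Q : ℂ) - B) * ((P : ℂ) - conj (B : ℂ))) *
          conj (((Q : ℂ) - conj (B : ℂ)) * ((P : ℂ) - B)) =
        ((4 * B.im ^ 2 * P.im * Q.im : ℝ) : ℂ) *
        ((ip B P * ip B Q - ip P Q : ℝ) + (vol B P Q / 2 : ℝ) * Complex.I) := by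
      have b0 := B.im_ne_zero
      have p0 := P.im_ne_zero
      have q0 := Q.im_ne_zero
      apply Complex.ext
      · simp [-Complex.ofReal_sub, -Complex.ofReal_mul, -Complex.ofReal_div]
        simp only [ip, hu, hv, hw]
        field_simp
        ring
      · simp [-Complex.ofReal_sub, -Complex.ofReal_mul, -Complex.ofReal_div]
        simp only [vol, hu, hv, hw]
        field_simp
        ring
    rw [h2]
    push_cast
    ring

theorem orientedAngle_eq {B P Q : ℍ} (hP : P ≠ B) {k γ : ℝ} (hk : 0 < k)
    (h1 : ip B P * ip B Q - ip P Q = k * cos γ) (h2 : vol B P Q / 2 = k * sin γ) :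
    orientedAngle B P Q = (γ : Real.Angle) := by
  obtain ⟨r, hr, h⟩ := discCoord_div (B := B) (P := P) (Q := Q)
  unfold orientedAngle
  rw [h hP, h1, h2]
  have : (r : ℂ) * (((k * cos γ : ℝ) : ℂ) + ((k * sin γ : ℝ) : ℂ) * Complex.I) =
      ((r * k : ℝ) : ℂ) * (Complex.cos γ + Complex.sin γ * Complex.I) := by
    push_cast
    ring
  rw [this]
  have h3 := Complex.arg_mul_cos_add_sin_mul_I_coe_angle (mul_pos hr hk) (γ : Real.Angle)
  rwa [Real.Angle.cos_coe, Real.Angle.sin_coe, Complex.ofReal_cos, Complex.ofReal_sin] at h3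

/-- The numerator of the cosine of the angle coordinate. -/
def angleCos (k p : Fin 3 → ℝ) : ℝ := -2 * k 1 + p 0 * k 2 + (4 - p 0 ^ 2) * p 1

/-- The numerator of the sine of the angle coordinate. -/
def angleSin (k p : Fin 3 → ℝ) : ℝ := k 2 - p 0 * p 1 - 2 * p 2

/-- The right side of `slice_identity` is a multiple of the product of the two discriminants, so
this combination of the numerators detects exactly the poles. -/
theorem IsCenters.slice {ρ : RelHom α} {C : Fin 4 → ℍ} (hα : ∀ i, 0 < α i ∧ α i < 2 * π)
    (hC : IsCenters ρ C) (hs : liftProd α C 0 0 = -1) :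
    angleCos (coef α (-1)) ![trX α C, trY α C, trZ α C] ^ 2 + (4 - trX α C ^ 2) *
      angleSin (coef α (-1)) ![trX α C, trY α C, trZ α C] ^ 2 = 0 ↔ C 0 = C 1 ∨ C 2 = C 3 := by
  have h := hC.fricke
  have h2 := hC.discr_two_three hα
  rw [hs] at h h2
  rw [← IsCenters.discr_zero_one hα, ← h2, ← mul_eq_zero]
  have := slice_identity h
  simp only [angleCos, angleSin, coef, Matrix.cons_val] at this ⊢
  rw [this]
  constructor <;> intro h <;> linarith

/-- Traces of products with the lift of ρ(b) express the distances from B to C₂ and C₃ and the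
volume of the three points by x, y, z. Multiplied by 8sin²(β/2)sin(α₂/2)sin(α₃/2), the law of
cosines becomes `angleCos` and half the volume becomes 2sin(β/2) `angleSin`. -/
theorem IsCenters.hasAngle_iff (hα : IsLarge α) {ρ : RelHom α} {C : Fin 4 → ℍ}
    (hC : IsCenters ρ C) (hs : liftProd α C 0 0 = -1) {β γ₀ r : ℝ} (hβ : 0 < β)
    (hβ' : β < 2 * π) (hx : trX α C = 2 * cos (β / 2)) (hr : 0 < r)
    (h1 : angleCos (coef α (-1)) ![trX α C, trY α C, trZ α C] = r * cos γ₀)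
    (h2 : 2 * sin (β / 2) * angleSin (coef α (-1)) ![trX α C, trY α C, trZ α C] = r * sin γ₀)
    (γ : Real.Angle) : HasAngle ρ γ ↔ γ = (γ₀ : Real.Angle) := by
  obtain ⟨B, hB⟩ := IsCenters.exists_b hα hβ hβ' hx
  have hb : ρ.1 b = (rotAt β B : PSL(2, ℝ)) := by rw [hC.map_b, hB]
  have fix : ∀ i z, Fixes (ρ.1 (c i)) z ↔ z = C i := fun i z => by
    rw [hC i, fixes_rotAt_iff (hα.pos i) (hα.lt' i)]
  have fixb : ∀ z, Fixes (ρ.1 b) z ↔ z = B := fun z => by rw [hb, fixes_rotAt_iff hβ hβ']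
  have sβ : 0 < sin (β / 2) := sin_pos_of_pos_of_lt_pi (by linarith) (by linarith)
  have sp : ∀ i, 0 < sin (α i / 2) := fun i =>
    sin_pos_of_pos_of_lt_pi (by linarith [hα.pos i]) (by linarith [hα.lt' i])
  -- traces of products with the lift of `ρ b`
  have e1 : tr (rotAt β B * rotAt (α 1) (C 1)) = 2 * cos (α 0 / 2) := by
    rw [← hB, ← tr_rotAt (α 0) (C 0), ← tr_inv (rotAt (α 0) (C 0)),
      ← tr_conj (rotAt (α 1) (C 1))⁻¹ (rotAt (α 0) (C 0))⁻¹]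
    congr 1; group
  have e2 : tr (rotAt β B * rotAt (α 2) (C 2)) =
      trX α C * (2 * cos (α 2 / 2)) + 2 * cos (α 3 / 2) := by
    have := tr_mul_inv (rotAt (α 2) (C 2)) (rotAt (α 0) (C 0) * rotAt (α 1) (C 1))
    rw [tr_mul_comm, hB, tr_mul_comm (rotAt (α 2) (C 2)), hC.tr_triple, hs, tr_rotAt] at this
    rw [this, trX]
    ring
  have e3 : tr (rotAt β B * rotAt (α 1) (C 1) * rotAt (α 2) (C 2)) =
      trX α C * trY α C + 2 * cos (α 1 / 2) * (2 * cos (α 3 / 2)) + trZ α C := by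
    have h := tr_mul_inv (rotAt (α 1) (C 1) * rotAt (α 2) (C 2))
      (rotAt (α 0) (C 0) * rotAt (α 1) (C 1))
    have h4 : tr (rotAt (α 1) (C 1) * rotAt (α 2) (C 2) *
        (rotAt (α 0) (C 0) * rotAt (α 1) (C 1))) =
        tr (rotAt (α 0) (C 0) * rotAt (α 1) (C 1) * (rotAt (α 1) (C 1) * rotAt (α 2) (C 2))) :=
      tr_mul_comm _ _
    have h6 := tr_mul_inv (rotAt (α 2) (C 2) * rotAt (α 0) (C 0) * rotAt (α 1) (C 1))
      (rotAt (α 1) (C 1))⁻¹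
    rw [inv_inv, mul_inv_cancel_right, tr_inv, tr_rotAt, tr_mul_comm (rotAt (α 2) (C 2)),
      mul_assoc (rotAt (α 2) (C 2)), tr_mul_comm (rotAt (α 2) (C 2)) (_ * _), hC.tr_triple,
      hs] at h6
    have h7 : tr (rotAt (α 2) (C 2) * (rotAt (α 0) (C 0) * rotAt (α 1) (C 1)) *
        rotAt (α 1) (C 1)) = tr (rotAt (α 0) (C 0) * rotAt (α 1) (C 1) *
          (rotAt (α 1) (C 1) * rotAt (α 2) (C 2))) := by
      rw [mul_assoc, tr_mul_comm]
      simp only [mul_assoc]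
    rw [mul_assoc, tr_mul_comm, ← hB, h, h4, ← h7, h6]
    simp only [trX, trY, trZ]
    ring
  have e4 : tr (rotAt β B * rotAt (α 2) (C 2) * rotAt (α 1) (C 1)) =
      2 * cos (α 0 / 2) * (2 * cos (α 2 / 2)) - trZ α C := by
    have h := tr_mul_inv (rotAt (α 2) (C 2)) (rotAt (α 0) (C 0))
    rw [tr_rotAt, tr_rotAt, tr_mul_comm _ (rotAt (α 0) (C 0))] at h
    rw [← hB]
    have h2 : tr ((rotAt (α 0) (C 0) * rotAt (α 1) (C 1))⁻¹ * rotAt (α 2) (C 2) *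
        rotAt (α 1) (C 1)) = tr (rotAt (α 2) (C 2) * (rotAt (α 0) (C 0))⁻¹) := by
      rw [tr_mul_comm (rotAt (α 2) (C 2)),
        ← tr_conj (rotAt (α 1) (C 1))⁻¹ ((rotAt (α 0) (C 0))⁻¹ * rotAt (α 2) (C 2))]
      congr 1; group
    rw [h2, h, trZ]
    ring
  have hy : trY α C = _ := tr_rotAt_mul (α 1) (α 2) (C 1) (C 2)
  rw [tr_rotAt_mul] at e1 e2
  -- The traces of the two cyclic orders differ only in the sign of the volume term, so their
  -- difference isolates it.
  have e5 : 2 * (sin (β / 2) * sin (α 1 / 2) * sin (α 2 / 2)) * vol B (C 2) (C 1) =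
      2 * cos (α 0 / 2) * (2 * cos (α 2 / 2)) - trZ α C - (trX α C * trY α C +
        2 * cos (α 1 / 2) * (2 * cos (α 3 / 2)) + trZ α C) := by
    rw [← e3, ← e4, tr_rotAt_mul_mul, tr_rotAt_mul_mul, ip_comm (C 2) (C 1)]
    simp only [vol]
    ring
  clear e3 e4
  have hsc : sin (β / 2) ^ 2 = 1 - trX α C ^ 2 / 4 := by
    rw [hx, sin_sq]; ring
  set S := sin (β / 2) ^ 2 * sin (α 1 / 2) * sin (α 2 / 2) with hS
  have hSpos : 0 < S := by
    have := sp 1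
    have := sp 2
    positivity
  simp only [angleCos, angleSin, coef, Matrix.cons_val] at h1 h2
  rw [← hx] at e1 e2
  have hcos : 8 * S * (ip B (C 2) * ip B (C 1) - ip (C 2) (C 1)) = r * cos γ₀ := by
    rw [← h1, ip_comm (C 2) (C 1)]
    have hU : sin (β / 2) * sin (α 1 / 2) * ip B (C 1) =
      (trX α C * cos (α 1 / 2) - 2 * cos (α 0 / 2)) / 2 := by linarith
    have hV : sin (β / 2) * sin (α 2 / 2) * ip B (C 2) =
      -(trX α C * cos (α 2 / 2) + 2 * cos (α 3 / 2)) / 2 := by linarith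
    have hW : sin (α 1 / 2) * sin (α 2 / 2) * ip (C 1) (C 2) =
      (2 * cos (α 1 / 2) * cos (α 2 / 2) - trY α C) / 2 := by linarith
    have e : 8 * S * (ip B (C 2) * ip B (C 1) - ip (C 1) (C 2)) =
      8 * (sin (β / 2) * sin (α 1 / 2) * ip B (C 1)) * (sin (β / 2) * sin (α 2 / 2) * ip B (C 2))
      - 8 * sin (β / 2) ^ 2 * (sin (α 1 / 2) * sin (α 2 / 2) * ip (C 1) (C 2)) := by
      rw [hS]; ring
    rw [e, hU, hV, hW, hsc]
    ring
  have hsin : 8 * S * (vol B (C 2) (C 1) / 2) = r * sin γ₀ := by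
    rw [← h2]
    linear_combination 2 * sin (β / 2) * e5
  -- At C₃ = B both numerators would vanish, although they are r cos γ₀ and r sin γ₀ with r > 0.
  have hne : C 2 ≠ B := by
    intro e
    have v0 : vol B (C 2) (C 1) = 0 := by rw [e]; simp only [vol]; ring
    rw [e, ip_eq_one_iff.2 rfl] at hcos
    rw [v0] at hsin
    have c0 : cos γ₀ = 0 := by
      apply mul_left_cancel₀ hr.ne'
      linarith
    have s0 : sin γ₀ = 0 := by
      apply mul_left_cancel₀ hr.ne'
      linarith
    have := sin_sq_add_cos_sq γ₀
    rw [c0, s0] at this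
    norm_num at this
  have ang : orientedAngle B (C 2) (C 1) = (γ₀ : Real.Angle) := by
    apply orientedAngle_eq hne (k := r / (8 * S)) (by positivity)
    · field_simp
      linarith
    · field_simp
      linarith
  constructor
  · rintro ⟨B', C₂, C₃, hB', h2', h3', rfl⟩
    rw [fixb] at hB'
    rw [fix] at h2' h3'
    rw [hB', h2', h3', ang]
  · rintro rfl
    exact ⟨B, C 1, C 2, (fixb B).2 rfl, (fix 1 _).2 rfl, (fix 2 _).2 rfl, ang.symm⟩

/-- The action-angle coordinates of the representations in the class `X` are `q`. -/
def HasCoords (X : CharVar α) (q : ℝ × AngleCoordinate) : Prop :=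
  ∀ ρ : RelHom α, CharVar.mk ρ = X → ∀ β a, ρ.HasCoordinates β a ↔ (β, a) = q

theorem two_cos_half_injective {β β' : ℝ} (h0 : 0 < β) (h1 : β < 2 * π) (h0' : 0 < β')
    (h1' : β' < 2 * π) (h : 2 * cos (β / 2) = 2 * cos (β' / 2)) : β = β' := by
  have e' : β / 2 = β' / 2 := injOn_cos ⟨by linarith, by linarith⟩ ⟨by linarith, by linarith⟩
    (by linarith)
  linarith

theorem hasCoords_angle (hα : IsLarge α) {X : CharVar α} (hs : sgn X = -1) {β γ r : ℝ}
    (hβ : 0 < β) (hβ' : β < 2 * π) (hx : traceVec X 0 = 2 * cos (β / 2)) (hr : 0 < r)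
    (h1 : angleCos (coef α (-1)) (traceVec X) = r * cos γ)
    (h2 : 2 * sin (β / 2) * angleSin (coef α (-1)) (traceVec X) = r * sin γ) :
    HasCoords X (β, .angle γ) := by
  rintro ρ rfl β' a
  obtain ⟨C, hC⟩ := exists_isCenters ρ
  have hd := sgn_traceVec_mk hα.bounds hC
  rw [hd.1] at hs
  rw [hd.2] at hx h1 h2
  change trX α C = _ at hx
  have hns : ¬ IsSingular ρ := by
    rw [hC.isSingular_iff hα.bounds, ← hC.slice hα.bounds hs]
    have e : 4 - trX α C ^ 2 = (2 * sin (β / 2)) ^ 2 := by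
      rw [hx]; linear_combination -4 * sin_sq_add_cos_sq (β / 2)
    rw [e, ← mul_pow, h1, h2]
    have : (r * cos γ) ^ 2 + (r * sin γ) ^ 2 = r ^ 2 := by
      linear_combination r ^ 2 * sin_sq_add_cos_sq γ
    rw [this]
    positivity
  have hact : HasAction ρ β' ↔ β' = β := by
    rw [hC.hasAction_iff hα, hx]
    constructor
    · rintro ⟨a1, a2, a3⟩
      exact (two_cos_half_injective hβ hβ' a1 a2 a3).symm
    · rintro rfl
      exact ⟨hβ, hβ', rfl⟩
  rw [Prod.mk.injEq]
  cases a with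
  | northPole => simp [RelHom.HasCoordinates, hns]
  | southPole => simp [RelHom.HasCoordinates, hns]
  | angle γ' =>
    simp only [RelHom.HasCoordinates, hact, hns, not_false_eq_true, true_and,
      AngleCoordinate.angle.injEq, hC.hasAngle_iff hα hs hβ hβ' hx hr h1 h2]

/-- Vanishing numerators mean a singular triangle chain. The value of β then names the pole: the two
prescribed values agree only when the angle sum is 6π, which is excluded. -/
theorem hasCoords_pole (hα : IsLarge α) {X : CharVar α} (hs : sgn X = -1) {β : ℝ}
    (hβ : 0 < β) (hβ' : β < 2 * π) (hx : traceVec X 0 = 2 * cos (β / 2))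
    (h1 : angleCos (coef α (-1)) (traceVec X) = 0)
    (h2 : angleSin (coef α (-1)) (traceVec X) = 0) :
    (β = α 2 + α 3 - 2 * π → HasCoords X (β, .northPole)) ∧
      (β = 4 * π - α 0 - α 1 → HasCoords X (β, .southPole)) := by
  have main : ∀ ρ : RelHom α, CharVar.mk ρ = X → IsSingular ρ ∧
      ∀ β', HasAction ρ β' ↔ β' = β := by
    rintro ρ rfl
    obtain ⟨C, hC⟩ := exists_isCenters ρ
    have hd := sgn_traceVec_mk hα.bounds hC
    rw [hd.1] at hs
    rw [hd.2] at hx h1 h2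
    change trX α C = _ at hx
    constructor
    · rw [hC.isSingular_iff hα.bounds, ← hC.slice hα.bounds hs, h1, h2]
      ring
    · intro β'
      rw [hC.hasAction_iff hα, hx]
      constructor
      · rintro ⟨a1, a2, a3⟩
        exact (two_cos_half_injective hβ hβ' a1 a2 a3).symm
      · rintro rfl
        exact ⟨hβ, hβ', rfl⟩
  have hsum := hα.sum
  constructor
  · intro hp ρ hρ β' a
    obtain ⟨m1, m2⟩ := main ρ hρ
    rw [Prod.mk.injEq]
    cases a with
    | northPole =>
      simp only [RelHom.HasCoordinates, m1, m2, true_and, and_true, ← hp, and_self]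
    | southPole =>
      simp only [RelHom.HasCoordinates, m2, reduceCtorEq, and_false, iff_false]
      rintro ⟨rfl, -, h⟩
      linarith
    | angle γ => simp [RelHom.HasCoordinates, m1]
  · intro hp ρ hρ β' a
    obtain ⟨m1, m2⟩ := main ρ hρ
    rw [Prod.mk.injEq]
    cases a with
    | northPole =>
      simp only [RelHom.HasCoordinates, m2, reduceCtorEq, and_false, iff_false]
      rintro ⟨rfl, -, h⟩
      linarith
    | southPole =>
      simp only [RelHom.HasCoordinates, m1, m2, true_and, and_true, ← hp, and_self]
    | angle γ => simp [RelHom.HasCoordinates, m1]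

theorem coordinates_eq {O : Set (CharVar α)} {q : Fin 3 → ℝ × AngleCoordinate}
    (h1 : ∀ X ∈ O, ∃ i, HasCoords X (q i)) (h2 : ∀ i, ∃ X ∈ O, HasCoords X (q i)) :
    coordinates O = {q 0, q 1, q 2} := by
  have hset : ({q 0, q 1, q 2} : Set (ℝ × AngleCoordinate)) = Set.range q := by
    ext y
    simp only [Set.mem_insert_iff, Set.mem_singleton_iff, Set.mem_range, Fin.exists_fin_succ,
      Fin.exists_fin_zero]
    constructor
    · rintro (rfl | rfl | rfl)
      exacts [Or.inl rfl, Or.inr (Or.inl rfl), Or.inr (Or.inr (Or.inl rfl))]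
    · rintro (h | h | h | h)
      exacts [Or.inl h.symm, Or.inr (Or.inl h.symm), Or.inr (Or.inr h.symm), h.elim]
  rw [hset]
  ext ⟨β, a⟩
  constructor
  · rintro ⟨ρ, hρ, h⟩
    obtain ⟨i, hi⟩ := h1 _ hρ
    exact ⟨i, ((hi ρ rfl β a).1 h).symm⟩
  · rintro ⟨i, hi⟩
    obtain ⟨X, hX, h⟩ := h2 i
    obtain ⟨ρ, rfl⟩ := exists_rep X
    exact ⟨ρ, hX, (h ρ rfl β a).2 hi.symm⟩

end PuncturedSphere

end

noncomputable section
namespace PuncturedSphere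
open SphereGroup AngleCoordinate
variable {α : Fin 4 → ℝ}

/-! ### Coordinates of the orbits of length three -/

theorem coordinates_eq_of_points (hα : IsLarge α) {O : Set (CharVar α)}
    (hO : IsOrbitOfLengthThree α O) {P : Fin 3 → (Fin 3 → ℝ)}
    {q : Fin 3 → ℝ × AngleCoordinate} (hP : ∀ p, p ∈ traceVec '' O ↔ ∃ i, p = P i)
    (hq : ∀ i, ∀ X : CharVar α, sgn X = -1 → traceVec X = P i → HasCoords X (q i)) :
    coordinates O = {q 0, q 1, q 2} := by
  apply coordinates_eq
  · intro X hX
    obtain ⟨i, hi⟩ := (hP _).1 ⟨X, hX, rfl⟩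
    exact ⟨i, hq i X (sgn_of_orbit hα hO hX) hi⟩
  · intro i
    obtain ⟨X, hX, h⟩ := (hP (P i)).2 ⟨i, rfl⟩
    exact ⟨X, hX, hq i X (sgn_of_orbit hα hO hX) h⟩

theorem exists_fin_three {p : Fin 3 → Prop} : (∃ i, p i) ↔ p 0 ∨ p 1 ∨ p 2 := by
  simp [Fin.exists_fin_succ]

theorem eq_vec_iff {p : Fin 3 → ℝ} {a b c : ℝ} : p = ![a, b, c] ↔ p 0 = a ∧ p 1 = b ∧ p 2 = c := by
  rw [eq_comm, eq_cons3_iff, eq_comm, eq_comm (a := b), eq_comm (a := c)]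

/-! ### Special values of sine and cosine -/

theorem sin_two_pi_div_three : sin (2 * π / 3) = √3 / 2 := by
  rw [show 2 * π / 3 = π - π / 3 by ring, sin_pi_sub, sin_pi_div_three]

theorem cos_two_pi_div_three : cos (2 * π / 3) = -1 / 2 := by
  rw [show 2 * π / 3 = π - π / 3 by ring, cos_pi_sub, cos_pi_div_three]; norm_num

theorem sin_four_pi_div_three : sin (4 * π / 3) = -(√3 / 2) := by
  rw [show 4 * π / 3 = π / 3 + π by ring, sin_add_pi, sin_pi_div_three]

theorem cos_four_pi_div_three : cos (4 * π / 3) = -1 / 2 := by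
  rw [show 4 * π / 3 = π / 3 + π by ring, cos_add_pi, cos_pi_div_three]; norm_num

theorem sin_five_pi_div_three : sin (5 * π / 3) = -(√3 / 2) := by
  rw [show 5 * π / 3 = 2 * π - π / 3 by ring, sin_two_pi_sub, sin_pi_div_three]

theorem cos_five_pi_div_three : cos (5 * π / 3) = 1 / 2 := by
  rw [show 5 * π / 3 = 2 * π - π / 3 by ring, cos_two_pi_sub, cos_pi_div_three]

theorem sin_three_pi_div_two' : sin (3 * π / 2) = -1 := by
  rw [show 3 * π / 2 = π / 2 + π by ring, sin_add_pi, sin_pi_div_two]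

theorem cos_three_pi_div_two' : cos (3 * π / 2) = 0 := by
  rw [show 3 * π / 2 = π / 2 + π by ring, cos_add_pi, cos_pi_div_two, neg_zero]

theorem sq_eq_four_of_eq {k x : ℝ} (hx : x ^ 2 = 1) (h : k = 2 * x) : k ^ 2 = 4 := by
  rw [h]; linear_combination 4 * hx

/-- The orbit on which the first trace is constant. -/
theorem coordinates_of_cycle_x (hα : IsLarge α) {O : Set (CharVar α)}
    (hO : IsOrbitOfLengthThree α O) (h1 : coef α (-1) 1 ^ 2 ≠ 4) (h2 : coef α (-1) 2 ^ 2 ≠ 4)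
    {β : ℝ} (hβ : 0 < β) (hβ' : β < 2 * π) (h0 : coef α (-1) 0 = 4 * cos (β / 2)) :
    (0 < coef α (-1) 1 → coordinates O = {(β, angle (0 : ℝ)), (β, angle (2 * π / 3 : ℝ)),
      (β, angle (4 * π / 3 : ℝ))}) ∧
    (coef α (-1) 1 < 0 → coordinates O = {(β, angle (π / 3 : ℝ)), (β, angle (π : ℝ)),
      (β, angle (5 * π / 3 : ℝ))}) := by
  obtain ⟨i, x, hx, hki, H⟩ := (isTwistDynamics hα hO).classification
  -- The cyclic twist must have coefficient ±2, which leaves only this index.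
  obtain rfl : i = 0 := by
    fin_cases i
    · rfl
    · exact absurd (sq_eq_four_of_eq hx hki) h1
    · exact absurd (sq_eq_four_of_eq hx hki) h2
  obtain ⟨hk, hne, hE⟩ := H 1 2 (by decide) (by decide) (by decide)
  set k := coef α (-1) with hkdef
  have hxβ : x = 2 * cos (β / 2) := by linarith
  have sβ : 0 < sin (β / 2) := sin_pos_of_pos_of_lt_pi (by linarith) (by linarith)
  have hsq : 2 * sin (β / 2) = √3 := by
    rw [eq_comm, Real.sqrt_eq_iff_mul_self_eq_of_pos (by linarith)]
    have := sin_sq_add_cos_sq (β / 2)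
    rw [hxβ] at hx
    linear_combination 4 * this - hx
  have s3 : 0 < √3 := by positivity
  have hP : ∀ p, p ∈ traceVec '' O ↔ ∃ i, p = (![![x, k 1, 0], ![x, 0, k 2], ![x, 0, 0]] :
      Fin 3 → Fin 3 → ℝ) i := by
    intro p
    rw [hE, exists_fin_three]
    simp only [Matrix.cons_val, eq_vec_iff]
    tauto
  -- The same points in another order: the sign of x decides which of the last two has the larger
  -- angle.
  have hP' : ∀ p, p ∈ traceVec '' O ↔ ∃ i, p = (![![x, k 1, 0], ![x, 0, 0], ![x, 0, k 2]] :
      Fin 3 → Fin 3 → ℝ) i := by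
    intro p
    rw [hE, exists_fin_three]
    simp only [Matrix.cons_val, eq_vec_iff]
    tauto
  have hx1 : x = 1 ∨ x = -1 := by
    have : (x - 1) * (x + 1) = 0 := by linear_combination hx
    rcases mul_eq_zero.1 this with h | h
    · exact Or.inl (by linarith)
    · exact Or.inr (by linarith)
  -- values of the angle functions
  have p1 : ∀ X : CharVar α, traceVec X = ![x, k 1, 0] → traceVec X 0 = 2 * cos (β / 2) ∧
      angleCos k (traceVec X) = 2 * k 1 ∧ 2 * sin (β / 2) * angleSin k (traceVec X) = 0 := by
    intro X e
    rw [e]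
    simp only [angleCos, angleSin, Matrix.cons_val]
    refine ⟨hxβ, ?_, ?_⟩
    · rw [hk]; linear_combination (k 1 - k 1) * hx
    · rw [hk]; ring
  have p2 : ∀ X : CharVar α, traceVec X = ![x, 0, k 2] → traceVec X 0 = 2 * cos (β / 2) ∧
      angleCos k (traceVec X) = -k 1 ∧
      2 * sin (β / 2) * angleSin k (traceVec X) = -(√3 * x * k 1) := by
    intro X e
    rw [e, hsq]
    simp only [angleCos, angleSin, Matrix.cons_val]
    refine ⟨hxβ, ?_, ?_⟩
    · rw [hk]; linear_combination k 1 * hx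
    · rw [hk]; ring
  have p3 : ∀ X : CharVar α, traceVec X = ![x, 0, 0] → traceVec X 0 = 2 * cos (β / 2) ∧
      angleCos k (traceVec X) = -k 1 ∧
      2 * sin (β / 2) * angleSin k (traceVec X) = √3 * x * k 1 := by
    intro X e
    rw [e, hsq]
    simp only [angleCos, angleSin, Matrix.cons_val]
    refine ⟨hxβ, ?_, ?_⟩
    · rw [hk]; linear_combination k 1 * hx
    · rw [hk]; ring
  -- The pairs (u, v) of numerators are three vectors of length 2|k₁| in directions 2π/3 apart, so r
  -- is 2k₁ or -2k₁ below.
  have build : ∀ (X : CharVar α) (u v γ r : ℝ), sgn X = -1 → traceVec X 0 = 2 * cos (β / 2) ∧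
      angleCos k (traceVec X) = u ∧ 2 * sin (β / 2) * angleSin k (traceVec X) = v → 0 < r →
      u = r * cos γ → v = r * sin γ → HasCoords X (β, angle γ) := by
    rintro X u v γ r hs ⟨e1, e2, e3⟩ hr hu' hv'
    exact hasCoords_angle hα hs hβ hβ' e1 hr (e2.trans hu') (e3.trans hv')
  constructor
  · intro hpos
    rcases hx1 with hx1 | hx1
    · rw [coordinates_eq_of_points hα hO (q := ![(β, angle (0 : ℝ)), (β, angle (4 * π / 3 : ℝ)),
        (β, angle (2 * π / 3 : ℝ))]) hP]
      · simp only [Matrix.cons_val]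
        rw [Set.pair_comm]
      · intro i X hs hX
        fin_cases i
        · exact build X _ _ _ _ hs (p1 X hX) (by linarith : 0 < 2 * k 1) (by simp) (by simp)
        · exact build X _ _ _ _ hs (p2 X hX) (by linarith : 0 < 2 * k 1)
            (by rw [cos_four_pi_div_three]; ring) (by rw [sin_four_pi_div_three, hx1]; ring)
        · exact build X _ _ _ _ hs (p3 X hX) (by linarith : 0 < 2 * k 1)
            (by rw [cos_two_pi_div_three]; ring) (by rw [sin_two_pi_div_three, hx1]; ring)
    · rw [coordinates_eq_of_points hα hO (q := ![(β, angle (0 : ℝ)), (β, angle (2 * π / 3 : ℝ)),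
        (β, angle (4 * π / 3 : ℝ))]) hP]
      · simp only [Matrix.cons_val]
      · intro i X hs hX
        fin_cases i
        · exact build X _ _ _ _ hs (p1 X hX) (by linarith : 0 < 2 * k 1) (by simp) (by simp)
        · exact build X _ _ _ _ hs (p2 X hX) (by linarith : 0 < 2 * k 1)
            (by rw [cos_two_pi_div_three]; ring) (by rw [sin_two_pi_div_three, hx1]; ring)
        · exact build X _ _ _ _ hs (p3 X hX) (by linarith : 0 < 2 * k 1)
            (by rw [cos_four_pi_div_three]; ring) (by rw [sin_four_pi_div_three, hx1]; ring)
  · intro hneg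
    rcases hx1 with hx1 | hx1
    · rw [coordinates_eq_of_points hα hO (q := ![(β, angle (π : ℝ)), (β, angle (π / 3 : ℝ)),
        (β, angle (5 * π / 3 : ℝ))]) hP]
      · simp only [Matrix.cons_val]
        rw [Set.insert_comm]
      · intro i X hs hX
        fin_cases i
        · exact build X _ _ _ _ hs (p1 X hX) (by linarith : 0 < -2 * k 1) (by simp) (by simp)
        · exact build X _ _ _ _ hs (p2 X hX) (by linarith : 0 < -2 * k 1)
            (by rw [cos_pi_div_three]; ring) (by rw [sin_pi_div_three, hx1]; ring)
        · exact build X _ _ _ _ hs (p3 X hX) (by linarith : 0 < -2 * k 1)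
            (by rw [cos_five_pi_div_three]; ring) (by rw [sin_five_pi_div_three, hx1]; ring)
    · rw [coordinates_eq_of_points hα hO (q := ![(β, angle (π : ℝ)), (β, angle (π / 3 : ℝ)),
        (β, angle (5 * π / 3 : ℝ))]) hP']
      · simp only [Matrix.cons_val]
        rw [Set.insert_comm]
      · intro i X hs hX
        fin_cases i
        · exact build X _ _ _ _ hs (p1 X hX) (by linarith : 0 < -2 * k 1) (by simp) (by simp)
        · exact build X _ _ _ _ hs (p3 X hX) (by linarith : 0 < -2 * k 1)
            (by rw [cos_pi_div_three]; ring) (by rw [sin_pi_div_three, hx1]; ring)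
        · exact build X _ _ _ _ hs (p2 X hX) (by linarith : 0 < -2 * k 1)
            (by rw [cos_five_pi_div_three]; ring) (by rw [sin_five_pi_div_three, hx1]; ring)

/-- `a` is the north or the south pole, and `β` is its action coordinate. -/
def IsPoleAt (α : Fin 4 → ℝ) (β : ℝ) (a : AngleCoordinate) : Prop :=
  (a = northPole ∧ β = α 2 + α 3 - 2 * π) ∨ (a = southPole ∧ β = 4 * π - α 0 - α 1)

theorem hasCoords_of_isPoleAt (hα : IsLarge α) {X : CharVar α} (hs : sgn X = -1) {β : ℝ}
    {a : AngleCoordinate} (ha : IsPoleAt α β a)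
    (hβ : 0 < β) (hβ' : β < 2 * π) (hx : traceVec X 0 = 2 * cos (β / 2))
    (h1 : angleCos (coef α (-1)) (traceVec X) = 0)
    (h2 : angleSin (coef α (-1)) (traceVec X) = 0) : HasCoords X (β, a) := by
  have h := hasCoords_pole hα hs hβ hβ' hx h1 h2
  rcases ha with ⟨rfl, e⟩ | ⟨rfl, e⟩
  exacts [h.1 e, h.2 e]

theorem two_sin_pi_div_two : 2 * sin (π / 2) = 2 := by simp

/-- The orbit on which the second trace is constant. -/
theorem coordinates_of_cycle_y (hα : IsLarge α) {O : Set (CharVar α)}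
    (hO : IsOrbitOfLengthThree α O) (h0 : coef α (-1) 0 ^ 2 ≠ 4) (h2 : coef α (-1) 2 ^ 2 ≠ 4)
    {β : ℝ} {a : AngleCoordinate} (ha : IsPoleAt α β a) (hβ : 0 < β) (hβ' : β < 2 * π)
    (hk0 : coef α (-1) 0 = 2 * cos (β / 2)) :
    coordinates O = {(π, angle (π / 2 : ℝ)), (π, angle (3 * π / 2 : ℝ)), (β, a)} := by
  obtain ⟨i, y, hy, hki, H⟩ := (isTwistDynamics hα hO).classification
  obtain rfl : i = 1 := by
    fin_cases i
    · exact absurd (sq_eq_four_of_eq hy hki) h0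
    · rfl
    · exact absurd (sq_eq_four_of_eq hy hki) h2
  obtain ⟨hk, hne, hE⟩ := H 0 2 (by decide) (by decide) (by decide)
  set k := coef α (-1) with hkdef
  have hk2 : k 2 ≠ 0 := by
    rw [hk]
    apply mul_ne_zero _ hne
    rintro rfl
    norm_num at hy
  have hP : ∀ p, p ∈ traceVec '' O ↔ ∃ i, p = (![![0, y, k 2], ![0, y, 0], ![k 0, y, 0]] :
      Fin 3 → Fin 3 → ℝ) i := by
    intro p
    rw [hE, exists_fin_three]
    simp only [Matrix.cons_val, eq_vec_iff]
    tauto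
  have hP' : ∀ p, p ∈ traceVec '' O ↔ ∃ i, p = (![![0, y, 0], ![0, y, k 2], ![k 0, y, 0]] :
      Fin 3 → Fin 3 → ℝ) i := by
    intro p
    rw [hE, exists_fin_three]
    simp only [Matrix.cons_val, eq_vec_iff]
    tauto
  have p1 : ∀ X : CharVar α, sgn X = -1 → traceVec X = ![k 0, y, 0] → HasCoords X (β, a) := by
    intro X hs e
    apply hasCoords_of_isPoleAt hα hs ha hβ hβ'
    · rw [e]; exact hk0
    · rw [e]
      simp only [angleCos, Matrix.cons_val]
      rw [← hkdef, hki, hk]; ring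
    · rw [e]
      simp only [angleSin, Matrix.cons_val]
      rw [← hkdef, hk]; ring
  have p2 : ∀ X : CharVar α, ∀ r γ : ℝ, sgn X = -1 → traceVec X = ![0, y, k 2] → 0 < r →
      cos γ = 0 → -2 * k 2 = r * sin γ → HasCoords X (π, angle γ) := by
    intro X r γ hs e hr hc hsin
    apply hasCoords_angle hα hs pi_pos (by linarith [pi_pos]) _ hr
    · rw [e]
      simp only [angleCos, Matrix.cons_val]
      rw [← hkdef, hki, hc]; ring
    · rw [e, ← hsin, two_sin_pi_div_two]
      simp only [angleSin, Matrix.cons_val]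
      rw [← hkdef]; ring
    · rw [e]; simp
  have p3 : ∀ X : CharVar α, ∀ r γ : ℝ, sgn X = -1 → traceVec X = ![0, y, 0] → 0 < r →
      cos γ = 0 → 2 * k 2 = r * sin γ → HasCoords X (π, angle γ) := by
    intro X r γ hs e hr hc hsin
    apply hasCoords_angle hα hs pi_pos (by linarith [pi_pos]) _ hr
    · rw [e]
      simp only [angleCos, Matrix.cons_val]
      rw [← hkdef, hki, hc]; ring
    · rw [e, ← hsin, two_sin_pi_div_two]
      simp only [angleSin, Matrix.cons_val]
      rw [← hkdef]; ring
    · rw [e]; simp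
  -- At the two regular points only the sine numerators ±2k₂ remain, so the sign of k₂ decides which
  -- point has angle π/2.
  rcases lt_or_gt_of_ne hk2 with hneg | hpos
  · rw [coordinates_eq_of_points hα hO (q := ![(π, angle (π / 2 : ℝ)),
      (π, angle (3 * π / 2 : ℝ)), (β, a)]) hP]
    · simp only [Matrix.cons_val]
    · intro i X hs hX
      fin_cases i
      · exact p2 X (-2 * k 2) _ hs hX (by linarith) cos_pi_div_two (by rw [sin_pi_div_two]; ring)
      · exact p3 X (-2 * k 2) _ hs hX (by linarith) cos_three_pi_div_two'
          (by rw [sin_three_pi_div_two']; ring)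
      · exact p1 X hs hX
  · rw [coordinates_eq_of_points hα hO (q := ![(π, angle (π / 2 : ℝ)),
      (π, angle (3 * π / 2 : ℝ)), (β, a)]) hP']
    · simp only [Matrix.cons_val]
    · intro i X hs hX
      fin_cases i
      · exact p3 X (2 * k 2) _ hs hX (by linarith) cos_pi_div_two (by rw [sin_pi_div_two]; ring)
      · exact p2 X (2 * k 2) _ hs hX (by linarith) cos_three_pi_div_two'
          (by rw [sin_three_pi_div_two']; ring)
      · exact p1 X hs hX

/-- The orbit on which the third trace is constant. -/
theorem coordinates_of_cycle_z (hα : IsLarge α) {O : Set (CharVar α)}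
    (hO : IsOrbitOfLengthThree α O) (h0 : coef α (-1) 0 ^ 2 ≠ 4) (h1 : coef α (-1) 1 ^ 2 ≠ 4)
    {β : ℝ} {a : AngleCoordinate} (ha : IsPoleAt α β a) (hβ : 0 < β) (hβ' : β < 2 * π)
    (hk0 : coef α (-1) 0 = 2 * cos (β / 2)) :
    coordinates O = {(π, angle (0 : ℝ)), (π, angle (π : ℝ)), (β, a)} := by
  obtain ⟨i, z, hz, hki, H⟩ := (isTwistDynamics hα hO).classification
  obtain rfl : i = 2 := by
    fin_cases i
    · exact absurd (sq_eq_four_of_eq hz hki) h0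
    · exact absurd (sq_eq_four_of_eq hz hki) h1
    · rfl
  obtain ⟨hk, hne, hE⟩ := H 0 1 (by decide) (by decide) (by decide)
  set k := coef α (-1) with hkdef
  have hk1 : k 1 ≠ 0 := by
    rw [hk]
    apply mul_ne_zero _ hne
    rintro rfl
    norm_num at hz
  have hP : ∀ p, p ∈ traceVec '' O ↔ ∃ i, p = (![![0, k 1, z], ![0, 0, z], ![k 0, 0, z]] :
      Fin 3 → Fin 3 → ℝ) i := by
    intro p
    rw [hE, exists_fin_three]
    simp only [Matrix.cons_val, eq_vec_iff]
    tauto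
  have hP' : ∀ p, p ∈ traceVec '' O ↔ ∃ i, p = (![![0, 0, z], ![0, k 1, z], ![k 0, 0, z]] :
      Fin 3 → Fin 3 → ℝ) i := by
    intro p
    rw [hE, exists_fin_three]
    simp only [Matrix.cons_val, eq_vec_iff]
    tauto
  have p1 : ∀ X : CharVar α, sgn X = -1 → traceVec X = ![k 0, 0, z] → HasCoords X (β, a) := by
    intro X hs e
    apply hasCoords_of_isPoleAt hα hs ha hβ hβ'
    · rw [e]; exact hk0
    · rw [e]
      simp only [angleCos, Matrix.cons_val]
      rw [← hkdef, hki, hk]; ring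
    · rw [e]
      simp only [angleSin, Matrix.cons_val]
      rw [← hkdef, hki]; ring
  have p2 : ∀ X : CharVar α, ∀ r γ : ℝ, sgn X = -1 → traceVec X = ![0, k 1, z] → 0 < r →
      sin γ = 0 → 2 * k 1 = r * cos γ → HasCoords X (π, angle γ) := by
    intro X r γ hs e hr hsin hc
    apply hasCoords_angle hα hs pi_pos (by linarith [pi_pos]) _ hr
    · rw [e, ← hc]
      simp only [angleCos, Matrix.cons_val]
      rw [← hkdef]; ring
    · rw [e, hsin]
      simp only [angleSin, Matrix.cons_val]
      rw [← hkdef, hki]; ring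
    · rw [e]; simp
  have p3 : ∀ X : CharVar α, ∀ r γ : ℝ, sgn X = -1 → traceVec X = ![0, 0, z] → 0 < r →
      sin γ = 0 → -2 * k 1 = r * cos γ → HasCoords X (π, angle γ) := by
    intro X r γ hs e hr hsin hc
    apply hasCoords_angle hα hs pi_pos (by linarith [pi_pos]) _ hr
    · rw [e, ← hc]
      simp only [angleCos, Matrix.cons_val]
      rw [← hkdef]; ring
    · rw [e, hsin]
      simp only [angleSin, Matrix.cons_val]
      rw [← hkdef, hki]; ring
    · rw [e]; simp
  rcases lt_or_gt_of_ne hk1 with hneg | hpos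
  · rw [coordinates_eq_of_points hα hO (q := ![(π, angle (0 : ℝ)), (π, angle (π : ℝ)), (β, a)]) hP']
    · simp only [Matrix.cons_val]
    · intro i X hs hX
      fin_cases i
      · exact p3 X (-2 * k 1) _ hs hX (by linarith) sin_zero (by rw [cos_zero]; ring)
      · exact p2 X (-2 * k 1) _ hs hX (by linarith) sin_pi (by rw [cos_pi]; ring)
      · exact p1 X hs hX
  · rw [coordinates_eq_of_points hα hO (q := ![(π, angle (0 : ℝ)), (π, angle (π : ℝ)), (β, a)]) hP]
    · simp only [Matrix.cons_val]
    · intro i X hs hX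
      fin_cases i
      · exact p2 X (2 * k 1) _ hs hX (by linarith) sin_zero (by rw [cos_zero]; ring)
      · exact p3 X (2 * k 1) _ hs hX (by linarith) sin_pi (by rw [cos_pi]; ring)
      · exact p1 X hs hX

end PuncturedSphere

end

noncomputable section
namespace PuncturedSphere
open SphereGroup AngleCoordinate

/-! ### The angles `4π/3, θ, θ, 2θ - 2π` -/

variable {θ : ℝ}

theorem two_cos_two_pi_div_three : 2 * cos (4 * π / 3 / 2) = -1 := by
  rw [show 4 * π / 3 / 2 = π - π / 3 by ring, cos_pi_sub, cos_pi_div_three]; norm_num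

theorem two_cos_half_double : 2 * cos ((2 * θ - 2 * π) / 2) = 2 - (2 * cos (θ / 2)) ^ 2 := by
  rw [show (2 * θ - 2 * π) / 2 = 2 * (θ / 2) - π by ring, cos_sub_pi, cos_two_mul]; ring

theorem two_cos_half_triple :
    2 * cos (3 * (θ / 2)) = (2 * cos (θ / 2)) ^ 3 - 3 * (2 * cos (θ / 2)) := by
  rw [cos_three_mul]; ring

theorem two_cos_north :
    2 * cos ((3 * θ - 4 * π) / 2) = (2 * cos (θ / 2)) ^ 3 - 3 * (2 * cos (θ / 2)) := by
  rw [← two_cos_half_triple, show (3 * θ - 4 * π) / 2 = 3 * (θ / 2) - 2 * π by ring,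
    cos_sub_two_pi]

theorem two_cos_south :
    2 * cos ((6 * π - 3 * θ) / 2) = 3 * (2 * cos (θ / 2)) - (2 * cos (θ / 2)) ^ 3 := by
  rw [show (6 * π - 3 * θ) / 2 = π - 3 * (θ / 2) + 2 * π by ring, cos_add_two_pi, cos_pi_sub]
  linear_combination -two_cos_half_triple (θ := θ)

/-- Here θ/2 lies between 5π/6 and π, so 2cos(θ/2) lies between -2 and -√3. -/
theorem two_cos_half_bounds (hθ : 5 * π / 3 < θ) (hθ' : θ < 2 * π) :
    -2 < 2 * cos (θ / 2) ∧ 3 < (2 * cos (θ / 2)) ^ 2 ∧ 2 * cos (θ / 2) < 0 ∧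
      (2 * cos (θ / 2)) ^ 2 < 4 := by
  have h1 : cos π < cos (θ / 2) := cos_lt_cos_of_nonneg_of_le_pi (by linarith [pi_pos]) le_rfl
    (by linarith)
  have h2 : cos (θ / 2) < cos (5 * π / 6) := cos_lt_cos_of_nonneg_of_le_pi (by linarith [pi_pos])
    (by linarith) (by linarith)
  rw [cos_pi] at h1
  rw [show 5 * π / 6 = π - π / 6 by ring, cos_pi_sub, cos_pi_div_six] at h2
  have h3 : √3 ^ 2 = 3 := Real.sq_sqrt (by norm_num)
  have h4 : 0 < √3 := by positivity
  refine ⟨by linarith, ?_, by linarith, ?_⟩ <;> nlinarith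

/-- Up to sign, t³ - 3t is each of the two coefficients other than ±2. Nonvanishing separates the
points of the orbit, and absolute value below 2 prevents those twists from being cyclic. -/
theorem triple_bounds (hθ : 5 * π / 3 < θ) (hθ' : θ < 2 * π) :
    -2 < (2 * cos (θ / 2)) ^ 3 - 3 * (2 * cos (θ / 2)) ∧
      (2 * cos (θ / 2)) ^ 3 - 3 * (2 * cos (θ / 2)) < 0 := by
  obtain ⟨h1, h2, h3, -⟩ := two_cos_half_bounds hθ hθ'
  set t := 2 * cos (θ / 2)
  constructor
  · have : 0 < (t + 2) * (t - 1) ^ 2 := mul_pos (by linarith) (by nlinarith)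
    linarith [show (t + 2) * (t - 1) ^ 2 = t ^ 3 - 3 * t + 2 by ring]
  · nlinarith

theorem triple_sq_lt (hθ : 5 * π / 3 < θ) (hθ' : θ < 2 * π) :
    ((2 * cos (θ / 2)) ^ 3 - 3 * (2 * cos (θ / 2))) ^ 2 < 4 := by
  obtain ⟨h1, h2⟩ := triple_bounds hθ hθ'
  nlinarith

theorem isLarge_of_perm (hθ : 5 * π / 3 < θ) (hθ' : θ < 2 * π) (σ : Equiv.Perm (Fin 4)) :
    IsLarge (![4 * π / 3, θ, θ, 2 * θ - 2 * π] ∘ σ) := by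
  have hb : ∀ i, π < (![4 * π / 3, θ, θ, 2 * θ - 2 * π] : Fin 4 → ℝ) i ∧
      (![4 * π / 3, θ, θ, 2 * θ - 2 * π] : Fin 4 → ℝ) i < 2 * π := by
    intro i
    fin_cases i <;> simp <;> constructor <;> linarith [pi_pos]
  refine ⟨fun i => (hb _).1, fun i => (hb _).2, ?_⟩
  have h : ∑ i, (![4 * π / 3, θ, θ, 2 * θ - 2 * π] ∘ σ) i
      = ∑ i, (![4 * π / 3, θ, θ, 2 * θ - 2 * π] : Fin 4 → ℝ) i :=
    Equiv.sum_comp σ _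
  rw [Fin.sum_univ_four, Fin.sum_univ_four] at h
  rw [h]
  simp only [Matrix.cons_val]
  linarith

theorem IsLarge.of_coords {a b c d : ℝ} (ha : π < a ∧ a < 2 * π) (hb : π < b ∧ b < 2 * π)
    (hc : π < c ∧ c < 2 * π) (hd : π < d ∧ d < 2 * π) (h : 6 * π < a + b + c + d) :
    IsLarge ![a, b, c, d] := by
  refine ⟨fun i => ?_, fun i => ?_, by simpa using h⟩ <;> fin_cases i <;> simp [*]

theorem coef_cons (a b c d : ℝ) : coef ![a, b, c, d] (-1) =
    ![2 * cos (a / 2) * (2 * cos (b / 2)) - 2 * cos (c / 2) * (2 * cos (d / 2)),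
      2 * cos (b / 2) * (2 * cos (c / 2)) - 2 * cos (a / 2) * (2 * cos (d / 2)),
      2 * cos (a / 2) * (2 * cos (c / 2)) - 2 * cos (b / 2) * (2 * cos (d / 2))] := by
  simp only [coef, Matrix.cons_val]
  ring_nf

/-- Peripheral angles for which the first trace is constant on an orbit of length three. -/
theorem orbitCoordinatesAre_of_cycle_x {a b c d β : ℝ} (hα : IsLarge ![a, b, c, d])
    (hβ : 0 < β) (hβ' : β < 2 * π) {x y z : ℝ} (h : coef ![a, b, c, d] (-1) = ![x, y, z])
    (hx : x = 2 * (2 * cos (β / 2))) (hy : y ^ 2 < 4) (hz : z ^ 2 < 4) :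
    (0 < y → OrbitCoordinatesAre ![a, b, c, d] {(β, angle (0 : ℝ)),
      (β, angle (2 * π / 3 : ℝ)), (β, angle (4 * π / 3 : ℝ))}) ∧
    (y < 0 → OrbitCoordinatesAre ![a, b, c, d] {(β, angle (π / 3 : ℝ)),
      (β, angle (π : ℝ)), (β, angle (5 * π / 3 : ℝ))}) := by
  constructor <;> intro hy' O hO
  · refine (coordinates_of_cycle_x hα hO ?_ ?_ hβ hβ' ?_).1 ?_ <;> rw [h]
    exacts [hy.ne, hz.ne, by simp [hx]; ring, hy']
  · refine (coordinates_of_cycle_x hα hO ?_ ?_ hβ hβ' ?_).2 ?_ <;> rw [h]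
    exacts [hy.ne, hz.ne, by simp [hx]; ring, hy']

theorem orbitCoordinatesAre_of_cycle_y {a b c d β : ℝ} (hα : IsLarge ![a, b, c, d])
    (hβ : 0 < β) (hβ' : β < 2 * π) {x y z : ℝ} (h : coef ![a, b, c, d] (-1) = ![x, y, z])
    {p : AngleCoordinate} (hp : IsPoleAt ![a, b, c, d] β p)
    (hx : x = 2 * cos (β / 2)) (hx' : x ^ 2 < 4) (hz : z ^ 2 < 4) :
    OrbitCoordinatesAre ![a, b, c, d] {(π, angle (π / 2 : ℝ)),
      (π, angle (3 * π / 2 : ℝ)), (β, p)} := by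
  intro O hO
  refine coordinates_of_cycle_y hα hO ?_ ?_ hp hβ hβ' ?_ <;> rw [h]
  exacts [hx'.ne, hz.ne, hx]

theorem orbitCoordinatesAre_of_cycle_z {a b c d β : ℝ} (hα : IsLarge ![a, b, c, d])
    (hβ : 0 < β) (hβ' : β < 2 * π) {x y z : ℝ} (h : coef ![a, b, c, d] (-1) = ![x, y, z])
    {p : AngleCoordinate} (hp : IsPoleAt ![a, b, c, d] β p)
    (hx : x = 2 * cos (β / 2)) (hx' : x ^ 2 < 4) (hy : y ^ 2 < 4) :
    OrbitCoordinatesAre ![a, b, c, d] {(π, angle (0 : ℝ)),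
      (π, angle (π : ℝ)), (β, p)} := by
  intro O hO
  refine coordinates_of_cycle_z hα hO ?_ ?_ hp hβ hβ' ?_ <;> rw [h]
  exacts [hx'.ne, hy.ne, hx]

/-- The half-angle traces are -1, t, t and 2 - t². The coefficient of the curve separating the two
punctures of angle θ from the other two is ±(t² + (2 - t²)) = ±2, and the others are ±(t³ - 3t). So
the position of the angles θ decides which trace is constant, and signs and poles depend on the
finer order. -/
theorem orbit_coordinates (hθ : 5 * π / 3 < θ) (hθ' : θ < 2 * π) :
    OrbitCoordinatesAre ![4 * π / 3, 2 * θ - 2 * π, θ, θ]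
      {(4 * π / 3, angle (0 : ℝ)), (4 * π / 3, angle (2 * π / 3 : ℝ)),
        (4 * π / 3, angle (4 * π / 3 : ℝ))} ∧
    OrbitCoordinatesAre ![2 * θ - 2 * π, 4 * π / 3, θ, θ]
      {(4 * π / 3, angle (π / 3 : ℝ)), (4 * π / 3, angle (π : ℝ)),
        (4 * π / 3, angle (5 * π / 3 : ℝ))} ∧
    OrbitCoordinatesAre ![θ, θ, 4 * π / 3, 2 * θ - 2 * π]
      {(2 * π / 3, angle (π / 3 : ℝ)), (2 * π / 3, angle (π : ℝ)),
        (2 * π / 3, angle (5 * π / 3 : ℝ))} ∧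
    OrbitCoordinatesAre ![θ, θ, 2 * θ - 2 * π, 4 * π / 3]
      {(2 * π / 3, angle (0 : ℝ)), (2 * π / 3, angle (2 * π / 3 : ℝ)),
        (2 * π / 3, angle (4 * π / 3 : ℝ))} ∧
    OrbitCoordinatesAre ![4 * π / 3, θ, 2 * θ - 2 * π, θ]
      {(π, angle (0 : ℝ)), (π, angle (π : ℝ)), (3 * θ - 4 * π, northPole)} ∧
    OrbitCoordinatesAre ![θ, 4 * π / 3, θ, 2 * θ - 2 * π]
      {(π, angle (0 : ℝ)), (π, angle (π : ℝ)), (3 * θ - 4 * π, northPole)} ∧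
    OrbitCoordinatesAre ![2 * θ - 2 * π, θ, 4 * π / 3, θ]
      {(π, angle (0 : ℝ)), (π, angle (π : ℝ)), (6 * π - 3 * θ, southPole)} ∧
    OrbitCoordinatesAre ![θ, 2 * θ - 2 * π, θ, 4 * π / 3]
      {(π, angle (0 : ℝ)), (π, angle (π : ℝ)), (6 * π - 3 * θ, southPole)} ∧
    OrbitCoordinatesAre ![4 * π / 3, θ, θ, 2 * θ - 2 * π]
      {(π, angle (π / 2 : ℝ)), (π, angle (3 * π / 2 : ℝ)), (3 * θ - 4 * π, northPole)} ∧
    OrbitCoordinatesAre ![θ, 4 * π / 3, 2 * θ - 2 * π, θ]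
      {(π, angle (π / 2 : ℝ)), (π, angle (3 * π / 2 : ℝ)), (3 * θ - 4 * π, northPole)} ∧
    OrbitCoordinatesAre ![θ, 2 * θ - 2 * π, 4 * π / 3, θ]
      {(π, angle (π / 2 : ℝ)), (π, angle (3 * π / 2 : ℝ)), (6 * π - 3 * θ, southPole)} ∧
    OrbitCoordinatesAre ![2 * θ - 2 * π, θ, θ, 4 * π / 3]
      {(π, angle (π / 2 : ℝ)), (π, angle (3 * π / 2 : ℝ)), (6 * π - 3 * θ, southPole)} := by
  have bA : π < 4 * π / 3 ∧ 4 * π / 3 < 2 * π := ⟨by linarith [pi_pos], by linarith [pi_pos]⟩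
  have bT : π < θ ∧ θ < 2 * π := ⟨by linarith [pi_pos], hθ'⟩
  have bD : π < 2 * θ - 2 * π ∧ 2 * θ - 2 * π < 2 * π :=
    ⟨by linarith [pi_pos], by linarith [pi_pos]⟩
  have nb : 0 < 3 * θ - 4 * π := by linarith
  have nb' : 3 * θ - 4 * π < 2 * π := by linarith
  have sb : 0 < 6 * π - 3 * θ := by linarith
  have sb' : 6 * π - 3 * θ < 2 * π := by linarith [pi_pos]
  have b4 : 0 < 4 * π / 3 := by linarith [pi_pos]
  have b2 : 0 < 2 * π / 3 := by linarith [pi_pos]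
  have b2' : 2 * π / 3 < 2 * π := by linarith [pi_pos]
  have x4 : 2 * cos (4 * π / 3 / 2) = -1 := two_cos_two_pi_div_three
  have x2 : 2 * cos (2 * π / 3 / 2) = 1 := by
    rw [show 2 * π / 3 / 2 = π / 3 by ring, cos_pi_div_three]; norm_num
  have xD := two_cos_half_double (θ := θ)
  have xn := two_cos_north (θ := θ)
  have xs := two_cos_south (θ := θ)
  obtain ⟨-, f0⟩ := triple_bounds hθ hθ'
  have fq := triple_sq_lt hθ hθ'
  have e : ∀ a b c d : ℝ, coef ![a, b, c, d] (-1) = _ := coef_cons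
  set t := 2 * cos (θ / 2)
  have fq' : (3 * t - t ^ 3) ^ 2 < 4 := by
    rwa [show (3 * t - t ^ 3) ^ 2 = (t ^ 3 - 3 * t) ^ 2 by ring]
  refine ⟨(orbitCoordinatesAre_of_cycle_x (.of_coords bA bD bT bT (by linarith)) b4 bA.2
      (x := -2) (y := 3 * t - t ^ 3) (z := t ^ 3 - 3 * t) ?_ ?_ fq' fq).1 (by linarith),
    (orbitCoordinatesAre_of_cycle_x (.of_coords bD bA bT bT (by linarith)) b4 bA.2
      (x := -2) (y := t ^ 3 - 3 * t) (z := 3 * t - t ^ 3) ?_ ?_ fq fq').2 (by linarith),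
    (orbitCoordinatesAre_of_cycle_x (.of_coords bT bT bA bD (by linarith)) b2 b2'
      (x := 2) (y := t ^ 3 - 3 * t) (z := t ^ 3 - 3 * t) ?_ ?_ fq fq).2 (by linarith),
    (orbitCoordinatesAre_of_cycle_x (.of_coords bT bT bD bA (by linarith)) b2 b2'
      (x := 2) (y := 3 * t - t ^ 3) (z := 3 * t - t ^ 3) ?_ ?_ fq' fq').1 (by linarith),
    orbitCoordinatesAre_of_cycle_z (.of_coords bA bT bD bT (by linarith)) nb nb'
      (x := t ^ 3 - 3 * t) (y := 3 * t - t ^ 3) (z := -2) ?_ (.inl ⟨rfl, ?_⟩) xn.symm fq fq',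
    orbitCoordinatesAre_of_cycle_z (.of_coords bT bA bT bD (by linarith)) nb nb'
      (x := t ^ 3 - 3 * t) (y := t ^ 3 - 3 * t) (z := 2) ?_ (.inl ⟨rfl, ?_⟩) xn.symm fq fq,
    orbitCoordinatesAre_of_cycle_z (.of_coords bD bT bA bT (by linarith)) sb sb'
      (x := 3 * t - t ^ 3) (y := t ^ 3 - 3 * t) (z := -2) ?_ (.inr ⟨rfl, ?_⟩) xs.symm fq' fq,
    orbitCoordinatesAre_of_cycle_z (.of_coords bT bD bT bA (by linarith)) sb sb'
      (x := 3 * t - t ^ 3) (y := 3 * t - t ^ 3) (z := 2) ?_ (.inr ⟨rfl, ?_⟩) xs.symm fq' fq',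
    orbitCoordinatesAre_of_cycle_y (.of_coords bA bT bT bD (by linarith)) nb nb'
      (x := t ^ 3 - 3 * t) (y := 2) (z := t ^ 3 - 3 * t) ?_ (.inl ⟨rfl, ?_⟩) xn.symm fq fq,
    orbitCoordinatesAre_of_cycle_y (.of_coords bT bA bD bT (by linarith)) nb nb'
      (x := t ^ 3 - 3 * t) (y := -2) (z := 3 * t - t ^ 3) ?_ (.inl ⟨rfl, ?_⟩) xn.symm fq fq',
    orbitCoordinatesAre_of_cycle_y (.of_coords bT bD bA bT (by linarith)) sb sb'
      (x := 3 * t - t ^ 3) (y := -2) (z := t ^ 3 - 3 * t) ?_ (.inr ⟨rfl, ?_⟩) xs.symm fq' fq,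
    orbitCoordinatesAre_of_cycle_y (.of_coords bD bT bT bA (by linarith)) sb sb'
      (x := 3 * t - t ^ 3) (y := 2) (z := 3 * t - t ^ 3) ?_ (.inr ⟨rfl, ?_⟩) xs.symm fq' fq'⟩
  all_goals first
    | (rw [e, x4, xD]
       refine congrArg₂ _ ?_ (congrArg₂ _ ?_ (congrArg₂ _ ?_ rfl)) <;> ring)
    | (rw [x4]; ring)
    | (rw [x2]; ring)
    | (simp only [Matrix.cons_val]; ring)

end PuncturedSphere

end

noncomputable section
namespace PuncturedSphere
open SphereGroup

/-! ### The free product of cyclic groups of order two and three -/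

/-- The homomorphism from a cyclic group with a prescribed value on the generator. -/
def zmodHom {G : Type*} [Group G] (n : ℕ) (g : G) (hg : g ^ n = 1) : Multiplicative (ZMod n) →* G :=
  AddMonoidHom.toMultiplicativeLeft (ZMod.lift n ⟨zmultiplesHom (Additive G) (Additive.ofMul g), by
    simpa using congrArg Additive.ofMul hg⟩)

theorem zmodHom_one {G : Type*} [Group G] {n : ℕ} {g : G} (hg : g ^ n = 1) :
    zmodHom n g hg (Multiplicative.ofAdd 1) = g := by
  have := ZMod.lift_coe n ⟨zmultiplesHom (Additive G) (Additive.ofMul g), by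
    simpa using congrArg Additive.ofMul hg⟩ 1
  simp only [Int.cast_one, zmultiplesHom_apply, one_smul] at this
  exact congrArg Additive.toMul this

/-- The free product of cyclic groups of order `2` and `3`. -/
abbrev ModularProduct : Type := Monoid.CoprodI fun i : Fin 2 => Multiplicative (ZMod (i.val + 2))

namespace ModularProduct

/-- The generator of order two. -/
def s : ModularProduct := Monoid.CoprodI.of (i := (0 : Fin 2)) (Multiplicative.ofAdd 1)

/-- The generator of order three. -/
def r : ModularProduct := Monoid.CoprodI.of (i := (1 : Fin 2)) (Multiplicative.ofAdd 1)

/-- The homomorphism with prescribed values on the generators. -/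
def lift {G : Type*} [Group G] (g : Fin 2 → G) (hg : ∀ i : Fin 2, g i ^ (i.val + 2) = 1) :
    ModularProduct →* G :=
  Monoid.CoprodI.lift fun i => zmodHom (i.val + 2) (g i) (hg i)

variable {G : Type*} [Group G] (g : Fin 2 → G) (hg : ∀ i : Fin 2, g i ^ (i.val + 2) = 1)

@[simp] theorem lift_s : lift g hg s = g 0 :=
  (Monoid.CoprodI.lift_of _ _).trans (zmodHom_one (hg 0))

@[simp] theorem lift_r : lift g hg r = g 1 :=
  (Monoid.CoprodI.lift_of _ _).trans (zmodHom_one (hg 1))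

theorem s_sq : s * s = 1 := by
  rw [s, ← map_mul, ← map_one (Monoid.CoprodI.of (M := fun i : Fin 2 =>
    Multiplicative (ZMod (i.val + 2))) (i := 0))]
  congr 1

theorem r_cube : r * r * r = 1 := by
  rw [r, ← map_mul, ← map_mul, ← map_one (Monoid.CoprodI.of (M := fun i : Fin 2 =>
    Multiplicative (ZMod (i.val + 2))) (i := 1))]
  congr 1

/-- The action of the modular group on the upper half-plane. -/
abbrev modularPerm : SL(2, ℤ) →* Equiv.Perm ℍ := MulAction.toPermHom SL(2, ℤ) ℍ

theorem modularPerm_neg (A : SL(2, ℤ)) : modularPerm (-A) = modularPerm A := by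
  ext1 z
  exact ModularGroup.SL_neg_smul A z

theorem modular_pow (i : Fin 2) : (![modularPerm ModularGroup.S,
    modularPerm (ModularGroup.T * ModularGroup.S)⁻¹] : Fin 2 → Equiv.Perm ℍ) i ^ (i.val + 2) = 1 := by
  fin_cases i
  · change modularPerm ModularGroup.S ^ 2 = 1
    rw [← map_pow, show ModularGroup.S ^ 2 = -1 by decide, modularPerm_neg, map_one]
  · change modularPerm (ModularGroup.T * ModularGroup.S)⁻¹ ^ 3 = 1
    rw [← map_pow, show ((ModularGroup.T * ModularGroup.S)⁻¹) ^ 3 = -1 by decide,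
      modularPerm_neg, map_one]

/-- The action of the free product on the upper half-plane. -/
def perm : ModularProduct →* Equiv.Perm ℍ := lift _ modular_pow

theorem re_S_smul (z : ℍ) : (ModularGroup.S • z).re = -z.re / Complex.normSq z := by
  rw [UpperHalfPlane.modular_S_smul, ← UpperHalfPlane.coe_re, ← UpperHalfPlane.coe_re,
    UpperHalfPlane.coe_mk, Complex.inv_re, Complex.normSq_neg, Complex.neg_re]

theorem re_T_smul (z : ℍ) : (ModularGroup.T • z).re = 1 + z.re := by
  rw [UpperHalfPlane.modular_T_smul]
  simp

theorem modularPerm_generator_apply (i : Fin 2) (z : ℍ) :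
    zmodHom (i.val + 2) _ (modular_pow i) (Multiplicative.ofAdd 1) z =
      (![ModularGroup.S, (ModularGroup.T * ModularGroup.S)⁻¹] : Fin 2 → SL(2, ℤ)) i • z := by
  rw [zmodHom_one]
  fin_cases i <;> rfl

/-- Ping-pong on the two halves of the plane cut by the imaginary axis: S maps the right half into
the left one, and both nontrivial powers of (TS)⁻¹ map the left half into the right one. -/
theorem perm_injective : Function.Injective perm := by
  refine Monoid.CoprodI.lift_injective_of_ping_pong (α := ℍ) _ ?_
    ![{z : ℍ | z.re < 0}, {z : ℍ | 0 < z.re}] ?_ ?_ ?_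
  -- With only two factors, ping-pong needs a factor with at least three elements; it is the cyclic
  -- group of order three.
  · right
    exact ⟨1, by rw [Cardinal.mk_fintype]; simp⟩
  · intro i
    fin_cases i
    · exact ⟨UpperHalfPlane.mk ⟨-1, 1⟩ one_pos, show (-1 : ℝ) < 0 by norm_num⟩
    · exact ⟨UpperHalfPlane.mk ⟨1, 1⟩ one_pos, show (0 : ℝ) < 1 by norm_num⟩
  · have key : Disjoint {z : ℍ | z.re < 0} {z : ℍ | 0 < z.re} :=
      Set.disjoint_left.2 fun z (h : z.re < 0) (h' : 0 < z.re) => lt_asymm h h'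
    intro i j hij
    fin_cases i <;> fin_cases j
    exacts [absurd rfl hij, key, key.symm, absurd rfl hij]
  · intro i j hij h hne
    have nz : ∀ z : ℍ, 0 < Complex.normSq z := fun z => UpperHalfPlane.normSq_pos z
    fin_cases i <;> fin_cases j
    · exact absurd rfl hij
    · obtain rfl : h = Multiplicative.ofAdd (1 : ZMod 2) := by
        revert hne h; decide
      rintro _ ⟨z, hz, rfl⟩
      refine (congrArg UpperHalfPlane.re (modularPerm_generator_apply 0 z)).trans_lt ?_
      change (ModularGroup.S • z).re < 0
      rw [re_S_smul]
      exact div_neg_of_neg_of_pos (neg_neg_of_pos hz) (nz z)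
    · have e : h = Multiplicative.ofAdd (1 : ZMod 3) ∨
          h = Multiplicative.ofAdd (1 : ZMod 3) * Multiplicative.ofAdd (1 : ZMod 3) := by
        revert hne h; decide
      rintro _ ⟨z, hz, rfl⟩
      have hz' : z.re < 0 := hz
      rcases e with rfl | rfl
      · refine lt_of_lt_of_eq ?_ (congrArg UpperHalfPlane.re (modularPerm_generator_apply 1 z)).symm
        change 0 < ((ModularGroup.T * ModularGroup.S)⁻¹ • z).re
        rw [show (ModularGroup.T * ModularGroup.S)⁻¹ = -(ModularGroup.S * ModularGroup.T⁻¹) by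
          decide, ModularGroup.SL_neg_smul, mul_smul, re_S_smul]
        refine div_pos ?_ (nz _)
        have := re_T_smul (ModularGroup.T⁻¹ • z)
        rw [smul_inv_smul] at this
        linarith
      · have e2 : zmodHom 3 _ (modular_pow 1) (Multiplicative.ofAdd 1 * Multiplicative.ofAdd 1) z =
            (ModularGroup.T * ModularGroup.S)⁻¹ • (ModularGroup.T * ModularGroup.S)⁻¹ • z := by
          rw [map_mul]
          exact (modularPerm_generator_apply 1 _).trans
            (congrArg _ (modularPerm_generator_apply 1 z))
        refine lt_of_lt_of_eq ?_ (congrArg UpperHalfPlane.re e2).symm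
        rw [← mul_smul, show (ModularGroup.T * ModularGroup.S)⁻¹ *
            (ModularGroup.T * ModularGroup.S)⁻¹ = -(ModularGroup.T * ModularGroup.S) by decide,
          ModularGroup.SL_neg_smul, mul_smul, re_T_smul, re_S_smul]
        have := div_pos (neg_pos.2 hz') (nz z)
        linarith
    · exact absurd rfl hij

theorem exists_perm_eq (A : SL(2, ℤ)) : ∃ x : ModularProduct, perm x = modularPerm A := by
  have hS : perm s = modularPerm ModularGroup.S := lift_s _ _
  have hR : perm r = modularPerm (ModularGroup.T * ModularGroup.S)⁻¹ := lift_r _ _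
  have hT : perm (r⁻¹ * s⁻¹) = modularPerm ModularGroup.T := by
    rw [map_mul, map_inv, map_inv, hS, hR, map_inv, inv_inv, map_mul, mul_inv_cancel_right]
  have h : A ∈ Subgroup.closure {ModularGroup.S, ModularGroup.T} := by
    rw [SpecialLinearGroup.SL2Z_generators]; trivial
  change A ∈ perm.range.comap modularPerm
  refine (Subgroup.closure_le _).2 ?_ h
  rintro B (rfl | rfl)
  exacts [⟨_, hS⟩, ⟨_, hT⟩]

end ModularProduct

end PuncturedSphere

end

noncomputable section
namespace PuncturedSphere
open SphereGroup

/-! ### Quadruples of integral matrices -/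

/-- The peripheral elements of an integral representation of the free group of rank three. -/
def modularMat : Fin 4 → SL(2, ℤ) :=
  ![⟨!![-1, 1; -1, 0], by decide⟩, ⟨!![-1, 1; 0, -1], by decide⟩, ⟨!![-1, 0; -1, -1], by decide⟩,
    ⟨!![-1, 2; 0, -1], by decide⟩]

theorem modularMat_prod : modularMat 0 * modularMat 1 * modularMat 2 * modularMat 3 = -1 := by
  decide

theorem sq_le_one_of_form_le {k l : ℤ} (h : k ^ 2 + k * l + l ^ 2 ≤ 1) :
    (-1 ≤ k ∧ k ≤ 1) ∧ (-1 ≤ l ∧ l ≤ 1) := by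
  refine ⟨⟨?_, ?_⟩, ⟨?_, ?_⟩⟩ <;>
    nlinarith [sq_nonneg (2 * k + l), sq_nonneg (2 * l + k)]

/-- The matrix is -1 plus a nilpotent matrix of rank one, so its conjugates depend only on one
column of h. The same holds for the next two. -/
theorem conj_entries_one (h : SL(2, ℤ)) :
    (h * modularMat 1 * h⁻¹) 0 0 = -1 - h 0 0 * h 1 0 ∧ (h * modularMat 1 * h⁻¹) 0 1 = h 0 0 ^ 2 ∧
    (h * modularMat 1 * h⁻¹) 1 0 = -h 1 0 ^ 2 ∧
    (h * modularMat 1 * h⁻¹) 1 1 = -1 + h 0 0 * h 1 0 := by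
  have hd := det_eq h
  simp only [mul_00, mul_01, mul_10, mul_11, inv_00, inv_01, inv_10, inv_11]
  simp only [modularMat, Matrix.cons_val, Matrix.SpecialLinearGroup.coe_mk, Matrix.of_apply]
  refine ⟨?_, ?_, ?_, ?_⟩ <;> first | ring1 | linear_combination -hd

theorem conj_entries_two (h : SL(2, ℤ)) :
    (h * modularMat 2 * h⁻¹) 0 0 = -1 - h 0 1 * h 1 1 ∧ (h * modularMat 2 * h⁻¹) 0 1 = h 0 1 ^ 2 ∧
    (h * modularMat 2 * h⁻¹) 1 0 = -h 1 1 ^ 2 ∧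
    (h * modularMat 2 * h⁻¹) 1 1 = -1 + h 0 1 * h 1 1 := by
  have hd := det_eq h
  simp only [mul_00, mul_01, mul_10, mul_11, inv_00, inv_01, inv_10, inv_11]
  simp only [modularMat, Matrix.cons_val, Matrix.SpecialLinearGroup.coe_mk, Matrix.of_apply]
  refine ⟨?_, ?_, ?_, ?_⟩ <;> first | ring1 | linear_combination -hd

theorem conj_entries_three (h : SL(2, ℤ)) :
    (h * modularMat 3 * h⁻¹) 0 0 = -1 - 2 * (h 0 0 * h 1 0) ∧
    (h * modularMat 3 * h⁻¹) 0 1 = 2 * h 0 0 ^ 2 ∧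
    (h * modularMat 3 * h⁻¹) 1 0 = -2 * h 1 0 ^ 2 ∧
    (h * modularMat 3 * h⁻¹) 1 1 = -1 + 2 * (h 0 0 * h 1 0) := by
  have hd := det_eq h
  simp only [mul_00, mul_01, mul_10, mul_11, inv_00, inv_01, inv_10, inv_11]
  simp only [modularMat, Matrix.cons_val, Matrix.SpecialLinearGroup.coe_mk, Matrix.of_apply]
  refine ⟨?_, ?_, ?_, ?_⟩ <;> first | ring1 | linear_combination -hd


/-- The form k² - kl + l² is invariant under `modularMat 0`, of order three. It has six integral
vectors of value 1, three up to sign, and these are permuted cyclically. -/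
theorem exists_conj_modularMat_three {h A : SL(2, ℤ)} (hA : A = h * modularMat 3 * h⁻¹)
    (hQ : h 0 0 ^ 2 - h 0 0 * h 1 0 + h 1 0 ^ 2 ≤ 1) :
    ∃ n : ℕ, A = modularMat 0 ^ n * modularMat 3 * (modularMat 0 ^ n)⁻¹ := by
  obtain ⟨e0, e1, e2, e3⟩ := conj_entries_three h
  rw [← hA] at e0 e1 e2 e3
  have hd := det_eq h
  generalize h 0 0 = k at *
  generalize h 1 0 = l at *
  obtain ⟨⟨k1, k2⟩, l1, l2⟩ := sq_le_one_of_form_le (k := k) (l := -l) (by linarith [hQ])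
  have l1' : -1 ≤ l := by linarith
  have l2' : l ≤ 1 := by linarith
  have key : ∀ n : ℕ, ∀ B, B = modularMat 0 ^ n * modularMat 3 * (modularMat 0 ^ n)⁻¹ →
      A 0 0 = B 0 0 → A 0 1 = B 0 1 → A 1 0 = B 1 0 → A 1 1 = B 1 1 →
      ∃ n : ℕ, A = modularMat 0 ^ n * modularMat 3 * (modularMat 0 ^ n)⁻¹ :=
    fun n B hB h0 h1 h2 h3 => ⟨n, (sl_ext h0 h1 h2 h3).trans hB⟩
  interval_cases k <;> interval_cases l
  · refine key 1 _ rfl ?_ ?_ ?_ ?_ <;> (first | rw [e0] | rw [e1] | rw [e2] | rw [e3]) <;> decide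
  · refine key 0 _ rfl ?_ ?_ ?_ ?_ <;> (first | rw [e0] | rw [e1] | rw [e2] | rw [e3]) <;> decide
  · norm_num at hQ
  · refine key 2 _ rfl ?_ ?_ ?_ ?_ <;> (first | rw [e0] | rw [e1] | rw [e2] | rw [e3]) <;> decide
  · norm_num at hd
  · refine key 2 _ rfl ?_ ?_ ?_ ?_ <;> (first | rw [e0] | rw [e1] | rw [e2] | rw [e3]) <;> decide
  · norm_num at hQ
  · refine key 0 _ rfl ?_ ?_ ?_ ?_ <;> (first | rw [e0] | rw [e1] | rw [e2] | rw [e3]) <;> decide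
  · refine key 1 _ rfl ?_ ?_ ?_ ?_ <;> (first | rw [e0] | rw [e1] | rw [e2] | rw [e3]) <;> decide

/-- The same argument with the form k² + kl + l², invariant under `modularMat 1 * modularMat 2`,
whose cube is -1. -/
theorem exists_conj_modularMat_one {h A : SL(2, ℤ)} (hA : A = h * modularMat 1 * h⁻¹)
    (hQ : h 0 0 ^ 2 + h 0 0 * h 1 0 + h 1 0 ^ 2 ≤ 1) :
    ∃ n : ℕ, n < 3 ∧ A = (modularMat 1 * modularMat 2) ^ n * modularMat 1 *
      ((modularMat 1 * modularMat 2) ^ n)⁻¹ := by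
  obtain ⟨e0, e1, e2, e3⟩ := conj_entries_one h
  rw [← hA] at e0 e1 e2 e3
  have hd := det_eq h
  generalize h 0 0 = k at *
  generalize h 1 0 = l at *
  obtain ⟨⟨k1, k2⟩, l1, l2⟩ := sq_le_one_of_form_le hQ
  have key : ∀ n : ℕ, n < 3 → ∀ B, B = (modularMat 1 * modularMat 2) ^ n * modularMat 1 *
        ((modularMat 1 * modularMat 2) ^ n)⁻¹ →
      A 0 0 = B 0 0 → A 0 1 = B 0 1 → A 1 0 = B 1 0 → A 1 1 = B 1 1 →
      ∃ n : ℕ, n < 3 ∧ A = (modularMat 1 * modularMat 2) ^ n * modularMat 1 *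
        ((modularMat 1 * modularMat 2) ^ n)⁻¹ :=
    fun n hn B hB h0 h1 h2 h3 => ⟨n, hn, (sl_ext h0 h1 h2 h3).trans hB⟩
  interval_cases k <;> interval_cases l
  · norm_num at hQ
  · refine key 0 (by decide) _ rfl ?_ ?_ ?_ ?_ <;>
      (first | rw [e0] | rw [e1] | rw [e2] | rw [e3]) <;> decide
  · refine key 2 (by decide) _ rfl ?_ ?_ ?_ ?_ <;>
      (first | rw [e0] | rw [e1] | rw [e2] | rw [e3]) <;> decide
  · refine key 1 (by decide) _ rfl ?_ ?_ ?_ ?_ <;>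
      (first | rw [e0] | rw [e1] | rw [e2] | rw [e3]) <;> decide
  · norm_num at hd
  · refine key 1 (by decide) _ rfl ?_ ?_ ?_ ?_ <;>
      (first | rw [e0] | rw [e1] | rw [e2] | rw [e3]) <;> decide
  · refine key 2 (by decide) _ rfl ?_ ?_ ?_ ?_ <;>
      (first | rw [e0] | rw [e1] | rw [e2] | rw [e3]) <;> decide
  · refine key 0 (by decide) _ rfl ?_ ?_ ?_ ?_ <;>
      (first | rw [e0] | rw [e1] | rw [e2] | rw [e3]) <;> decide
  · norm_num at hQ

theorem inv_conj_mul_of_commute {G : Type*} [Group G] {a b D : G}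
    (h : D * (a * b) = a * b * D) : (D * a * D⁻¹)⁻¹ * (a * b) = D * b * D⁻¹ := by
  rw [inv_mul_eq_iff_eq_mul]
  calc a * b = a * b * D * D⁻¹ := by group
    _ = D * (a * b) * D⁻¹ := by rw [h]
    _ = _ := by group

theorem mul_eq_mul_of_outer_eq {G : Type*} [Group G] {a x y z p q : G}
    (h : a * x * y * z = a * p * q * z) : x * y = p * q := by
  have h' := mul_right_cancel h
  rw [mul_assoc, mul_assoc] at h'
  exact mul_left_cancel h'

/-- Quadruples conjugate termwise to the standard one, with the same product. -/
theorem exists_conj_of_isConj {A : Fin 4 → SL(2, ℤ)} (hA : ∀ i, IsConj (modularMat i) (A i))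
    (hp : A 0 * A 1 * A 2 * A 3 = -1) : ∃ w : SL(2, ℤ), ∃ n : ℕ, n < 3 ∧
      A 0 = w * modularMat 0 * w⁻¹ ∧
      A 1 = w * ((modularMat 1 * modularMat 2) ^ n * modularMat 1 *
        ((modularMat 1 * modularMat 2) ^ n)⁻¹) * w⁻¹ ∧
      A 2 = w * ((modularMat 1 * modularMat 2) ^ n * modularMat 2 *
        ((modularMat 1 * modularMat 2) ^ n)⁻¹) * w⁻¹ := by
  choose g hg using fun i => isConj_iff.1 (hA i)
  -- normalise the first matrix
  have hp1 : modularMat 0 * ((g 0)⁻¹ * A 1 * g 0) * ((g 0)⁻¹ * A 2 * g 0) *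
      ((g 0)⁻¹ * A 3 * g 0) = -1 := by
    have : (g 0)⁻¹ * (A 0 * A 1 * A 2 * A 3) * g 0 = -1 := by rw [hp]; simp
    rw [← this, ← hg 0]
    group
  have hB : ∀ i, ∃ h : SL(2, ℤ), (g 0)⁻¹ * A i * g 0 = h * modularMat i * h⁻¹ := fun i =>
    ⟨(g 0)⁻¹ * g i, by rw [← hg i]; group⟩
  obtain ⟨h1, e1⟩ := hB 1
  obtain ⟨h2, e2⟩ := hB 2
  obtain ⟨h3, e3⟩ := hB 3
  rw [e1, e2, e3] at hp1
  -- Comparing traces, 2Q - 1 = 2 - e², where Q is the form and e is the determinant of the two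
  -- fixed vectors of the middle matrices. Integrality turns Q ≤ 3/2 into Q ≤ 1.
  have hQ : h3 0 0 ^ 2 - h3 0 0 * h3 1 0 + h3 1 0 ^ 2 ≤ 1 := by
    have hp2 : (h1 * modularMat 1 * h1⁻¹) * (h2 * modularMat 2 * h2⁻¹) =
        -((modularMat 0)⁻¹ * (h3 * modularMat 3 * h3⁻¹)⁻¹) := by
      have : (h1 * modularMat 1 * h1⁻¹) * (h2 * modularMat 2 * h2⁻¹) =
          (modularMat 0)⁻¹ * (-1) * (h3 * modularMat 3 * h3⁻¹)⁻¹ := by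
        rw [← hp1]; group
      rw [this]; simp
    have t0 := congrArg (fun M : SL(2, ℤ) => M 0 0 + M 1 1) hp2
    obtain ⟨a0, a1, a2, a3⟩ := conj_entries_one h1
    obtain ⟨b0, b1, b2, b3⟩ := conj_entries_two h2
    obtain ⟨c0, c1, c2, c3⟩ := conj_entries_three h3
    generalize h1 * modularMat 1 * h1⁻¹ = B1 at *
    generalize h2 * modularMat 2 * h2⁻¹ = B2 at *
    generalize h3 * modularMat 3 * h3⁻¹ = B3 at *
    simp only [mul_00, mul_11, inv_00, inv_01, inv_10, inv_11, neg_app, a0, a1, a2, a3, b0, b1, b2,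
      b3, c0, c1, c2, c3] at t0
    simp only [modularMat, Matrix.cons_val, Matrix.SpecialLinearGroup.coe_mk, Matrix.of_apply] at t0
    nlinarith [sq_nonneg (h1 0 0 * h2 1 1 - h1 1 0 * h2 0 1)]
  obtain ⟨m, hm⟩ := exists_conj_modularMat_three rfl hQ
  -- normalise the last matrix
  set v := modularMat 0 ^ m with hv
  have hc0 : v⁻¹ * modularMat 0 * v = modularMat 0 := by
    rw [hv, mul_assoc, ← pow_succ', pow_succ, inv_mul_cancel_left]
  have hp3 : modularMat 0 * (v⁻¹ * (h1 * modularMat 1 * h1⁻¹) * v) *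
      (v⁻¹ * (h2 * modularMat 2 * h2⁻¹) * v) * modularMat 3 = -1 := by
    have : v⁻¹ * (modularMat 0 * (h1 * modularMat 1 * h1⁻¹) * (h2 * modularMat 2 * h2⁻¹) *
      (h3 * modularMat 3 * h3⁻¹)) * v = -1 := by rw [hp1]; simp
    rw [← this, hm]
    nth_rewrite 1 [← hc0]
    group
  have hp4 : (v⁻¹ * (h1 * modularMat 1 * h1⁻¹) * v) * (v⁻¹ * (h2 * modularMat 2 * h2⁻¹) * v) =
      modularMat 1 * modularMat 2 := 
    mul_eq_mul_of_outer_eq (hp3.trans modularMat_prod.symm)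
  have hf1 : v⁻¹ * (h1 * modularMat 1 * h1⁻¹) * v = (v⁻¹ * h1) * modularMat 1 * (v⁻¹ * h1)⁻¹ := by
    group
  have hf2 : v⁻¹ * (h2 * modularMat 2 * h2⁻¹) * v = (v⁻¹ * h2) * modularMat 2 * (v⁻¹ * h2)⁻¹ := by
    group
  have hp5 : v⁻¹ * (h2 * modularMat 2 * h2⁻¹) * v =
      (v⁻¹ * (h1 * modularMat 1 * h1⁻¹) * v)⁻¹ * (modularMat 1 * modularMat 2) := by
    rw [← hp4, inv_mul_cancel_left]
  -- The third matrix has trace -2; writing it as the inverse of the second times the known product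
  -- shows that the form equals 1.
  have hQ' : (v⁻¹ * h1) 0 0 ^ 2 + (v⁻¹ * h1) 0 0 * (v⁻¹ * h1) 1 0 + (v⁻¹ * h1) 1 0 ^ 2 ≤ 1 := by
    rw [hf2, hf1] at hp5
    have t0 := congrArg (fun M : SL(2, ℤ) => M 0 0 + M 1 1) hp5
    obtain ⟨a0, a1, a2, a3⟩ := conj_entries_one (v⁻¹ * h1)
    obtain ⟨b0, b1, b2, b3⟩ := conj_entries_two (v⁻¹ * h2)
    generalize v⁻¹ * h1 = k1 at *
    generalize v⁻¹ * h2 = k2 at *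
    generalize k1 * modularMat 1 * k1⁻¹ = B1 at *
    generalize k2 * modularMat 2 * k2⁻¹ = B2 at *
    simp only [mul_00, mul_01, mul_10, mul_11, inv_00, inv_01, inv_10, inv_11, a0, a1, a2, a3,
      b0, b3] at t0
    simp only [modularMat, Matrix.cons_val, Matrix.SpecialLinearGroup.coe_mk, Matrix.of_apply] at t0
    linarith
  obtain ⟨n, hn, e⟩ := exists_conj_modularMat_one hf1 hQ'
  refine ⟨g 0 * v, n, hn, ?_, ?_, ?_⟩
  · rw [← hg 0]
    have : g 0 * v * modularMat 0 * (g 0 * v)⁻¹ =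
      g 0 * (v * (v⁻¹ * modularMat 0 * v) * v⁻¹) * (g 0)⁻¹ := by rw [hc0]; group
    rw [this]
    group
  · rw [← e, ← e1]; group
  · rw [← inv_conj_mul_of_commute (pow_mul_comm' _ n), ← e, ← hp5, ← e2]; group

end PuncturedSphere

end

noncomputable section
namespace PuncturedSphere
open SphereGroup

/-! ### Pure automorphisms and the free product -/

theorem twistY_c (i : Fin 4) : twistY (c i) = (![c 0, (c 1 * c 2) * c 1 * (c 1 * c 2)⁻¹,
    (c 1 * c 2) * c 2 * (c 1 * c 2)⁻¹, c 3] : Fin 4 → SphereGroup) i := by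
  simp only [twistY, sphereAut_apply, sphereHom_c]

theorem twistY_pow_c (n : ℕ) : (twistY ^ n) (c 0) = c 0 ∧
    (twistY ^ n) (c 1) = (c 1 * c 2) ^ n * c 1 * ((c 1 * c 2) ^ n)⁻¹ ∧
    (twistY ^ n) (c 2) = (c 1 * c 2) ^ n * c 2 * ((c 1 * c 2) ^ n)⁻¹ := by
  have h0 : twistY (c 0) = c 0 := twistY_c 0
  have h1 : twistY (c 1) = (c 1 * c 2) * c 1 * (c 1 * c 2)⁻¹ := twistY_c 1
  have h2 : twistY (c 2) = (c 1 * c 2) * c 2 * (c 1 * c 2)⁻¹ := twistY_c 2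
  have h12 : twistY (c 1 * c 2) = c 1 * c 2 := by rw [map_mul, h1, h2]; group
  induction n with
  | zero => simp
  | succ n ih =>
    simp only [pow_succ' twistY, MulAut.mul_apply, ih, map_mul, map_inv, map_pow, h0]
    rw [← map_mul, h12, h1, h2, pow_succ]
    exact ⟨trivial, by group, by group⟩

namespace ModularProduct

/-- The representation of the fundamental group in the free product. -/
def peripheral : SphereGroup →* ModularProduct :=
  sphereHom ![r⁻¹, s * r, r * s, s * r * (s * r)] (by
    simp only [Matrix.cons_val]
    calc r⁻¹ * (s * r) * (r * s) * (s * r * (s * r)) =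
        r⁻¹ * s * r * r * (s * s) * r * s * r := by group
      _ = r⁻¹ * s * (r * r * r) * s * r := by rw [s_sq]; group
      _ = r⁻¹ * (s * s) * r := by rw [r_cube]; group
      _ = 1 := by rw [s_sq]; group)

/-- The integral lift of the representation. -/
def integral : SphereGroup →* SL(2, ℤ) :=
  sphereHom ![modularMat 0, modularMat 1, modularMat 2, -modularMat 3] (by decide)

theorem modularPerm_eq {A B : SL(2, ℤ)} (h : A = B ∨ A = -B) : modularPerm A = modularPerm B := by
  rcases h with rfl | rfl
  exacts [rfl, modularPerm_neg B]

theorem perm_peripheral (x : SphereGroup) : perm (peripheral x) = modularPerm (integral x) := by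
  have hS : perm s = modularPerm ModularGroup.S := lift_s _ _
  have hR : perm r = modularPerm (ModularGroup.T * ModularGroup.S)⁻¹ := lift_r _ _
  suffices perm.comp peripheral = modularPerm.comp integral from DFunLike.congr_fun this x
  apply sphereHom_ext
  intro i
  simp only [MonoidHom.comp_apply, peripheral, integral, sphereHom_c]
  fin_cases i
  · change perm r⁻¹ = modularPerm (modularMat 0)
    rw [map_inv, hR, ← map_inv]
    exact modularPerm_eq (by decide)
  · change perm (s * r) = modularPerm (modularMat 1)
    rw [map_mul, hR, hS, ← map_mul]
    exact modularPerm_eq (by decide)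
  · change perm (r * s) = modularPerm (modularMat 2)
    rw [map_mul, hR, hS, ← map_mul]
    exact modularPerm_eq (by decide)
  · change perm (s * r * (s * r)) = modularPerm (-modularMat 3)
    rw [map_mul, map_mul, hR, hS, ← map_mul, ← map_mul]
    exact modularPerm_eq (by decide)

theorem isConj_neg {A B : SL(2, ℤ)} (h : IsConj A B) : IsConj (-A) (-B) := by
  obtain ⟨w, rfl⟩ := isConj_iff.1 h
  exact isConj_iff.2 ⟨w, by simp⟩

/-- In the free product, pure automorphisms act as powers of a single Dehn twist. -/
theorem peripheral_pureAut {φ : MulAut SphereGroup} (hφ : φ ∈ PureAut) :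
    ∃ w : ModularProduct, ∃ n : ℕ, n < 3 ∧
      ∀ x, peripheral (φ x) = w * peripheral ((twistY ^ n) x) * w⁻¹ := by
  have hc : ∀ i, integral (c i) =
      (![modularMat 0, modularMat 1, modularMat 2, -modularMat 3] : Fin 4 → SL(2, ℤ)) i := fun i => by
    rw [integral, sphereHom_c]
  have hconj : ∀ i, IsConj (integral (c i)) (integral (φ (c i))) := fun i =>
    integral.map_isConj (hφ i)
  -- The integral lift uses `-modularMat 3` in order to respect the relation; the sign is undone
  -- here to match the standard quadruple.
  obtain ⟨w, n, hn, e0, e1, e2⟩ := exists_conj_of_isConj (A := ![integral (φ (c 0)),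
    integral (φ (c 1)), integral (φ (c 2)), -integral (φ (c 3))]) (by
      intro i
      have h := hconj i
      rw [hc] at h
      fin_cases i
      exacts [h, h, h, by simpa using isConj_neg h]) (by
      simp only [Matrix.cons_val]
      rw [mul_neg, ← map_mul, ← map_mul, ← map_mul, ← map_mul, ← map_mul, ← map_mul, c_prod,
        map_one, map_one])
  simp only [Matrix.cons_val] at e0 e1 e2
  obtain ⟨t0, t1, t2⟩ := twistY_pow_c n
  have hw : ∀ x, integral (φ x) = w * integral ((twistY ^ n) x) * w⁻¹ := by
    have : integral.comp φ.toMonoidHom =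
        (MulAut.conj w).toMonoidHom.comp (integral.comp (twistY ^ n).toMonoidHom) := by
      have hi : ∀ i : Fin 4, i ≠ 3 → integral (φ (c i)) = w * integral ((twistY ^ n) (c i)) * w⁻¹ := by
        intro i hi
        have hc0 := hc 0
        have hc1 := hc 1
        have hc2 := hc 2
        simp only [Matrix.cons_val] at hc0 hc1 hc2
        fin_cases i
        · change integral (φ (c 0)) = w * integral ((twistY ^ n) (c 0)) * w⁻¹
          rw [e0, t0, hc0]
        · change integral (φ (c 1)) = w * integral ((twistY ^ n) (c 1)) * w⁻¹
          rw [e1, t1]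
          simp only [map_mul, map_inv, map_pow, hc1, hc2]
        · change integral (φ (c 2)) = w * integral ((twistY ^ n) (c 2)) * w⁻¹
          rw [e2, t2]
          simp only [map_mul, map_inv, map_pow, hc1, hc2]
        · exact absurd rfl hi
      apply sphereHom_ext
      intro i
      change integral (φ (c i)) = w * integral ((twistY ^ n) (c i)) * w⁻¹
      by_cases h3 : i = 3
      · subst h3
        rw [c_three]
        simp only [map_mul, map_inv, hi 0 (by decide), hi 1 (by decide), hi 2 (by decide)]
        group
      · exact hi i h3
    exact fun x => DFunLike.congr_fun this x
  -- The conjugator lives in SL(2, ℤ). It acts on ℍ as an element of the free product, and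
  -- faithfulness of that action brings the identity back.
  obtain ⟨u, hu⟩ := exists_perm_eq w
  refine ⟨u, n, hn, fun x => perm_injective ?_⟩
  rw [map_mul, map_mul, map_inv, perm_peripheral, perm_peripheral, hw, hu, map_mul, map_mul, map_inv]

end ModularProduct

end PuncturedSphere

end

noncomputable section
namespace PuncturedSphere
open SphereGroup

/-! ### The representation with image a triangle group -/

variable {θ : ℝ}

theorem rotAt_two_pi (z : ℍ) : rotAt (2 * π) z = -1 := by
  have e : 2 * π / 2 = π := by ring
  apply sl_ext <;> simp [e]

theorem rotAt_pi_sq (z : ℍ) : rotAt π z * rotAt π z = -1 := by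
  rw [rotAt_mul_same, ← two_mul, rotAt_two_pi]

theorem rotAt_third_cube (z : ℍ) :
    rotAt (2 * π / 3) z * rotAt (2 * π / 3) z * rotAt (2 * π / 3) z = -1 := by
  rw [rotAt_mul_same, rotAt_mul_same, ← rotAt_two_pi z]
  congr 1
  ring

theorem rotAt_third_inv (z : ℍ) : rotAt (4 * π / 3) z = -(rotAt (2 * π / 3) z)⁻¹ := by
  have h : rotAt (4 * π / 3) z * rotAt (2 * π / 3) z = -1 := by
    rw [rotAt_mul_same, ← rotAt_two_pi z]
    congr 1
    ring
  rw [eq_mul_inv_of_mul_eq h, neg_mul, one_mul]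

theorem rotAt_sub_two_pi (φ : ℝ) (z : ℍ) : rotAt (φ - 2 * π) z = -rotAt φ z := by
  have h : rotAt (φ - 2 * π) z * rotAt (2 * π) z = rotAt φ z := by
    rw [rotAt_mul_same, sub_add_cancel]
  rw [rotAt_two_pi] at h
  rw [← h]
  simp

theorem exists_hv_add_hw {b : ℝ} (hb : 1 ≤ b) : ∃ q : ℍ, hu q = 0 ∧ hv q + hw q = 2 * b := by
  have hs : √(b ^ 2 - 1) ^ 2 = b ^ 2 - 1 := Real.sq_sqrt (by nlinarith)
  have hy : 0 < b + √(b ^ 2 - 1) := by positivity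
  refine ⟨UpperHalfPlane.mk ⟨0, b + √(b ^ 2 - 1)⟩ hy, ?_, ?_⟩
  · simp [hu]
  · simp only [hv, hw, UpperHalfPlane.mk_re, UpperHalfPlane.mk_im]
    field_simp
    linear_combination hs

/-- Rotations of angles `π` and `2π/3` whose product is a rotation of angle `θ`. -/
theorem exists_rotAt_mul_eq (hθ : 5 * π / 3 < θ) (hθ' : θ < 2 * π) :
    ∃ q z : ℍ, rotAt π I * rotAt (2 * π / 3) q = rotAt θ z := by
  obtain ⟨h1, h2, h3, -⟩ := two_cos_half_bounds hθ hθ'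
  have s3 : √3 ^ 2 = 3 := Real.sq_sqrt (by norm_num)
  have s3' : 0 < √3 := by positivity
  -- The trace of the product is -√3 cosh d, with d the distance from I to q, and has to be
  -- 2cos(θ/2). The required cosh is at least 1 because θ > 5π/3.
  obtain ⟨q, hq, hq'⟩ := exists_hv_add_hw (b := -(2 * cos (θ / 2)) / √3) (by
    rw [le_div_iff₀ s3']; nlinarith)
  have e : 2 * π / 3 / 2 = π / 3 := by ring
  have hI : hu I = 0 ∧ hv I = 1 := by simp [hu, hv]
  refine ⟨q, eq_rotAt (by linarith [pi_pos]) hθ' ?_ ?_⟩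
  · rw [mul_10, rotAt_10, rotAt_11, rotAt_00, rotAt_10, e, hq, hI.1, hI.2]
    simp
  · simp only [tr, mul_00, mul_11, rotAt_00, rotAt_01, rotAt_10, rotAt_11, e, hq, cos_pi_div_two,
      sin_pi_div_two, cos_pi_div_three, sin_pi_div_three]
    simp only [hu, hv, hw, I_re, I_im]
    have : (hv q + hw q) * √3 = -2 * (2 * cos (θ / 2)) := by rw [hq']; field_simp
    simp only [hv, hw] at this
    linear_combination (-1 / 2 : ℝ) * this

/-- The peripheral angles of the representation. -/
def baseAngles (θ : ℝ) : Fin 4 → ℝ := ![4 * π / 3, θ, θ, 2 * θ - 2 * π]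

section model

variable {q z : ℍ} (hq : rotAt π I * rotAt (2 * π / 3) q = rotAt θ z)

/-- The representation of the free product by rotations of angles `π` and `2π/3`. -/
def triangleHom (q : ℍ) : ModularProduct →* PSL(2, ℝ) :=
  ModularProduct.lift ![(rotAt π I : PSL(2, ℝ)), (rotAt (2 * π / 3) q : PSL(2, ℝ))] (by
    intro i
    fin_cases i
    · change (rotAt π I : PSL(2, ℝ)) ^ 2 = 1
      rw [← QuotientGroup.mk_pow, pow_two, rotAt_pi_sq, mk_neg, QuotientGroup.mk_one]
    · change (rotAt (2 * π / 3) q : PSL(2, ℝ)) ^ 3 = 1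
      rw [← QuotientGroup.mk_pow, pow_succ, pow_two, rotAt_third_cube, mk_neg,
        QuotientGroup.mk_one])

theorem triangleHom_s : triangleHom q ModularProduct.s = (rotAt π I : PSL(2, ℝ)) :=
  ModularProduct.lift_s _ _

theorem triangleHom_r : triangleHom q ModularProduct.r = (rotAt (2 * π / 3) q : PSL(2, ℝ)) :=
  ModularProduct.lift_r _ _

/-- The fixed points of the peripheral rotations. -/
def baseCenters (q z : ℍ) : Fin 4 → ℍ := ![q, z, (rotAt π I)⁻¹ • z, z]

theorem rotAt_mul_swap (hq : rotAt π I * rotAt (2 * π / 3) q = rotAt θ z) : rotAt θ ((rotAt π I)⁻¹ • z) = rotAt (2 * π / 3) q * rotAt π I := by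
  rw [← conj_rotAt, ← hq]
  group

theorem rotAt_double (z : ℍ) : rotAt (2 * θ - 2 * π) z = -(rotAt θ z * rotAt θ z) := by
  rw [rotAt_sub_two_pi, rotAt_mul_same, two_mul]

theorem triangleHom_peripheral (hq : rotAt π I * rotAt (2 * π / 3) q = rotAt θ z) (i : Fin 4) :
    triangleHom q (ModularProduct.peripheral (c i)) =
      (rotAt (baseAngles θ i) (baseCenters q z i) : PSL(2, ℝ)) := by
  simp only [ModularProduct.peripheral, sphereHom_c]
  fin_cases i
  · change triangleHom q ModularProduct.r⁻¹ = (rotAt (4 * π / 3) q : PSL(2, ℝ))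
    rw [map_inv, triangleHom_r, rotAt_third_inv, mk_neg, QuotientGroup.mk_inv]
  · change triangleHom q (ModularProduct.s * ModularProduct.r) = (rotAt θ z : PSL(2, ℝ))
    rw [map_mul, triangleHom_s, triangleHom_r, ← hq, QuotientGroup.mk_mul]
  · change triangleHom q (ModularProduct.r * ModularProduct.s) =
      (rotAt θ ((rotAt π I)⁻¹ • z) : PSL(2, ℝ))
    rw [map_mul, triangleHom_s, triangleHom_r, rotAt_mul_swap hq, QuotientGroup.mk_mul]
  · change triangleHom q (ModularProduct.s * ModularProduct.r * (ModularProduct.s *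
      ModularProduct.r)) = (rotAt (2 * θ - 2 * π) z : PSL(2, ℝ))
    rw [map_mul, map_mul, triangleHom_s, triangleHom_r, rotAt_double, mk_neg, ← hq,
      QuotientGroup.mk_mul, QuotientGroup.mk_mul]

/-- The representation of the fundamental group with image a triangle group. -/
def baseRep (hq : rotAt π I * rotAt (2 * π / 3) q = rotAt θ z) : RelHom (baseAngles θ) :=
  ⟨(triangleHom q).comp ModularProduct.peripheral, fun i =>
    ⟨baseCenters q z i, isRotation_iff.2 (triangleHom_peripheral hq i)⟩⟩

theorem baseRep_isCenters : IsCenters (baseRep hq) (baseCenters q z) := triangleHom_peripheral hq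

theorem sl_product {S B : SL(2, ℝ)} (hS : S * S = -1) (hB : B * B * B = -1) :
    -B⁻¹ * (S * B) * (B * S) * -(S * B * (S * B)) = -1 := by
  have e : -B⁻¹ * (S * B) * (B * S) * -(S * B * (S * B)) =
      B⁻¹ * (S * B * (B * (S * S) * B) * S) * B := by
    simp only [neg_mul, mul_neg, neg_neg]
    group
  rw [e, hS]
  have e2 : S * B * (B * (-1) * B) * S = -(S * (B * B * B) * S) := by
    simp only [neg_mul, mul_neg, mul_one, mul_assoc]
  rw [e2, hB]
  simp [hS]

theorem liftProd_base (hq : rotAt π I * rotAt (2 * π / 3) q = rotAt θ z) : liftProd (baseAngles θ) (baseCenters q z) = -1 := by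
  simp only [liftProd, baseAngles, baseCenters, Matrix.cons_val]
  rw [rotAt_mul_swap hq, rotAt_third_inv, rotAt_double, ← hq]
  exact sl_product (rotAt_pi_sq I) (rotAt_third_cube q)

/-- The first and third products are, up to sign and conjugacy, the half-turn, of trace 0. The
second is minus a conjugate of the square of the rotation of order three. -/
theorem traces_base (hq : rotAt π I * rotAt (2 * π / 3) q = rotAt θ z) : trX (baseAngles θ) (baseCenters q z) = 0 ∧
    trY (baseAngles θ) (baseCenters q z) = 1 ∧ trZ (baseAngles θ) (baseCenters q z) = 0 := by
  simp only [trX, trY, trZ, baseAngles, baseCenters, Matrix.cons_val]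
  rw [rotAt_mul_swap hq, rotAt_third_inv, ← hq]
  have h0 : tr (rotAt π I) = 0 := by simp
  refine ⟨?_, ?_, ?_⟩
  · rw [neg_mul, tr_neg, ← mul_assoc, tr_mul_comm, ← mul_assoc, mul_inv_cancel, one_mul, h0,
      neg_zero]
  · rw [← mul_assoc, tr_mul_comm, ← mul_assoc, ← mul_assoc, rotAt_pi_sq, mul_assoc, neg_mul,
      one_mul, tr_neg, rotAt_mul_same, tr_rotAt,
      show (2 * π / 3 + 2 * π / 3) / 2 = 4 * π / 3 / 2 by ring, two_cos_two_pi_div_three, neg_neg]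
  · rw [neg_mul, tr_neg, inv_mul_cancel_left, h0, neg_zero]

/-! ### The orbit of the base representation -/

theorem isLarge_base (hθ : 5 * π / 3 < θ) (hθ' : θ < 2 * π) : IsLarge (baseAngles θ) :=
  isLarge_of_perm hθ hθ' 1

theorem coef_base : coef (baseAngles θ) (-1) = ![(2 * cos (θ / 2)) ^ 3 - 3 * (2 * cos (θ / 2)), 2,
    (2 * cos (θ / 2)) ^ 3 - 3 * (2 * cos (θ / 2))] := by
  rw [baseAngles, coef_cons, two_cos_two_pi_div_three, two_cos_half_double]
  refine congrArg₂ _ ?_ (congrArg₂ _ ?_ (congrArg₂ _ ?_ rfl)) <;> ring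

theorem sgn_base (hθ : 5 * π / 3 < θ) (hθ' : θ < 2 * π) : sgn (CharVar.mk (baseRep hq)) = -1 := by
  rw [(sgn_traceVec_mk (isLarge_base hθ hθ').bounds (baseRep_isCenters hq)).1, liftProd_base hq]
  simp

theorem traceVec_base (hθ : 5 * π / 3 < θ) (hθ' : θ < 2 * π) :
    traceVec (CharVar.mk (baseRep hq)) = ![0, 1, 0] := by
  obtain ⟨h1, h2, h3⟩ := traces_base hq
  rw [(sgn_traceVec_mk (isLarge_base hθ hθ').bounds (baseRep_isCenters hq)).2, h1, h2, h3]

/-- The base representation factors through `ModularProduct.peripheral`, where pure automorphisms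
reduce to powers of `twistY` up to conjugation. -/
theorem smul_base_eq (φ : PureAut) : ∃ n : ℕ, n < 3 ∧
    φ • CharVar.mk (baseRep hq) = twists 1 ^ n • CharVar.mk (baseRep hq) := by
  obtain ⟨w, n, hn, h⟩ := ModularProduct.peripheral_pureAut (φ⁻¹).2
  refine ⟨n, hn, ?_⟩
  have e : twists 1 ^ n • CharVar.mk (baseRep hq) =
      CharVar.mk (precomp (baseRep hq) (twistY ^ n) (PureAut.pow_mem twistY_mem n)) := by
    rw [mk_precomp]
    change ((⟨twistY, twistY_mem⟩ : PureAut)⁻¹) ^ n • _ = _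
    rw [inv_pow]
    rfl
  rw [e, smul_mk_eq]
  symm
  refine mk_eq_mk_of_conj (triangleHom q w) fun i => ?_
  rw [precomp_apply, precomp_apply]
  change triangleHom q (ModularProduct.peripheral _) = _ * triangleHom q (ModularProduct.peripheral _) * _
  rw [h, map_mul, map_mul, map_inv]

theorem twistMap_base {f : ℝ} : twistMap ![f, 2, f] 1 ![0, 1, 0] = ![0, 1, f] ∧
    twistMap ![f, 2, f] 1 ![0, 1, f] = ![f, 1, 0] := by
  constructor <;> simp [twistMap, twistPair]

theorem traceVec_twist_base (hθ : 5 * π / 3 < θ) (hθ' : θ < 2 * π) :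
    sgn (twists 1 • CharVar.mk (baseRep hq)) = -1 ∧
    traceVec (twists 1 • CharVar.mk (baseRep hq)) =
      ![0, 1, (2 * cos (θ / 2)) ^ 3 - 3 * (2 * cos (θ / 2))] ∧
    sgn (twists 1 • twists 1 • CharVar.mk (baseRep hq)) = -1 ∧
    traceVec (twists 1 • twists 1 • CharVar.mk (baseRep hq)) =
      ![(2 * cos (θ / 2)) ^ 3 - 3 * (2 * cos (θ / 2)), 1, 0] := by
  have hb := (isLarge_base hθ hθ').bounds
  obtain ⟨h1, h2⟩ := twists_smul hb 1 (CharVar.mk (baseRep hq))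
  obtain ⟨h3, h4⟩ := twists_smul hb 1 (twists 1 • CharVar.mk (baseRep hq))
  rw [sgn_base hq hθ hθ'] at h1 h2
  rw [h1] at h3 h4
  rw [traceVec_base hq hθ hθ', coef_base, twistMap_base.1] at h2
  rw [h2, coef_base, twistMap_base.2] at h4
  exact ⟨h1, h2, h3, h4⟩

/-- There are at most three points by `smul_base_eq`. Their trace vectors (0, 1, 0), (0, 1, f), (f,
1, 0) differ because f ≠ 0. -/
theorem isOrbit_base (hθ : 5 * π / 3 < θ) (hθ' : θ < 2 * π) :
    IsOrbitOfLengthThree (baseAngles θ) (MulAction.orbit PureAut (CharVar.mk (baseRep hq))) := by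
  obtain ⟨s1, t1, s2, t2⟩ := traceVec_twist_base hq hθ hθ'
  have s0 := sgn_base hq hθ hθ'
  have t0 := traceVec_base hq hθ hθ'
  have hO : MulAction.orbit PureAut (CharVar.mk (baseRep hq)) = {CharVar.mk (baseRep hq),
      twists 1 • CharVar.mk (baseRep hq), twists 1 • twists 1 • CharVar.mk (baseRep hq)} := by
    ext X
    constructor
    · rintro ⟨φ, rfl⟩
      obtain ⟨n, hn, h⟩ := smul_base_eq hq φ
      change φ • _ ∈ _
      rw [h]
      interval_cases n
      · left; rw [pow_zero, one_smul]
      · right; left; rw [pow_one]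
      · right; right; rw [pow_two, mul_smul]; rfl
    · rintro (rfl | rfl | rfl)
      · exact MulAction.mem_orbit_self _
      · exact MulAction.mem_orbit _ _
      · rw [← mul_smul]; exact MulAction.mem_orbit _ _
  have hf := (triple_bounds hθ hθ').2.ne
  set f := (2 * cos (θ / 2)) ^ 3 - 3 * (2 * cos (θ / 2))
  refine ⟨⟨_, rfl⟩, ?_, ?_⟩
  · rw [hO]
    rintro X (rfl | rfl | rfl)
    exacts [mem_DTComponent_of_sgn (isLarge_base hθ hθ').bounds s0,
      mem_DTComponent_of_sgn (isLarge_base hθ hθ').bounds s1,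
      mem_DTComponent_of_sgn (isLarge_base hθ hθ').bounds s2]
  · rw [hO, Set.ncard_eq_three]
    refine ⟨_, _, _, fun h => ?_, fun h => ?_, fun h => ?_, rfl⟩
    · have := congrArg traceVec h
      rw [t0, t1, cons3_inj] at this
      exact hf this.2.2.symm
    · have := congrArg traceVec h
      rw [t0, t2, cons3_inj] at this
      exact hf this.1.symm
    · have := congrArg traceVec h
      rw [t1, t2, cons3_inj] at this
      exact hf this.1.symm

/-- By the classification every orbit of length three contains a class with traces (0, 1, 0). Traces
determine the class, so this is the base class. -/
theorem eq_orbit_base (hθ : 5 * π / 3 < θ) (hθ' : θ < 2 * π) {O : Set (CharVar (baseAngles θ))}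
    (hO : IsOrbitOfLengthThree (baseAngles θ) O) :
    O = MulAction.orbit PureAut (CharVar.mk (baseRep hq)) := by
  have hα := isLarge_base hθ hθ'
  obtain ⟨i, y, hy, hki, H⟩ := (isTwistDynamics hα hO).classification
  have hf := (triple_sq_lt hθ hθ').ne
  rw [coef_base] at hki
  obtain rfl : i = 1 := by
    fin_cases i
    · exact absurd (sq_eq_four_of_eq hy hki) hf
    · rfl
    · exact absurd (sq_eq_four_of_eq hy hki) hf
  obtain ⟨-, -, hE⟩ := H 0 2 (by decide) (by decide) (by decide)
  simp only [Matrix.cons_val] at hki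
  obtain ⟨X, hX, hXt⟩ := (hE ![0, 1, 0]).2 ⟨show (1 : ℝ) = y by linarith, .inr (.inr ⟨rfl, rfl⟩)⟩
  have e : X = CharVar.mk (baseRep hq) := eq_of_traceVec_eq hα.bounds (sgn_of_orbit hα hO hX)
    (sgn_base hq hθ hθ') (hXt.trans (traceVec_base hq hθ hθ').symm)
  subst e
  obtain ⟨⟨Y, rfl⟩, -⟩ := hO
  exact (MulAction.orbit_eq_iff.2 hX).symm

end model

end PuncturedSphere

end

noncomputable section
namespace PuncturedSphere
open SphereGroup

/-! ### Rotation triangle groups -/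

theorem interiorAngle_smul (h : SL(2, ℝ)) {P Q R : ℍ} (hQ : Q ≠ P) :
    interiorAngle (h • P) (h • Q) (h • R) = interiorAngle P Q R := by
  obtain ⟨r, hr, e⟩ := discCoord_div (B := P) (P := Q) (Q := R)
  obtain ⟨r', hr', e'⟩ := discCoord_div (B := h • P) (P := h • Q) (Q := h • R)
  rw [interiorAngle, interiorAngle, e hQ, e' (fun H => hQ (MulAction.injective h H)),
    Complex.arg_real_mul _ hr, Complex.arg_real_mul _ hr', ip_smul, ip_smul, ip_smul, vol_smul]

/-- The Gram determinant of three vectors of the hyperboloid. It gives the sine of an angle, up to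
sign, from distances alone. -/
theorem gram (P Q R : ℍ) : (vol P Q R / 2) ^ 2 =
    (ip P Q ^ 2 - 1) * (ip P R ^ 2 - 1) - (ip P Q * ip P R - ip Q R) ^ 2 := by
  have e1 := hw_mul_hv P
  have e2 := hw_mul_hv Q
  have e3 := hw_mul_hv R
  have v1 := (hv_pos P).ne'
  have v2 := (hv_pos Q).ne'
  have v3 := (hv_pos R).ne'
  rw [← eq_div_iff v1] at e1
  rw [← eq_div_iff v2] at e2
  rw [← eq_div_iff v3] at e3
  simp only [ip, vol, e1, e2, e3]
  field_simp
  ring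

/-- The law of cosines, with k the product of the sinh of the two sides at P. The undetermined sign
of the volume disappears in the absolute value. -/
theorem interiorAngle_eq {P Q R : ℍ} (hQ : Q ≠ P) {a k : ℝ} (ha : 0 < a) (ha' : a < π)
    (hk : 0 < k) (h1 : ip P Q * ip P R - ip Q R = k * cos a)
    (h2 : (ip P Q ^ 2 - 1) * (ip P R ^ 2 - 1) = k ^ 2) : interiorAngle P Q R = a := by
  obtain ⟨r, hr, e⟩ := discCoord_div (B := P) (P := Q) (Q := R)
  rw [interiorAngle, e hQ, Complex.arg_real_mul _ hr, h1]
  have hv : (vol P Q R / 2) ^ 2 = (k * sin a) ^ 2 := by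
    rw [gram, h1, h2]
    linear_combination (-k ^ 2) * sin_sq_add_cos_sq a
  rcases sq_eq_sq_iff_eq_or_eq_neg.1 hv with h | h
  · rw [h, show (((k * cos a : ℝ) : ℂ) + ((k * sin a : ℝ) : ℂ) * Complex.I) =
      (k : ℂ) * (Complex.cos a + Complex.sin a * Complex.I) by push_cast; ring,
      Complex.arg_mul_cos_add_sin_mul_I hk ⟨by linarith, ha'.le⟩, abs_of_pos ha]
  · rw [h, show (((k * cos a : ℝ) : ℂ) + ((-(k * sin a) : ℝ) : ℂ) * Complex.I) =
      (k : ℂ) * (Complex.cos ((-a : ℝ) : ℂ) + Complex.sin ((-a : ℝ) : ℂ) * Complex.I) by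
        push_cast; rw [Complex.cos_neg, Complex.sin_neg]; ring,
      Complex.arg_mul_cos_add_sin_mul_I hk ⟨by linarith, by linarith⟩, abs_neg, abs_of_pos ha]

theorem isRotation_smul {h : SL(2, ℝ)} {P : ℍ} {φ : ℝ} {g : PSL(2, ℝ)} :
    IsRotation g (h • P) φ ↔ ∃ g', IsRotation g' P φ ∧ (h : PSL(2, ℝ)) * g' * (h : PSL(2, ℝ))⁻¹ = g := by
  simp only [isRotation_iff, exists_eq_left, ← conj_rotAt, QuotientGroup.mk_mul,
    QuotientGroup.mk_inv]
  exact eq_comm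

theorem IsRotationTriangleGroup.conj {p q r : ℝ} {Γ : Subgroup PSL(2, ℝ)}
    (H : IsRotationTriangleGroup p q r Γ) (k : PSL(2, ℝ)) :
    IsRotationTriangleGroup p q r (Γ.map (MulAut.conj k).toMonoidHom) := by
  obtain ⟨h, rfl⟩ := QuotientGroup.mk_surjective k
  obtain ⟨P, Q, R, h1, h2, h3, a1, a2, a3, rfl⟩ := H
  refine ⟨h • P, h • Q, h • R, fun H => h1 (MulAction.injective h H),
    fun H => h2 (MulAction.injective h H), fun H => h3 (MulAction.injective h H), ?_, ?_, ?_, ?_⟩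
  · rw [interiorAngle_smul h h1.symm, a1]
  · rw [interiorAngle_smul h h2.symm, a2]
  · rw [interiorAngle_smul h h3.symm, a3]
  · rw [MonoidHom.map_closure]
    congr 1
    ext g
    simp only [Set.mem_image, Set.mem_ofPred_eq, isRotation_smul, or_and_right, exists_or]
    rfl

theorem range_le_of_c_mem {G : Type*} [Group G] {f : SphereGroup →* G} {K : Subgroup G}
    (h : ∀ i, f (c i) ∈ K) : f.range ≤ K := by
  rw [MonoidHom.range_eq_map, ← PresentedGroup.closure_range_of, MonoidHom.map_closure,
    Subgroup.closure_le]
  rintro _ ⟨_, ⟨i, rfl⟩, rfl⟩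
  exact h i

variable {θ : ℝ} {q z : ℍ}

theorem sin_half_pos (hθ : 5 * π / 3 < θ) (hθ' : θ < 2 * π) : 0 < sin (θ / 2) :=
  sin_pos_of_pos_of_lt_pi (by linarith [pi_pos]) (by linarith)

/-- The product of two of the three rotations is, up to sign and conjugacy, the third or its
inverse; its known trace gives the distance of the two centres. -/
theorem ip_base (hq : rotAt π I * rotAt (2 * π / 3) q = rotAt θ z) :
    √3 * ip I q = -2 * cos (θ / 2) ∧ 2 * sin (θ / 2) * ip I z = 1 ∧
      √3 * sin (θ / 2) * ip q z = -cos (θ / 2) := by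
  have e : 2 * π / 3 / 2 = π / 3 := by ring
  have e' : 4 * π / 3 / 2 = π - π / 3 := by ring
  refine ⟨?_, ?_, ?_⟩
  · have h := congrArg tr hq
    rw [tr_rotAt_mul, tr_rotAt, e, cos_pi_div_two, sin_pi_div_two, sin_pi_div_three] at h
    linear_combination -h
  · have h : rotAt π I * rotAt θ z = -rotAt (2 * π / 3) q := by
      rw [← hq, ← mul_assoc, rotAt_pi_sq, neg_mul, one_mul]
    have h := congrArg tr h
    rw [tr_rotAt_mul, tr_neg, tr_rotAt, e, cos_pi_div_two, sin_pi_div_two, cos_pi_div_three] at h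
    linear_combination -h
  · have h : rotAt (4 * π / 3) q * rotAt θ z = -((rotAt (2 * π / 3) q)⁻¹ * rotAt π I *
        rotAt (2 * π / 3) q) := by
      rw [← hq, rotAt_third_inv, neg_mul, mul_assoc]
    have h := congrArg tr h
    rw [tr_rotAt_mul, tr_neg, tr_mul_comm (_ * _) (rotAt _ q), ← mul_assoc, mul_inv_cancel, one_mul, tr_rotAt,
      e', cos_pi_sub, sin_pi_sub, cos_pi_div_two, cos_pi_div_three, sin_pi_div_three] at h
    linear_combination -h

theorem isRotationTriangleGroup_base (hθ : 5 * π / 3 < θ) (hθ' : θ < 2 * π)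
    (hq : rotAt π I * rotAt (2 * π / 3) q = rotAt θ z) :
    IsRotationTriangleGroup 2 3 (1 - θ / (2 * π))⁻¹ (baseRep hq).1.range := by
  obtain ⟨i1, i2, i3⟩ := ip_base hq
  obtain ⟨-, t2, t3, -⟩ := two_cos_half_bounds hθ hθ'
  have hs := sin_half_pos hθ hθ'
  have hsc := sin_sq_add_cos_sq (θ / 2)
  have s3 : √3 ^ 2 = 3 := Real.sq_sqrt (by norm_num)
  have s3' : 0 < √3 := by positivity
  set s := sin (θ / 2) with hsdef
  set C := cos (θ / 2) with hC
  set w := √3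
  have hs2 : s ^ 2 = 1 - C ^ 2 := by linarith
  have w4 : w ^ 4 = 9 := by rw [show w ^ 4 = (w ^ 2) ^ 2 by ring, s3]; norm_num
  have hK : 0 < 4 * C ^ 2 - 3 := by linarith
  have j1 : ip I q = -2 * C / w := by rw [eq_div_iff s3'.ne']; linarith
  have j2 : ip I z = 1 / (2 * s) := by rw [eq_div_iff (by positivity)]; linarith
  have j3 : ip q z = -C / (w * s) := by rw [eq_div_iff (by positivity)]; linarith
  have n1 : I ≠ q := fun h => by
    have := ip_eq_one_iff.2 h
    rw [this] at i1
    nlinarith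
  have n2 : q ≠ z := fun h => by
    have := ip_eq_one_iff.2 h
    rw [this] at i3
    have : (w * s) ^ 2 = C ^ 2 := by rw [show w * s = -C by linarith]; ring
    rw [mul_pow, s3] at this
    nlinarith
  have n3 : z ≠ I := fun h => by
    have := ip_eq_one_iff.2 h.symm
    rw [this] at i2
    nlinarith
  have eθ : π / (1 - θ / (2 * π))⁻¹ = π - θ / 2 := by
    have := pi_pos.ne'
    rw [div_inv_eq_mul]
    field_simp
  have eθ' : 2 * π / (1 - θ / (2 * π))⁻¹ = 2 * π - θ := by
    rw [mul_div_assoc, eθ]; ring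
  -- The triangle group prescribes the rotation of angle 2π - θ, twice the interior angle π - θ/2.
  -- It is the inverse of ρ(c₂), so the generated group is the same.
  have hrot : (rotAt (2 * π - θ) z : PSL(2, ℝ)) = (rotAt θ z : PSL(2, ℝ))⁻¹ := by
    rw [eq_inv_iff_mul_eq_one, ← QuotientGroup.mk_mul, rotAt_mul_same, sub_add_cancel, rotAt_two_pi,
      mk_neg, QuotientGroup.mk_one]
  refine ⟨I, q, z, n1, n2, n3, ?_, ?_, ?_, ?_⟩
  · refine interiorAngle_eq n1.symm (k := (4 * C ^ 2 - 3) / (2 * w * s)) (by positivity)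
      (by linarith [pi_pos]) (by positivity) ?_ ?_
    · rw [j1, j2, j3, cos_pi_div_two]; field_simp; ring
    · rw [j1, j2]; field_simp; rw [s3, hs2]; ring
  · refine interiorAngle_eq n2.symm (k := (4 * C ^ 2 - 3) / (3 * s)) (by positivity)
      (by linarith [pi_pos]) (by positivity) ?_ ?_
    · rw [ip_comm z I, ip_comm q I, j1, j2, j3, cos_pi_div_three]; field_simp; rw [s3]; ring
    · rw [ip_comm q I, j1, j3]; field_simp; rw [w4, s3, hs2]; ring
  · rw [eθ]
    refine interiorAngle_eq n3.symm (k := (4 * C ^ 2 - 3) / (2 * w * s ^ 2)) (by linarith)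
      (by linarith [pi_pos]) (by positivity) ?_ ?_
    · rw [ip_comm z I, ip_comm z q, j1, j2, j3, cos_pi_sub, ← hC]; field_simp; rw [hs2]; ring
    · rw [ip_comm z I, ip_comm z q, j2, j3]; field_simp; rw [s3, hs2]; ring
  · have b := triangleHom_peripheral hq
    have hset : {g : PSL(2, ℝ) | IsRotation g I (2 * π / 2) ∨ IsRotation g q (2 * π / 3) ∨
        IsRotation g z (2 * π / (1 - θ / (2 * π))⁻¹)} = {(rotAt π I : PSL(2, ℝ)),
        (rotAt (2 * π / 3) q : PSL(2, ℝ)), (rotAt θ z : PSL(2, ℝ))⁻¹} := by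
      ext g
      simp only [isRotation_iff, eθ', hrot, Set.mem_ofPred_eq, Set.mem_insert_iff,
        Set.mem_singleton_iff, mul_div_cancel_left₀ π (two_ne_zero' ℝ)]
    rw [hset]
    apply le_antisymm
    · set K := Subgroup.closure {(rotAt π I : PSL(2, ℝ)), (rotAt (2 * π / 3) q : PSL(2, ℝ)),
        (rotAt θ z : PSL(2, ℝ))⁻¹}
      have hS : triangleHom q ModularProduct.s ∈ K :=
        triangleHom_s (q := q) ▸ Subgroup.subset_closure (by simp)
      have hR : triangleHom q ModularProduct.r ∈ K :=
        triangleHom_r (q := q) ▸ Subgroup.subset_closure (by simp)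
      refine range_le_of_c_mem fun i => ?_
      change triangleHom q (ModularProduct.peripheral (c i)) ∈ K
      rw [ModularProduct.peripheral, sphereHom_c]
      fin_cases i
      · exact map_inv (triangleHom q) _ ▸ K.inv_mem hR
      · exact map_mul (triangleHom q) _ _ ▸ K.mul_mem hS hR
      · exact map_mul (triangleHom q) _ _ ▸ K.mul_mem hR hS
      · change triangleHom q (ModularProduct.s * ModularProduct.r * (ModularProduct.s *
          ModularProduct.r)) ∈ K
        rw [map_mul, map_mul]
        exact K.mul_mem (K.mul_mem hS hR) (K.mul_mem hS hR)
    · rw [Subgroup.closure_le]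
      have hp : ∀ x, triangleHom q (ModularProduct.peripheral x) ∈ (baseRep hq).1.range :=
        fun x => ⟨x, rfl⟩
      have p0 : ModularProduct.peripheral (c 0) = ModularProduct.r⁻¹ := by
        rw [ModularProduct.peripheral, sphereHom_c]; rfl
      have p1 : ModularProduct.peripheral (c 1) = ModularProduct.s * ModularProduct.r := by
        rw [ModularProduct.peripheral, sphereHom_c]; rfl
      rintro g (rfl | rfl | rfl)
      -- The half-turn is recovered as s = (sr)r⁻¹.
      · have := hp (c 1 * c 0)
        rwa [map_mul, p0, p1, mul_inv_cancel_right, triangleHom_s] at this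
      · have := hp (c 0)⁻¹
        rwa [map_inv, p0, inv_inv, triangleHom_r] at this
      · have := hp (c 1)⁻¹
        rwa [map_inv, map_inv, b 1] at this

/-- The images of all representations in the orbit are triangle groups. -/
theorem isRotationTriangleGroup_of_mem_orbit (hθ : 5 * π / 3 < θ) (hθ' : θ < 2 * π)
    (hq : rotAt π I * rotAt (2 * π / 3) q = rotAt θ z) {ρ : RelHom (baseAngles θ)}
    (hρ : CharVar.mk ρ ∈ MulAction.orbit PureAut (CharVar.mk (baseRep hq))) :
    IsRotationTriangleGroup 2 3 (1 - θ / (2 * π))⁻¹ ρ.1.range := by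
  obtain ⟨φ, hφ⟩ := hρ
  obtain ⟨k, hk⟩ := conj_of_mk_eq_mk (ρ := φ • baseRep hq) hφ
  have e : ρ.1 = (MulAut.conj k).toMonoidHom.comp
      ((baseRep hq).1.comp ((φ⁻¹ : PureAut) : MulAut SphereGroup).toMonoidHom) :=
    MonoidHom.ext hk
  have h := (isRotationTriangleGroup_base hθ hθ' hq).conj k
  rw [e, MonoidHom.range_comp, MonoidHom.range_comp,
    MonoidHom.range_eq_top.2 (MulEquiv.surjective _), ← MonoidHom.range_eq_map]
  exact h

end PuncturedSphere

end

noncomputable section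
namespace PuncturedSphere
open SphereGroup

/-! ### Permuting the punctures -/

/-- The automorphism `B` permutes the peripheral conjugacy classes by `σ`. -/
def Permutes (B : MulAut SphereGroup) (σ : Equiv.Perm (Fin 4)) : Prop :=
  ∀ i, IsConj (c (σ i)) (B (c i))

theorem Permutes.one : Permutes 1 1 := fun i => IsConj.refl (c i)

theorem Permutes.mul {B B' : MulAut SphereGroup} {σ τ : Equiv.Perm (Fin 4)} (h : Permutes B σ)
    (h' : Permutes B' τ) : Permutes (B * B') (σ * τ) :=
  fun i => (h (τ i)).trans (B.toMonoidHom.map_isConj (h' i))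

theorem Permutes.inv {B : MulAut SphereGroup} {σ : Equiv.Perm (Fin 4)} (h : Permutes B σ) :
    Permutes B⁻¹ σ⁻¹ := by
  intro i
  have h1 := (B⁻¹ : MulAut SphereGroup).toMonoidHom.map_isConj (h (σ⁻¹ i))
  rw [show σ (σ⁻¹ i) = i from σ.apply_symm_apply i] at h1
  have e : (B⁻¹ : MulAut SphereGroup) (B (c (σ⁻¹ i))) = c (σ⁻¹ i) := MulAut.inv_apply_self _ B _
  change IsConj ((B⁻¹ : MulAut SphereGroup) (c i)) ((B⁻¹ : MulAut SphereGroup) (B (c (σ⁻¹ i)))) at h1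
  rw [e] at h1
  exact h1.symm

/-- The braid exchanging the first two punctures. -/
def braidZero : MulAut SphereGroup :=
  sphereAut (sphereHom ![c 0 * c 1 * (c 0)⁻¹, c 0, c 2, c 3] (by simp [c_three]))
    (sphereHom ![c 1, (c 1)⁻¹ * c 0 * c 1, c 2, c 3] (by simp [c_three]; group))
    (by intro i; fin_cases i <;> simp [c_three] <;> group)
    (by intro i; fin_cases i <;> simp [c_three] <;> group)

/-- The braid exchanging the second and the third puncture. -/
def braidOne : MulAut SphereGroup :=
  sphereAut (sphereHom ![c 0, c 1 * c 2 * (c 1)⁻¹, c 1, c 3] (by simp [c_three]; group))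
    (sphereHom ![c 0, c 2, (c 2)⁻¹ * c 1 * c 2, c 3] (by simp [c_three]; group))
    (by intro i; fin_cases i <;> simp [c_three] <;> group)
    (by intro i; fin_cases i <;> simp [c_three] <;> group)

/-- The braid exchanging the last two punctures. -/
def braidTwo : MulAut SphereGroup :=
  sphereAut (sphereHom ![c 0, c 1, c 2 * c 3 * (c 2)⁻¹, c 2] (by simp [c_three]; group))
    (sphereHom ![c 0, c 1, c 3, (c 3)⁻¹ * c 2 * c 3] (by simp [c_three]; group))
    (by intro i; fin_cases i <;> simp [c_three] <;> group)
    (by intro i; fin_cases i <;> simp [c_three] <;> group)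

theorem permutes_braidZero : Permutes braidZero (Equiv.swap 0 1) := by
  intro i
  fin_cases i <;> simp only [braidZero, sphereAut_apply, sphereHom_c]
  exacts [isConj_mul_inv _ _, IsConj.refl _, IsConj.refl _, IsConj.refl _]

theorem permutes_braidOne : Permutes braidOne (Equiv.swap 1 2) := by
  intro i
  fin_cases i <;> simp only [braidOne, sphereAut_apply, sphereHom_c]
  exacts [IsConj.refl _, isConj_mul_inv _ _, IsConj.refl _, IsConj.refl _]

theorem permutes_braidTwo : Permutes braidTwo (Equiv.swap 2 3) := by
  intro i
  fin_cases i <;> simp only [braidTwo, sphereAut_apply, sphereHom_c]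
  exacts [IsConj.refl _, IsConj.refl _, isConj_mul_inv _ _, IsConj.refl _]

/-- The three elementary braids realise the adjacent transpositions, which generate the symmetric
group. -/
theorem exists_permutes (σ : Equiv.Perm (Fin 4)) : ∃ B, Permutes B σ := by
  have h : σ ∈ Submonoid.closure (Set.range fun i : Fin 3 => Equiv.swap i.castSucc i.succ) := by
    rw [Equiv.Perm.mclosure_swap_castSucc_succ]; trivial
  induction h using Submonoid.closure_induction with
  | mem τ hτ =>
    obtain ⟨i, rfl⟩ := hτ
    fin_cases i
    exacts [⟨_, permutes_braidZero⟩, ⟨_, permutes_braidOne⟩, ⟨_, permutes_braidTwo⟩]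
  | one => exact ⟨1, Permutes.one⟩
  | mul τ τ' _ _ h h' =>
    obtain ⟨B, hB⟩ := h
    obtain ⟨B', hB'⟩ := h'
    exact ⟨_, hB.mul hB'⟩

/-! ### Transport of orbits between orderings of the angles -/

variable {α α' : Fin 4 → ℝ} {B : MulAut SphereGroup} {σ : Equiv.Perm (Fin 4)}

theorem exists_isRotation_of_isConj {ρ : RelHom α} {i : Fin 4} {x : SphereGroup}
    (h : IsConj (c i) x) : ∃ z, IsRotation (ρ.1 x) z (α i) := by
  obtain ⟨w, rfl⟩ := isConj_iff.1 h
  rw [map_mul, map_mul, map_inv]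
  exact exists_isRotation_conj (ρ.2 i) _

/-- Precomposition with an automorphism that permutes the punctures. -/
def pullRep (hB : Permutes B σ) (hα : ∀ i, α' i = α (σ i)) (ρ : RelHom α) : RelHom α' :=
  ⟨ρ.1.comp B.toMonoidHom, fun i => by
    rw [hα]
    exact exists_isRotation_of_isConj (hB i)⟩

/-- Precomposition on conjugacy classes. -/
def pull (hB : Permutes B σ) (hα : ∀ i, α' i = α (σ i)) : CharVar α → CharVar α' :=
  Quotient.map (pullRep hB hα) (by
    rintro ρ ρ' ⟨h, hh⟩
    exact ⟨h, fun g => hh (B g)⟩)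

theorem pull_mk (hB : Permutes B σ) (hα : ∀ i, α' i = α (σ i)) (ρ : RelHom α) :
    pull hB hα (CharVar.mk ρ) = CharVar.mk (pullRep hB hα ρ) := rfl

theorem continuous_pull (hB : Permutes B σ) (hα : ∀ i, α' i = α (σ i)) :
    Continuous (pull hB hα) := by
  refine continuous_quot_lift _ (continuous_quot_mk.comp ?_)
  refine continuous_induced_rng.2 (continuous_pi fun g => ?_)
  exact (continuous_apply (B g)).comp continuous_induced_dom

theorem angles_inv (hα : ∀ i, α' i = α (σ i)) (i : Fin 4) : α i = α' (σ⁻¹ i) := by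
  rw [hα, show σ (σ⁻¹ i) = i from σ.apply_symm_apply i]

theorem pull_inv_pull (hB : Permutes B σ) (hα : ∀ i, α' i = α (σ i)) (X : CharVar α) :
    pull hB.inv (angles_inv hα) (pull hB hα X) = X := by
  obtain ⟨ρ, rfl⟩ := exists_rep X
  rw [pull_mk, pull_mk]
  congr 1
  refine Subtype.ext (MonoidHom.ext fun g => ?_)
  change ρ.1 (B ((B⁻¹ : MulAut SphereGroup) g)) = ρ.1 g
  rw [MulAut.apply_inv_self]

theorem pull_pull_inv (hB : Permutes B σ) (hα : ∀ i, α' i = α (σ i)) (X : CharVar α') :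
    pull hB hα (pull hB.inv (angles_inv hα) X) = X := by
  obtain ⟨ρ, rfl⟩ := exists_rep X
  rw [pull_mk, pull_mk]
  congr 1
  refine Subtype.ext (MonoidHom.ext fun g => ?_)
  change ρ.1 ((B⁻¹ : MulAut SphereGroup) (B g)) = ρ.1 g
  rw [MulAut.inv_apply_self]

/-- Precomposition is a homeomorphism of relative character varieties. -/
def pullHomeomorph (hB : Permutes B σ) (hα : ∀ i, α' i = α (σ i)) : CharVar α ≃ₜ CharVar α' where
  toFun := pull hB hα
  invFun := pull hB.inv (angles_inv hα)
  left_inv := pull_inv_pull hB hα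
  right_inv := pull_pull_inv hB hα
  continuous_toFun := continuous_pull hB hα
  continuous_invFun := continuous_pull hB.inv (angles_inv hα)

/-- Pure automorphisms induce the trivial permutation of the punctures, so they are stable under
conjugation by B. -/
theorem pull_smul_mem (hB : Permutes B σ) (hα : ∀ i, α' i = α (σ i)) (φ : PureAut) (X : CharVar α) :
    pull hB hα (φ • X) ∈ MulAction.orbit PureAut (pull hB hα X) := by
  have hφ : B⁻¹ * φ * B ∈ PureAut := by
    have h1 : Permutes φ 1 := φ.2
    have h : Permutes (B⁻¹ * φ * B) (σ⁻¹ * 1 * σ) := (hB.inv.mul h1).mul hB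
    rw [mul_one, inv_mul_cancel] at h
    exact h
  refine ⟨⟨_, hφ⟩, ?_⟩
  obtain ⟨ρ, rfl⟩ := exists_rep X
  change CharVar.mk ((⟨_, hφ⟩ : PureAut) • pullRep hB hα ρ) = CharVar.mk (pullRep hB hα (φ • ρ))
  congr 1
  refine Subtype.ext (MonoidHom.ext fun g => ?_)
  change ρ.1 (B (((B⁻¹ * φ * B)⁻¹ : MulAut SphereGroup) g)) =
    ρ.1 (((φ⁻¹ : PureAut) : MulAut SphereGroup) (B g))
  rw [← MulAut.mul_apply, ← MulAut.mul_apply]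
  congr 2
  rw [InvMemClass.coe_inv]
  group

theorem pull_image_orbit (hB : Permutes B σ) (hα : ∀ i, α' i = α (σ i)) (X : CharVar α) :
    pull hB hα '' MulAction.orbit PureAut X = MulAction.orbit PureAut (pull hB hα X) := by
  apply subset_antisymm
  · rintro _ ⟨_, ⟨φ, rfl⟩, rfl⟩
    exact pull_smul_mem hB hα φ X
  · rintro _ ⟨φ, rfl⟩
    refine ⟨_, ?_, pull_pull_inv hB hα _⟩
    have := pull_smul_mem hB.inv (angles_inv hα) φ (pull hB hα X)
    rwa [pull_inv_pull] at this

theorem pull_mem_DTComponent (hB : Permutes B σ) (hα : ∀ i, α' i = α (σ i)) {X : CharVar α}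
    (hX : X ∈ DTComponent α) : pull hB hα X ∈ DTComponent α' := by
  have h := (pullHomeomorph hB hα).image_connectedComponentIn (s := Set.univ) (x := X) (Set.mem_univ X)
  rw [Set.image_univ, (pullHomeomorph hB hα).surjective.range_eq, connectedComponentIn_univ,
    connectedComponentIn_univ] at h
  change IsCompact (connectedComponent (pullHomeomorph hB hα X))
  rw [← h]
  exact IsCompact.image hX (pullHomeomorph hB hα).continuous

theorem IsOrbitOfLengthThree.pull (hB : Permutes B σ) (hα : ∀ i, α' i = α (σ i))
    {O : Set (CharVar α)} (hO : IsOrbitOfLengthThree α O) :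
    IsOrbitOfLengthThree α' (pull hB hα '' O) := by
  obtain ⟨⟨X, rfl⟩, hD, hc⟩ := hO
  refine ⟨⟨_, pull_image_orbit hB hα X⟩, ?_, ?_⟩
  · rintro _ ⟨Y, hY, rfl⟩
    exact pull_mem_DTComponent hB hα (hD hY)
  · exact (Set.ncard_image_of_injective _ (pullHomeomorph hB hα).injective).trans hc

/-- The homeomorphism matches orbits and compact components, and precomposition with an automorphism
does not change the image of a representation. -/
theorem orbits_of_permutes (hB : Permutes B σ) (hα : ∀ i, α' i = α (σ i)) {p q r : ℝ}
    (hu : ∃! O : Set (CharVar α), IsOrbitOfLengthThree α O)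
    (ht : ∀ O : Set (CharVar α), IsOrbitOfLengthThree α O → ∀ ρ : RelHom α, CharVar.mk ρ ∈ O →
      IsRotationTriangleGroup p q r ρ.1.range) :
    (∃! O : Set (CharVar α'), IsOrbitOfLengthThree α' O) ∧
    ∀ O : Set (CharVar α'), IsOrbitOfLengthThree α' O → ∀ ρ : RelHom α', CharVar.mk ρ ∈ O →
      IsRotationTriangleGroup p q r ρ.1.range := by
  constructor
  · obtain ⟨O, hO, huniq⟩ := hu
    refine ⟨_, hO.pull hB hα, fun O' hO' => ?_⟩
    rw [← huniq _ (hO'.pull hB.inv (angles_inv hα)), Set.image_image]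
    simp only [pull_pull_inv, Set.image_id']
  · intro O hO ρ hρ
    have h := ht _ (hO.pull hB.inv (angles_inv hα)) (pullRep hB.inv (angles_inv hα) ρ)
      ⟨_, hρ, rfl⟩
    change IsRotationTriangleGroup p q r (ρ.1.comp (B⁻¹ : MulAut SphereGroup).toMonoidHom).range at h
    rwa [MonoidHom.range_comp, MonoidHom.range_eq_top.2 (MulEquiv.surjective _),
      ← MonoidHom.range_eq_map] at h

end PuncturedSphere

end

/-! ### The lemma on orbits of Type III -/

theorem mainTheorem2 (θ : ℝ) (hθ : 5 * π / 3 < θ) (hθ' : θ < 2 * π) :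
    (∀ σ : Equiv.Perm (Fin 4),
      (∃! O : Set (CharVar (![4 * π / 3, θ, θ, 2 * θ - 2 * π] ∘ σ)), IsOrbitOfLengthThree _ O) ∧
      ∀ O : Set (CharVar (![4 * π / 3, θ, θ, 2 * θ - 2 * π] ∘ σ)), IsOrbitOfLengthThree _ O →
        ∀ ρ : RelHom (![4 * π / 3, θ, θ, 2 * θ - 2 * π] ∘ σ), CharVar.mk ρ ∈ O →
          IsRotationTriangleGroup 2 3 (1 - θ / (2 * π))⁻¹ ρ.1.range) ∧
    OrbitCoordinatesAre ![4 * π / 3, 2 * θ - 2 * π, θ, θ]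
      {(4 * π / 3, angle (0 : ℝ)),
        (4 * π / 3, angle (2 * π / 3 : ℝ)),
        (4 * π / 3, angle (4 * π / 3 : ℝ))} ∧
    OrbitCoordinatesAre ![2 * θ - 2 * π, 4 * π / 3, θ, θ]
      {(4 * π / 3, angle (π / 3 : ℝ)),
        (4 * π / 3, angle (π : ℝ)),
        (4 * π / 3, angle (5 * π / 3 : ℝ))} ∧
    OrbitCoordinatesAre ![θ, θ, 4 * π / 3, 2 * θ - 2 * π]
      {(2 * π / 3, angle (π / 3 : ℝ)),
        (2 * π / 3, angle (π : ℝ)),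
        (2 * π / 3, angle (5 * π / 3 : ℝ))} ∧
    OrbitCoordinatesAre ![θ, θ, 2 * θ - 2 * π, 4 * π / 3]
      {(2 * π / 3, angle (0 : ℝ)),
        (2 * π / 3, angle (2 * π / 3 : ℝ)),
        (2 * π / 3, angle (4 * π / 3 : ℝ))} ∧
    OrbitCoordinatesAre ![4 * π / 3, θ, 2 * θ - 2 * π, θ]
      {(π, angle (0 : ℝ)),
        (π, angle (π : ℝ)),
        (3 * θ - 4 * π, northPole)} ∧
    OrbitCoordinatesAre ![θ, 4 * π / 3, θ, 2 * θ - 2 * π]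
      {(π, angle (0 : ℝ)),
        (π, angle (π : ℝ)),
        (3 * θ - 4 * π, northPole)} ∧
    OrbitCoordinatesAre ![2 * θ - 2 * π, θ, 4 * π / 3, θ]
      {(π, angle (0 : ℝ)),
        (π, angle (π : ℝ)),
        (6 * π - 3 * θ, southPole)} ∧
    OrbitCoordinatesAre ![θ, 2 * θ - 2 * π, θ, 4 * π / 3]
      {(π, angle (0 : ℝ)),
        (π, angle (π : ℝ)),
        (6 * π - 3 * θ, southPole)} ∧
    OrbitCoordinatesAre ![4 * π / 3, θ, θ, 2 * θ - 2 * π]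
      {(π, angle (π / 2 : ℝ)),
        (π, angle (3 * π / 2 : ℝ)),
        (3 * θ - 4 * π, northPole)} ∧
    OrbitCoordinatesAre ![θ, 4 * π / 3, 2 * θ - 2 * π, θ]
      {(π, angle (π / 2 : ℝ)),
        (π, angle (3 * π / 2 : ℝ)),
        (3 * θ - 4 * π, northPole)} ∧
    OrbitCoordinatesAre ![θ, 2 * θ - 2 * π, 4 * π / 3, θ]
      {(π, angle (π / 2 : ℝ)),
        (π, angle (3 * π / 2 : ℝ)),
        (6 * π - 3 * θ, southPole)} ∧
    OrbitCoordinatesAre ![2 * θ - 2 * π, θ, θ, 4 * π / 3]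
      {(π, angle (π / 2 : ℝ)),
        (π, angle (3 * π / 2 : ℝ)),
        (6 * π - 3 * θ, southPole)} := by

  refine ⟨fun σ => ?_, orbit_coordinates hθ hθ'⟩
  obtain ⟨q, z, hq⟩ := exists_rotAt_mul_eq hθ hθ'
  obtain ⟨B, hB⟩ := exists_permutes σ
  refine orbits_of_permutes (α := baseAngles θ) hB (fun i => rfl)
    ⟨_, isOrbit_base hq hθ hθ', fun O hO => eq_orbit_base hq hθ hθ' hO⟩ fun O hO ρ hρ => ?_
  rw [eq_orbit_base hq hθ hθ' hO] at hρ
  exact isRotationTriangleGroup_of_mem_orbit hθ hθ' hq hρ
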